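/- Let $k$ be a field of characteristic $p>0$, let $n\ge 0$, and let $X$ be a geometrically reduced projective $k$-scheme of pure dimension $n$ (every irreducible component of $X$ has dimension $n$; $X$ need not be irreducible). Let $\mathcal L$ be an ample line bundle on $X$, let $D$ be a closed subscheme of $X$ of dimension less than $n$, and let $S$ be a zero-dimensional (possibly empty) subscheme of the smooth locus of $X$ over $k$ that does not meet $D$. Let $\mathbb P^n_k$ have homogeneous coordinates $x_0,\dots,x_n$, and let $H=\{x_0=0\}$ be the hyperplane at infinity. Then there exists a finite morphism $f\colon X\to\mathbb P^n_k$ of $k$-schemes such that: (a) $f$ is induced by an $(n+1)$-tuple $(s_0,\dots,s_n)$ of global sections of $\mathcal L^{\otimes d}$ for some integer $d\ge 1$; that is, for each $i$ the preimage of $\{x_i\neq 0\}$ is the open set where $s_i$ does not vanish, and on it $f^*(x_j/x_i)=s_j/s_i$ for all $j$; (b) $f$ is étale away from $H$, i.e. the restriction $f^{-1}(\mathbb P^n_k\setminus H)\to\mathbb P^n_k\setminus H$ is étale; (c) $f(D)\subseteq H$, and in fact $f|_D\colon D\to\mathbb P^n_k$ factors through the closed subscheme $H$; (d) $f(S)$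 does not meet $H$. -/

import Mathlib

open CategoryTheory AlgebraicGeometry TopologicalSpace Opposite

universe u

noncomputable section

namespace EtaleCover

/-! ### Line bundles, their tensor powers, and ampleness -/

section LineBundle

variable {X : Scheme.{u}}

/-- The restriction of a section of a sheaf of modules to a smaller open set. -/
def res (M : X.Modules) {U V : X.Opens} (h : V ≤ U) (s : Γ(M, U)) : Γ(M, V) :=
  M.presheaf.map (homOfLE h).op s

/-- `s` freely generates `M` over `V`, i.e. `r ↦ r • s` is an isomorphism `𝒪_V ≅ M|_V`. -/
def IsFrame (M : X.Modules) {U : X.Opens} (s : Γ(M, U)) (V : X.Opens) : Prop :=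
  ∃ hV : V ≤ U, ∀ (W : X.Opens) (hW : W ≤ V),
    Function.Bijective fun r : Γ(X, W) ↦ r • res M (hW.trans hV) s

/-- A sheaf of modules is a line bundle (an invertible sheaf) if locally it is isomorphic to the
structure sheaf. -/
def IsLineBundle (M : X.Modules) : Prop :=
  ∀ x : X, ∃ (U : X.Opens) (e : Γ(M, U)), x ∈ U ∧ IsFrame M e U

/-- The open set `X_s` on which the section `s` of a line bundle does not vanish: the largest open
set on which `s` freely generates. -/
def nonvanishing (M : X.Modules) (s : Γ(M, ⊤)) : X.Opens :=
  sSup {U : X.Opens | IsFrame M s U}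

/-- The presheaf `U ↦ L(U) ⊗ ⋯ ⊗ L(U)` (`d` factors, over `𝒪_X(U)`). -/
def presheafTensorPow (L : X.Modules) :
    ℕ → PresheafOfModules.{u} (X.presheaf ⋙ forget₂ CommRingCat.{u} RingCat.{u})
  | 0 => PresheafOfModules.unit _
  | d + 1 => PresheafOfModules.Monoidal.tensorObj (presheafTensorPow L d)
      ((Scheme.Modules.toPresheafOfModules X).obj L)

/-- The tensor power `L^{⊗ d}` of a sheaf of modules: the sheaf associated with the presheaf tensor
power. -/
def tensorPow (L : X.Modules) (d : ℕ) : X.Modules :=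
  (PresheafOfModules.sheafification (R := X.ringCatSheaf) (𝟙 X.ringCatSheaf.obj)).obj
    (presheafTensorPow L d)

/-- A line bundle `L` on `X` is ample if `X` is quasi-compact and every point of `X` lies in an
affine open set of the form `X_s`, with `s` a global section of some `L^{⊗ d}`, `d ≥ 1`. -/
structure IsAmple (L : X.Modules) : Prop where
  isLineBundle : IsLineBundle L
  compactSpace : CompactSpace X
  exists_affine : ∀ x : X, ∃ (d : ℕ) (s : Γ(tensorPow L d, ⊤)), 1 ≤ d ∧
    x ∈ nonvanishing (tensorPow L d) s ∧ IsAffineOpen (nonvanishing (tensorPow L d) s)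

end LineBundle

/-! ### Projective space -/

section ProjectiveSpace

variable (k : Type u) [Field k] (n : ℕ)

/-- The standard grading of `k[x₀, …, xₙ]`. -/
abbrev grading : ℕ → Submodule k (MvPolynomial (Fin (n + 1)) k) :=
  MvPolynomial.homogeneousSubmodule (Fin (n + 1)) k

attribute [local instance] MvPolynomial.gradedAlgebra

/-- Projective space `ℙⁿ_k = Proj k[x₀, …, xₙ]`. -/
abbrev PSpace : Scheme.{u} := Proj (grading k n)

/-- The structure morphism `ℙⁿ_k ⟶ Spec k`. -/
def PSpace.structureMap : PSpace k n ⟶ Spec (CommRingCat.of k) :=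
  Proj.toSpecZero (grading k n) ≫
    Spec.map (CommRingCat.ofHom (algebraMap k (grading k n 0)))

variable {n}

/-- The standard open set `D₊(xᵢ)`. -/
abbrev PSpace.chart (i : Fin (n + 1)) : (PSpace k n).Opens :=
  Proj.basicOpen (grading k n) (MvPolynomial.X i)

lemma PSpace.X_mem_grading (i : Fin (n + 1)) : MvPolynomial.X i ∈ grading k n 1 :=
  (MvPolynomial.mem_homogeneousSubmodule _ _).2 (MvPolynomial.isHomogeneous_X k i)

/-- The regular function `xⱼ / xᵢ` on `D₊(xᵢ)`. -/
def PSpace.ratio (i j : Fin (n + 1)) : Γ(PSpace k n, PSpace.chart k i) :=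
  Proj.awayToSection (grading k n) (MvPolynomial.X i)
    (HomogeneousLocalization.Away.mk (grading k n)
      (PSpace.X_mem_grading k i) 1 (MvPolynomial.X j)
      (by simpa only [smul_eq_mul, mul_one] using PSpace.X_mem_grading k j))

variable (n) in
/-- The set of points of the hyperplane at infinity `H = {x₀ = 0}` in `ℙⁿ_k`. -/
def PSpace.hyperplane : Set (PSpace k n) :=
  {y | y ∉ PSpace.chart k (0 : Fin (n + 1))}

end ProjectiveSpace

/-! ### Notions for schemes over a field -/

section OverField

variable {k : Type u} [Field k] {X : Scheme.{u}}

/-- A `k`-scheme is projective if it admits a closed immersion of `k`-schemes into some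
projective space `ℙᴺ_k`. -/
def IsProjective (π : X ⟶ Spec (CommRingCat.of k)) : Prop :=
  ∃ (N : ℕ) (i : X ⟶ PSpace k N), IsClosedImmersion i ∧ i ≫ PSpace.structureMap k N = π

/-- `X` has pure dimension `n`: all its irreducible components have dimension `n`. -/
def HasPureDimension (X : Scheme.{u}) (n : ℕ) : Prop :=
  ∀ Z ∈ irreducibleComponents X, topologicalKrullDim Z = n

/-- The smooth locus of `X` over the base: the points with a smooth open neighbourhood. -/
def smoothPoints (π : X ⟶ Spec (CommRingCat.of k)) : Set X :=
  {x | ∃ U : X.Opens, x ∈ U ∧ Smooth (U.ι ≫ π)}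

/-- The morphism `f : X ⟶ ℙⁿ` is induced by the sections `s₀, …, sₙ` of `M`: the preimage of
`D₊(xᵢ)` is the open set where `sᵢ` does not vanish, and there `f^*(xⱼ / xᵢ) = sⱼ / sᵢ`. -/
def IsInducedBy {n : ℕ} (f : X ⟶ PSpace k n) (M : X.Modules) (s : Fin (n + 1) → Γ(M, ⊤)) : Prop :=
  ∀ i, f ⁻¹ᵁ PSpace.chart k i = nonvanishing M (s i) ∧
    ∀ j, res M le_top (s j) =
      f.app (PSpace.chart k i) (PSpace.ratio k i j) •
        (res M le_top (s i) : Γ(M, f ⁻¹ᵁ PSpace.chart k i))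

/-- `g : T ⟶ ℙⁿ` factors through the closed subscheme `H = V₊(x₀)`: the equations `x₀ / xᵢ` of `H`
in the charts `D₊(xᵢ)` pull back to zero. -/
def FactorsThroughHyperplane {T : Scheme.{u}} {n : ℕ} (g : T ⟶ PSpace k n) : Prop :=
  ∀ i, g.app (PSpace.chart k i) (PSpace.ratio k i 0) = 0

end OverField

end EtaleCover

end

/-! Characteristic p enters through d(z^p) = 0: adding p-th powers to étale coordinates leaves their
differentials, hence their étaleness, unchanged (`EtaleCoords.add_pow`).

Choose a section h of a power of L that vanishes on D but at no point of S, nor at one chosen closed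
smooth point of each irreducible component, together with functions Y_1, ..., Y_n on X_h that are
étale coordinates everywhere on X_h. The complement of X_h contains no component, so it has
dimension less than n, and n sections g_1, ..., g_n of a power of L have no common zero on it
(`AmpleCocycle.exists_no_common_zero`). Put s_0 = h^M and s_j = Y_j h^M + g_j^N, with M large and N
a multiple of p that equalizes the degrees. On X_h the ratio s_j / s_0 is Y_j plus a p-th power, so
the map is étale there. Off X_h the extended section Y_j h^M vanishes and the g_j have no common
zero, so the s_i define a morphism on all of X (`AmpleCocycle.exists_sections`). It is proper, and
preimages of charts are quasi-affine because L is ample; hence it is finite. As h vanishes at the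
points of D, it is nilpotent on the scheme D, and a large M makes s_0 restrict to zero there.

The Y_j come from separate étale coordinates at the chosen points. A change lying in the square of
the prime of a point does not affect étaleness there, so a quotient of sums weighted by powers of
sections t_s, each nonzero at just one of the points, interpolates all of them
(`AmpleCocycle.exists_etaleOn`). Smooth points exist on every component by MacLane's criterion:
geometric reducedness makes the local ring at a generic point separably generated over k. Its
transcendence degree n is also the rank of the differentials, which fixes the number of étale
coordinates at n (`formallySmooth_and_finrank`).

Sections of powers of L are handled as families of functions on a finite affine cover, related by
units on overlaps (`Cocycle`, `IsSec`). The cocycle identity is not imposed: the arguments only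
compare two charts at a time. -/

noncomputable section

namespace EtaleCover


/-! ### Frames of tensor powers of a sheaf of modules -/

section TensorFrames

variable {X : Scheme.{u}} (L : X.Modules)

/-- The sections over `U` of the presheaf tensor power. -/
abbrev preTensor (d : ℕ) (U : X.Opens) : ModuleCat.{u} Γ(X, U) :=
  (presheafTensorPow L d).obj (op U)

/-- Restriction in the presheaf tensor power. -/
def preRes (d : ℕ) {U V : X.Opens} (h : V ≤ U) (x : preTensor L d U) : preTensor L d V :=
  (presheafTensorPow L d).presheaf.map (homOfLE h).op x

/-- The section `e ⊗ ⋯ ⊗ e`. -/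
def tensorPure {U : X.Opens} (e : Γ(L, U)) : ∀ d : ℕ, preTensor L d U
  | 0 => (1 : Γ(X, U))
  | d + 1 => TensorProduct.tmul Γ(X, U) (M := preTensor L d U) (N := Γ(L, U)) (tensorPure e d) e

lemma preRes_tensorPure {U V : X.Opens} (h : V ≤ U) (e : Γ(L, U)) (d : ℕ) :
    preRes L d h (tensorPure L e d) = tensorPure L (res L h e) d := by
  induction d with
  | zero => exact map_one (X.presheaf.map (homOfLE h).op).hom
  | succ d ih =>
    change TensorProduct.tmul Γ(X, V) (preRes L d h (tensorPure L e d)) (res L h e) = _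
    rw [ih]; rfl

lemma tensorPure_smul {U : X.Opens} (g : Γ(X, U)) (e : Γ(L, U)) (d : ℕ) :
    tensorPure L (g • e) d = g ^ d • tensorPure L e d := by
  induction d with
  | zero => rw [pow_zero, one_smul]; rfl
  | succ d ih =>
    change TensorProduct.tmul Γ(X, U) (tensorPure L (g • e) d) (g • e) =
      g ^ (d + 1) • TensorProduct.tmul Γ(X, U) (tensorPure L e d) e
    rw [ih, TensorProduct.smul_tmul_smul, ← pow_succ]

lemma bijective_smul_tmul {R M N : Type*} [CommRing R] [AddCommGroup M] [AddCommGroup N]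
    [Module R M] [Module R N] {m : M} {n : N}
    (hm : Function.Bijective fun r : R ↦ r • m) (hn : Function.Bijective fun r : R ↦ r • n) :
    Function.Bijective fun r : R ↦ r • TensorProduct.tmul R m n := by
  let e₁ : R ≃ₗ[R] M := LinearEquiv.ofBijective (LinearMap.toSpanSingleton R M m) hm
  let e₂ : R ≃ₗ[R] N := LinearEquiv.ofBijective (LinearMap.toSpanSingleton R N n) hn
  convert ((TensorProduct.lid R R).symm ≪≫ₗ TensorProduct.congr e₁ e₂).bijective using 1
  ext r
  change r • TensorProduct.tmul R m n = TensorProduct.tmul R ((1 : R) • m) (r • n)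
  rw [one_smul, TensorProduct.tmul_smul]

lemma bijective_tensorPure {U : X.Opens} {e : Γ(L, U)}
    (he : Function.Bijective fun r : Γ(X, U) ↦ r • e) (d : ℕ) :
    Function.Bijective fun r : Γ(X, U) ↦ r • tensorPure L e d := by
  induction d with
  | zero =>
    have h : (fun r : Γ(X, U) ↦ r • tensorPure L e 0) = fun r : Γ(X, U) ↦ r :=
      funext fun r ↦ mul_one r
    rw [h]
    exact Function.bijective_id
  | succ d ih => exact bijective_smul_tmul ih he

/-- The canonical map from the presheaf tensor power to the tensor power. -/
def toTensorPow (d : ℕ) (U : X.Opens) (x : preTensor L d U) : Γ(tensorPow L d, U) :=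
  (CategoryTheory.toSheafify (Opens.grothendieckTopology X)
    (presheafTensorPow L d).presheaf).app (op U) x

lemma toTensorPow_smul (d : ℕ) (U : X.Opens) (r : Γ(X, U)) (x : preTensor L d U) :
    toTensorPow L d U (r • x) = r • toTensorPow L d U x :=
  ((((PresheafOfModules.sheafificationAdjunction (R := X.ringCatSheaf)
    (𝟙 X.ringCatSheaf.obj)).unit.app (presheafTensorPow L d)).app (op U)).hom.map_smul r x)

lemma res_toTensorPow (d : ℕ) {U V : X.Opens} (h : V ≤ U) (x : preTensor L d U) :
    res (tensorPow L d) h (toTensorPow L d U x) = toTensorPow L d V (preRes L d h x) :=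
  (ConcreteCategory.congr_hom ((CategoryTheory.toSheafify (Opens.grothendieckTopology X)
    (presheafTensorPow L d).presheaf).naturality (homOfLE h).op) x).symm

/-- Sheafification is locally injective and, by the next lemma, locally surjective. These two facts
replace any explicit description of sections of the tensor power. -/
lemma toTensorPow_locally_inj (d : ℕ) {U : X.Opens} {x y : preTensor L d U}
    (h : toTensorPow L d U x = toTensorPow L d U y) (p : X) (hp : p ∈ U) :
    ∃ (V : X.Opens) (hV : V ≤ U), p ∈ V ∧ preRes L d hV x = preRes L d hV y := by
  have := Presheaf.equalizerSieve_mem (Opens.grothendieckTopology X)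
    (CategoryTheory.toSheafify (Opens.grothendieckTopology X)
    (presheafTensorPow L d).presheaf) x y h
  obtain ⟨V, f, hf, hpV⟩ := this p hp
  exact ⟨V, f.le, hpV, hf⟩

lemma toTensorPow_locally_surj (d : ℕ) {U : X.Opens} (x : Γ(tensorPow L d, U))
    (p : X) (hp : p ∈ U) :
    ∃ (V : X.Opens) (hV : V ≤ U) (y : preTensor L d V), p ∈ V ∧
      toTensorPow L d V y = res _ hV x := by
  have := Presheaf.imageSieve_mem (Opens.grothendieckTopology X)
    (CategoryTheory.toSheafify (Opens.grothendieckTopology X)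
    (presheafTensorPow L d).presheaf) x
  obtain ⟨V, f, ⟨y, hy⟩, hpV⟩ := this p hp
  exact ⟨V, f.le, y, hpV, hy⟩

/-- Restriction of functions. -/
abbrev rs {U V : X.Opens} (h : V ≤ U) : Γ(X, U) →+* Γ(X, V) :=
  (X.presheaf.map (homOfLE h).op).hom

lemma rs_rs {U V W : X.Opens} (h : V ≤ U) (h' : W ≤ V) (a : Γ(X, U)) :
    rs h' (rs h a) = rs (h'.trans h) a := by
  change (X.presheaf.map (homOfLE h).op ≫ X.presheaf.map (homOfLE h').op) a = _
  rw [← X.presheaf.map_comp]; rfl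

lemma rs_self {U : X.Opens} (h : U ≤ U) (a : Γ(X, U)) : rs h a = a := by
  change X.presheaf.map (𝟙 (op U)) a = a
  rw [X.presheaf.map_id]; rfl

lemma rs_ext {U : X.Opens} {a b : Γ(X, U)}
    (H : ∀ p ∈ U, ∃ (V : X.Opens) (hV : V ≤ U), p ∈ V ∧ rs hV a = rs hV b) : a = b := by
  choose V hV hp h using H
  exact X.sheaf.eq_of_locally_eq' (fun p : U ↦ V p.1 p.2) U (fun p ↦ homOfLE (hV p.1 p.2))
    (fun p hpU ↦ Opens.mem_iSup.2 ⟨⟨p, hpU⟩, hp p hpU⟩) a b fun p ↦ h p.1 p.2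

lemma rs_glue {ι : Type u} {W : X.Opens} (V : ι → X.Opens) (hVW : ∀ i, V i ≤ W)
    (hW : W ≤ iSup V) (a : ∀ i, Γ(X, V i))
    (h : ∀ i j, rs (inf_le_left : V i ⊓ V j ≤ V i) (a i) =
      rs (inf_le_right : V i ⊓ V j ≤ V j) (a j)) :
    ∃ b : Γ(X, W), ∀ i, rs (hVW i) b = a i :=
  (X.sheaf.existsUnique_gluing' V W (fun i ↦ homOfLE (hVW i)) hW a h).exists

variable (M : X.Modules)

lemma res_res {U V W : X.Opens} (h : V ≤ U) (h' : W ≤ V) (a : Γ(M, U)) :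
    res M h' (res M h a) = res M (h'.trans h) a := by
  change (M.presheaf.map (homOfLE h).op ≫ M.presheaf.map (homOfLE h').op) a = _
  rw [← M.presheaf.map_comp]; rfl

lemma res_self {U : X.Opens} (h : U ≤ U) (a : Γ(M, U)) : res M h a = a := by
  change M.presheaf.map (𝟙 (op U)) a = a
  rw [M.presheaf.map_id]; rfl

lemma res_smul {U V : X.Opens} (h : V ≤ U) (r : Γ(X, U)) (a : Γ(M, U)) :
    res M h (r • a) = rs h r • res M h a :=
  Scheme.Modules.map_smul M (homOfLE h) r a

lemma res_ext {U : X.Opens} {a b : Γ(M, U)}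
    (H : ∀ p ∈ U, ∃ (V : X.Opens) (hV : V ≤ U), p ∈ V ∧ res M hV a = res M hV b) : a = b := by
  choose V hV hp h using H
  exact TopCat.Sheaf.eq_of_locally_eq' ⟨M.presheaf, M.isSheaf⟩ (fun p : U ↦ V p.1 p.2) U
    (fun p ↦ homOfLE (hV p.1 p.2))
    (fun p hpU ↦ Opens.mem_iSup.2 ⟨⟨p, hpU⟩, hp p hpU⟩) a b fun p ↦ h p.1 p.2

lemma res_glue {ι : Type u} {W : X.Opens} (V : ι → X.Opens) (hVW : ∀ i, V i ≤ W)
    (hW : W ≤ iSup V) (a : ∀ i, Γ(M, V i))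
    (h : ∀ i j, res M (inf_le_left : V i ⊓ V j ≤ V i) (a i) =
      res M (inf_le_right : V i ⊓ V j ≤ V j) (a j)) :
    ∃ b : Γ(M, W), ∀ i, res M (hVW i) b = a i :=
  (TopCat.Sheaf.existsUnique_gluing' ⟨M.presheaf, M.isSheaf⟩ V W (fun i ↦ homOfLE (hVW i)) hW
    a h).exists

/-- The `d`-th tensor power of a section. -/
def framePow {U : X.Opens} (e : Γ(L, U)) (d : ℕ) : Γ(tensorPow L d, U) :=
  toTensorPow L d U (tensorPure L e d)

lemma res_framePow {U V : X.Opens} (h : V ≤ U) (e : Γ(L, U)) (d : ℕ) :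
    res _ h (framePow L e d) = framePow L (res L h e) d := by
  rw [framePow, res_toTensorPow, preRes_tensorPure]; rfl

lemma framePow_smul {U : X.Opens} (g : Γ(X, U)) (e : Γ(L, U)) (d : ℕ) :
    framePow L (g • e) d = g ^ d • framePow L e d := by
  rw [framePow, tensorPure_smul, toTensorPow_smul]; rfl

lemma IsFrame.framePow_injective {U : X.Opens} {e : Γ(L, U)} (he : IsFrame L e U) (d : ℕ)
    {W : X.Opens} (hW : W ≤ U) :
    Function.Injective fun r : Γ(X, W) ↦ r • res _ hW (framePow L e d) := by
  obtain ⟨_, he⟩ := he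
  intro r r' h
  dsimp only at h
  rw [res_framePow, framePow, ← toTensorPow_smul, ← toTensorPow_smul] at h
  refine rs_ext fun p hp ↦ ?_
  obtain ⟨V, hV, hpV, hV'⟩ := toTensorPow_locally_inj L d h p hp
  refine ⟨V, hV, hpV, (bijective_tensorPure L (he V (hV.trans hW)) d).1 ?_⟩
  have key (r : Γ(X, W)) : preRes L d hV (r • tensorPure L (res L hW e) d) =
      rs hV r • tensorPure L (res L (hV.trans hW) e) d := by
    rw [← res_res L hW hV, ← preRes_tensorPure L hV]
    exact (presheafTensorPow L d).map_smul (homOfLE hV).op r _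
  rw [key, key] at hV'
  exact hV'

/-- Coefficients exist locally because the presheaf tensor power is free on e ⊗ ⋯ ⊗ e. The
injectivity proved above makes them agree on overlaps, so they glue. -/
lemma IsFrame.framePow {U : X.Opens} {e : Γ(L, U)} (he : IsFrame L e U) (d : ℕ) :
    IsFrame (tensorPow L d) (framePow L e d) U := by
  refine ⟨le_rfl, fun W hW ↦ ⟨he.framePow_injective L d hW, fun x ↦ ?_⟩⟩
  have key (p : W) : ∃ (V : X.Opens) (hV : V ≤ W) (r : Γ(X, V)), p.1 ∈ V ∧
      r • res _ (hV.trans hW) (EtaleCover.framePow L e d) = res _ hV x := by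
    obtain ⟨V, hV, y, hpV, hy⟩ := toTensorPow_locally_surj L d x p.1 p.2
    obtain ⟨_, he'⟩ := he
    obtain ⟨r, rfl⟩ := (bijective_tensorPure L (he' V (hV.trans hW)) d).2 y
    refine ⟨V, hV, r, hpV, ?_⟩
    rw [← hy, toTensorPow_smul, res_framePow]; rfl
  choose V hV r hpV hr using key
  obtain ⟨b, hb⟩ := rs_glue V hV (fun p hp ↦ Opens.mem_iSup.2 ⟨⟨p, hp⟩, hpV _⟩) r
    (fun i j ↦ by
      apply he.framePow_injective L d (inf_le_left.trans ((hV i).trans hW))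
      dsimp only
      have h1 := congrArg (res _ (inf_le_left : V i ⊓ V j ≤ V i)) (hr i)
      have h2 := congrArg (res _ (inf_le_right : V i ⊓ V j ≤ V j)) (hr j)
      rw [res_smul, res_res, res_res] at h1 h2
      rw [h1, h2])
  refine ⟨b, res_ext _ fun p hp ↦ ⟨V ⟨p, hp⟩, hV _, hpV _, ?_⟩⟩
  dsimp only
  rw [res_smul, hb, res_res, hr]

end TensorFrames


/-! ### Sections of line bundles as twisted families of functions -/

section Cocycles

/-- A finite affine open cover together with units on the overlaps, thought of as the transition
functions of a line bundle. -/
structure Cocycle (X : Scheme.{u}) where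
  /-- The index type. -/
  ι : Type u
  finite : Finite ι
  /-- The members of the cover. -/
  U : ι → X.Opens
  affine : ∀ i, IsAffineOpen (U i)
  cover : ∀ p : X, ∃ i, p ∈ U i
  /-- The transition functions. -/
  g : ∀ i j, Γ(X, U i ⊓ U j)
  isUnit : ∀ i j, IsUnit (g i j)

variable {X : Scheme.{u}} (c : Cocycle X)

/-- The family `a` is a section of the `d`-th power of the line bundle defined by `c`. -/
def IsSec (d : ℕ) (a : ∀ i, Γ(X, c.U i)) : Prop :=
  ∀ i j, rs (inf_le_right : c.U i ⊓ c.U j ≤ c.U j) (a j) =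
    c.g i j ^ d * rs (inf_le_left : c.U i ⊓ c.U j ≤ c.U i) (a i)

/-- The open set on which a section does not vanish. -/
def locus (a : ∀ i, Γ(X, c.U i)) : X.Opens := ⨆ i, X.basicOpen (a i)

variable {c}

lemma IsSec.mul {d e : ℕ} {a b : ∀ i, Γ(X, c.U i)} (ha : IsSec c d a) (hb : IsSec c e b) :
    IsSec c (d + e) (a * b) := fun i j ↦ by
  rw [Pi.mul_apply, Pi.mul_apply, map_mul, map_mul, ha i j, hb i j]; ring

lemma IsSec.pow {d : ℕ} {a : ∀ i, Γ(X, c.U i)} (ha : IsSec c d a) (m : ℕ) :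
    IsSec c (m * d) (a ^ m) := fun i j ↦ by
  rw [Pi.pow_apply, Pi.pow_apply, map_pow, map_pow, ha i j, mul_pow, ← pow_mul, mul_comm d]

lemma IsSec.add {d : ℕ} {a b : ∀ i, Γ(X, c.U i)} (ha : IsSec c d a) (hb : IsSec c d b) :
    IsSec c d (a + b) := fun i j ↦ by
  rw [Pi.add_apply, Pi.add_apply, map_add, map_add, ha i j, hb i j]; ring

lemma IsSec.zero {d : ℕ} : IsSec c d 0 := fun i j ↦ by simp

lemma IsSec.sum {d : ℕ} {κ : Type*} (s : Finset κ) {a : κ → ∀ i, Γ(X, c.U i)}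
    (ha : ∀ t ∈ s, IsSec c d (a t)) : IsSec c d (∑ t ∈ s, a t) := by
  classical
  induction s using Finset.induction_on with
  | empty => exact IsSec.zero
  | insert t s hts ih =>
    rw [Finset.sum_insert hts]
    exact (ha t (by simp)).add (ih fun t' ht' ↦ ha t' (by simp [ht']))

lemma mem_basicOpen_rs {U V : X.Opens} (h : V ≤ U) (a : Γ(X, U)) {p : X} (hp : p ∈ V) :
    p ∈ X.basicOpen (rs h a) ↔ p ∈ X.basicOpen a := by
  rw [show X.basicOpen (rs h a) = V ⊓ X.basicOpen a from X.basicOpen_res a (homOfLE h).op]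
  exact and_iff_right hp

/-- The transition functions are units, so vanishing at a point does not depend on the chart. -/
lemma IsSec.mem_basicOpen_iff {d : ℕ} {a : ∀ i, Γ(X, c.U i)} (ha : IsSec c d a) {p : X}
    {i j : c.ι} (hi : p ∈ c.U i) (hj : p ∈ c.U j) :
    p ∈ X.basicOpen (a j) ↔ p ∈ X.basicOpen (a i) := by
  have hp : p ∈ c.U i ⊓ c.U j := ⟨hi, hj⟩
  rw [← mem_basicOpen_rs inf_le_right (a j) hp, ← mem_basicOpen_rs inf_le_left (a i) hp, ha i j,
    Scheme.basicOpen_mul, Scheme.basicOpen_of_isUnit _ ((c.isUnit i j).pow d)]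
  exact and_iff_right hp

lemma IsSec.mem_locus_iff {d : ℕ} {a : ∀ i, Γ(X, c.U i)} (ha : IsSec c d a) {p : X}
    {i : c.ι} (hi : p ∈ c.U i) : p ∈ locus c a ↔ p ∈ X.basicOpen (a i) := by
  refine ⟨fun h ↦ ?_, fun h ↦ Opens.mem_iSup.2 ⟨i, h⟩⟩
  obtain ⟨j, hj⟩ := Opens.mem_iSup.1 h
  exact (ha.mem_basicOpen_iff hi (X.basicOpen_le _ hj)).1 hj

lemma mem_locus_mul {a b : ∀ i, Γ(X, c.U i)} {d e : ℕ} (ha : IsSec c d a) (hb : IsSec c e b)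
    {p : X} : p ∈ locus c (a * b) ↔ p ∈ locus c a ∧ p ∈ locus c b := by
  obtain ⟨i, hi⟩ := c.cover p
  rw [ha.mem_locus_iff hi, hb.mem_locus_iff hi, (ha.mul hb).mem_locus_iff hi, Pi.mul_apply,
    Scheme.basicOpen_mul]
  rfl

lemma locus_pow {a : ∀ i, Γ(X, c.U i)} {m : ℕ} (hm : 0 < m) : locus c (a ^ m) = locus c a := by
  refine iSup_congr fun i ↦ ?_
  rw [Pi.pow_apply, Scheme.basicOpen_pow _ _ hm]

lemma isUnit_rs_of_le {U V : X.Opens} (h : V ≤ U) {a : Γ(X, U)} (hV : V ≤ X.basicOpen a) :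
    IsUnit (rs h a) := by
  have := (RingedSpace.isUnit_res_basicOpen X.toRingedSpace a).map (rs (X := X) hV)
  convert this using 1
  exact (rs_rs (X.basicOpen_le a) hV a).symm

lemma mem_basicOpen_iff_exists_isUnit {U : X.Opens} {a : Γ(X, U)} {p : X} :
    p ∈ X.basicOpen a ↔ ∃ (V : X.Opens) (h : V ≤ U), p ∈ V ∧ IsUnit (rs h a) := by
  refine ⟨fun h ↦ ⟨_, X.basicOpen_le a, h, isUnit_rs_of_le _ le_rfl⟩, fun ⟨V, h, hpV, hu⟩ ↦ ?_⟩
  rw [← mem_basicOpen_rs h a hpV, Scheme.basicOpen_of_isUnit _ hu]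
  exact hpV

end Cocycles

/-! ### From line bundles to cocycles and back -/

section Bridge

variable {X : Scheme.{u}} {L : X.Modules}

lemma IsFrame.res {M : X.Modules} {U V : X.Opens} {s : Γ(M, U)} (hs : IsFrame M s U)
    (h : V ≤ U) : IsFrame M (EtaleCover.res M h s) V :=
  ⟨le_rfl, fun W hW ↦ by simpa only [res_res] using hs.2 W (hW.trans h)⟩

/-- Local frames of a line bundle on the members of the cover of `c`, with the transition functions
prescribed by `c`. -/
structure Frames (L : X.Modules) (c : Cocycle X) where
  /-- The frames. -/
  e : ∀ i, Γ(L, c.U i)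
  isFrame : ∀ i, IsFrame L (e i) (c.U i)
  trans : ∀ i j, res L (inf_le_left : c.U i ⊓ c.U j ≤ c.U i) (e i) =
    c.g i j • res L (inf_le_right : c.U i ⊓ c.U j ≤ c.U j) (e j)

/-- Two frames on an overlap are multiples of each other, so the transition factor is a unit;
quasi-compactness leaves finitely many frames. -/
lemma exists_frames [CompactSpace X] (hL : IsLineBundle L) :
    ∃ c : Cocycle X, Nonempty (Frames L c) := by
  have h1 (x : X) : ∃ (U : X.Opens) (e : Γ(L, U)), x ∈ U ∧ IsAffineOpen U ∧ IsFrame L e U := by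
    obtain ⟨U, e, hx, he⟩ := hL x
    obtain ⟨V, hV, hxV, hVU⟩ := exists_isAffineOpen_mem_and_subset hx
    exact ⟨V, res L hVU e, hxV, hV, he.res hVU⟩
  choose U e hx hU he using h1
  obtain ⟨t, ht⟩ := isCompact_univ.elim_finite_subcover (fun x ↦ (U x : Set X))
    (fun x ↦ (U x).2) (fun x _ ↦ Set.mem_iUnion.2 ⟨x, hx x⟩)
  have h2 (i j : t) := (((he j).2 (U i ⊓ U j) inf_le_right).2
    (res L (inf_le_left : U i ⊓ U j ≤ U i) (e i)))
  choose g hg using h2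
  have hg' (i j : t) : IsUnit (g i j) := by
    obtain ⟨r, hr⟩ := (((he i).2 (U i ⊓ U j) inf_le_left).2
      (res L (inf_le_right : U i ⊓ U j ≤ U j) (e j)))
    refine IsUnit.of_mul_eq_one r (((he i).2 (U i ⊓ U j) inf_le_left).1 ?_)
    have := hg i j
    dsimp only at this hr ⊢
    rw [mul_smul, hr, this, one_smul]
  refine ⟨⟨t, inferInstance, fun i ↦ U i, fun i ↦ hU i, fun p ↦ ?_, g, hg'⟩,
    ⟨⟨fun i ↦ e i, fun i ↦ he i, fun i j ↦ (hg i j).symm⟩⟩⟩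
  have := ht (Set.mem_univ p)
  simp only [Set.mem_iUnion] at this
  obtain ⟨i, hi, hp⟩ := this
  exact ⟨⟨i, hi⟩, hp⟩

variable {c : Cocycle X} (F : Frames L c)

/-- The global section `s` is given by the family `a` in the frames `F`. -/
def Represents (d : ℕ) (s : Γ(tensorPow L d, ⊤)) (a : ∀ i, Γ(X, c.U i)) : Prop :=
  ∀ i, res _ le_top s = a i • framePow L (F.e i) d

lemma Frames.pow_trans (d : ℕ) (i j : c.ι) :
    res _ (inf_le_left : c.U i ⊓ c.U j ≤ c.U i) (framePow L (F.e i) d) =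
    c.g i j ^ d • res _ (inf_le_right : c.U i ⊓ c.U j ≤ c.U j) (framePow L (F.e j) d) := by
  rw [res_framePow, res_framePow, F.trans, framePow_smul]

/-- The rule in `IsSec` is the gluing condition for the local sections `a i • e i ^ d`: frames and
coefficients transform in opposite directions. -/
lemma exists_represents {d : ℕ} {a : ∀ i, Γ(X, c.U i)} (ha : IsSec c d a) :
    ∃ s, Represents F d s a := by
  obtain ⟨s, hs⟩ := res_glue (tensorPow L d) (W := ⊤) c.U (fun _ ↦ le_top)
    (fun p _ ↦ Opens.mem_iSup.2 (c.cover p)) (fun i ↦ a i • framePow L (F.e i) d)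
    (fun i j ↦ by
      rw [res_smul, res_smul, F.pow_trans, ha i j, smul_smul, mul_comm])
  exact ⟨s, hs⟩

lemma exists_isSec_represents (d : ℕ) (s : Γ(tensorPow L d, ⊤)) :
    ∃ a, IsSec c d a ∧ Represents F d s a := by
  have h (i) := (((F.isFrame i).framePow L d).2 (c.U i) le_rfl).2 (res _ le_top s)
  choose a ha using h
  have ha' : Represents F d s a := fun i ↦ by
    have := ha i
    dsimp only at this
    rw [res_self] at this
    exact this.symm
  refine ⟨a, fun i j ↦ ?_, ha'⟩
  apply (((F.isFrame j).framePow L d).2 (c.U i ⊓ c.U j) inf_le_right).1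
  dsimp only
  rw [mul_comm, mul_smul, ← F.pow_trans, ← res_smul, ← res_smul, ← ha' i, ← ha' j, res_res, res_res]

/-- A multiple of a frame is again a frame exactly where the coefficient is a unit. -/
lemma Represents.nonvanishing_eq {d : ℕ} {s : Γ(tensorPow L d, ⊤)} {a : ∀ i, Γ(X, c.U i)}
    (ha : IsSec c d a) (h : Represents F d s a) : nonvanishing (tensorPow L d) s = locus c a := by
  have key {i : c.ι} {W : X.Opens} (hW : W ≤ c.U i) : res _ le_top s =
      rs hW (a i) • res _ hW (framePow L (F.e i) d) := by
    rw [← res_smul, ← h i, res_res]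
  apply le_antisymm
  · refine sSup_le fun V hV p hp ↦ ?_
    obtain ⟨i, hi⟩ := c.cover p
    rw [ha.mem_locus_iff hi, mem_basicOpen_iff_exists_isUnit]
    refine ⟨V ⊓ c.U i, inf_le_right, ⟨hp, hi⟩, ?_⟩
    obtain ⟨r, hr⟩ := (hV.2 (V ⊓ c.U i) inf_le_left).2
      (res _ inf_le_right (framePow L (F.e i) d))
    dsimp only at hr
    rw [key inf_le_right, smul_smul] at hr
    refine IsUnit.of_mul_eq_one r ?_
    apply (((F.isFrame i).framePow L d).2 (V ⊓ c.U i) inf_le_right).1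
    dsimp only
    rw [mul_comm, hr, one_smul]
  · refine iSup_le fun i ↦ le_sSup ⟨le_top, fun W hW ↦ ?_⟩
    have hWU : W ≤ c.U i := hW.trans (X.basicOpen_le _)
    obtain ⟨v, hv⟩ := isUnit_rs_of_le hWU hW
    have := (((F.isFrame i).framePow L d).2 W hWU).comp (Units.mulRight_bijective v)
    convert this using 1
    ext r
    simp only [Function.comp_apply]
    rw [key hWU, smul_smul, ← hv]

lemma Represents.res_eq_smul {d : ℕ} {s s' : Γ(tensorPow L d, ⊤)} {a a' : ∀ i, Γ(X, c.U i)}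
    (h : Represents F d s a) (h' : Represents F d s' a') {V : X.Opens} (r : Γ(X, V))
    (H : ∀ i, rs (inf_le_right : V ⊓ c.U i ≤ c.U i) (a' i) =
      rs (inf_le_left : V ⊓ c.U i ≤ V) r * rs (inf_le_right : V ⊓ c.U i ≤ c.U i) (a i)) :
    res _ le_top s' = r • (res _ le_top s : Γ(tensorPow L d, V)) := by
  refine res_ext _ fun p hp ↦ ?_
  obtain ⟨i, hi⟩ := c.cover p
  refine ⟨V ⊓ c.U i, inf_le_left, ⟨hp, hi⟩, ?_⟩
  rw [res_smul, res_res, res_res, ← res_res _ le_top (inf_le_right : V ⊓ c.U i ≤ c.U i) s,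
    ← res_res _ le_top (inf_le_right : V ⊓ c.U i ≤ c.U i) s', h i, h' i, res_smul, res_smul, H i,
    mul_smul]

end Bridge


/-! ### Ratios, extension and separation of points by sections -/

section Sections

variable {X : Scheme.{u}} {c : Cocycle X}

lemma IsSec.le_basicOpen {d : ℕ} {a : ∀ i, Γ(X, c.U i)} (ha : IsSec c d a) {V : X.Opens}
    {i : c.ι} (hV : V ≤ locus c a) (hU : V ≤ c.U i) : V ≤ X.basicOpen (a i) :=
  fun _ hp ↦ (ha.mem_locus_iff (hU hp)).1 (hV hp)

lemma IsSec.isUnit_rs {d : ℕ} {a : ∀ i, Γ(X, c.U i)} (ha : IsSec c d a) {V : X.Opens}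
    {i : c.ι} (hV : V ≤ locus c a) (hU : V ≤ c.U i) : IsUnit (rs hU (a i)) :=
  isUnit_rs_of_le hU (ha.le_basicOpen hV hU)

lemma rs_eq_rs_of_inf {d : ℕ} {a : ∀ i, Γ(X, c.U i)} (ha : IsSec c d a) {V : X.Opens} {i j : c.ι}
    (hi : V ≤ c.U i) (hj : V ≤ c.U j) :
    rs hj (a j) = rs (le_inf hi hj) (c.g i j) ^ d * rs hi (a i) := by
  have := congrArg (rs (le_inf hi hj)) (ha i j)
  rw [map_mul, map_pow, rs_rs, rs_rs] at this
  exact this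

/-- The quotient of two sections of the same degree, as a function on the nonvanishing locus of the
denominator. -/
lemma exists_ratio {d : ℕ} {a b : ∀ i, Γ(X, c.U i)} (ha : IsSec c d a) (hb : IsSec c d b) :
    ∃ φ : Γ(X, locus c b), ∀ (i : c.ι) (V : X.Opens) (hV : V ≤ locus c b) (hU : V ≤ c.U i),
      rs hV φ * rs hU (b i) = rs hU (a i) := by
  have hle (i) : X.basicOpen (b i) ≤ locus c b := le_iSup (fun i ↦ X.basicOpen (b i)) i
  have h (i) := hb.isUnit_rs (hle i) (X.basicOpen_le (b i))
  choose v hv using fun i ↦ (h i).exists_left_inv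
  -- The local quotients a_i / b_i agree on overlaps because the factors `g i j ^ d` of numerator
  -- and denominator cancel.
  obtain ⟨φ, hφ⟩ := rs_glue (W := locus c b) (fun i ↦ X.basicOpen (b i)) hle
    (fun p hp ↦ hp) (fun i ↦ rs (X.basicOpen_le (b i)) (a i) * v i) (fun i j ↦ by
      have hi : X.basicOpen (b i) ⊓ X.basicOpen (b j) ≤ c.U i :=
        inf_le_left.trans (X.basicOpen_le _)
      have hj : X.basicOpen (b i) ⊓ X.basicOpen (b j) ≤ c.U j :=
        inf_le_right.trans (X.basicOpen_le _)
      have hub := hb.isUnit_rs (inf_le_left.trans (hle i)) hi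
      have hi' := congrArg (rs (inf_le_left : X.basicOpen (b i) ⊓ X.basicOpen (b j) ≤ _)) (hv i)
      have hj' := congrArg (rs (inf_le_right : X.basicOpen (b i) ⊓ X.basicOpen (b j) ≤ _)) (hv j)
      rw [map_mul, map_one, rs_rs] at hi' hj'
      rw [map_mul, map_mul, rs_rs, rs_rs, ← hub.mul_left_inj]
      have e1 := rs_eq_rs_of_inf ha hi hj
      have e2 := rs_eq_rs_of_inf hb hi hj
      rw [e2] at hj'
      rw [e1, mul_assoc, hi']
      linear_combination - (rs hi (a i)) * hj')
  refine ⟨φ, fun i V hV hU ↦ ?_⟩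
  have hVb := hb.le_basicOpen hV hU
  have h1 := congrArg (rs hVb) (hφ i)
  have h2 := congrArg (rs hVb) (hv i)
  simp only [map_mul, rs_rs, map_one] at h1 h2
  rw [h1, mul_assoc, h2, mul_one]

lemma exists_nat_bound {ι : Type*} [Finite ι] (n : ι → ℕ) : ∃ N, ∀ i, n i ≤ N := by
  obtain ⟨N, hN⟩ := (Set.finite_range n).bddAbove
  exact ⟨N, fun i ↦ hN ⟨i, rfl⟩⟩

/-- A function on the nonvanishing locus of `b` extends to a section after multiplication by a
large power of `b`. -/
lemma exists_extension [NoetherianSpace X] {d : ℕ} {b : ∀ i, Γ(X, c.U i)} (hb : IsSec c d b)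
    (φ : Γ(X, locus c b)) :
    ∃ N₀ : ℕ, ∀ N ≥ N₀, ∃ a, IsSec c (N * d) a ∧
      ∀ (i : c.ι) (V : X.Opens) (hV : V ≤ locus c b) (hU : V ≤ c.U i),
        rs hU (a i) = rs hV φ * rs hU (b i) ^ N := by
  have := c.finite
  have hle (i) : X.basicOpen (b i) ≤ locus c b := le_iSup (fun i ↦ X.basicOpen (b i)) i
  -- Denominators are cleared chart by chart, then with a common exponent M. The resulting z_i obey
  -- the transition rule only on the locus of b.
  have h (i : c.ι) : ∃ (n : ℕ) (y : Γ(X, c.U i)), rs (X.basicOpen_le (b i)) y =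
      rs (X.basicOpen_le (b i)) (b i) ^ n * rs (hle i) φ :=
    exists_eq_pow_mul_of_isAffineOpen X (c.U i) (c.affine i) (b i) (rs (hle i) φ)
  choose n y hy using h
  obtain ⟨M, hM⟩ := exists_nat_bound n
  obtain ⟨z, hz⟩ : ∃ z : ∀ i, Γ(X, c.U i), ∀ (i : c.ι) (V : X.Opens) (hV : V ≤ locus c b)
      (hU : V ≤ c.U i), rs hU (z i) = rs hV φ * rs hU (b i) ^ M := by
    refine ⟨fun i ↦ b i ^ (M - n i) * y i, fun i V hV hU ↦ ?_⟩
    have h1 := congrArg (rs (hb.le_basicOpen hV hU)) (hy i)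
    simp only [map_mul, map_pow, rs_rs] at h1
    simp only [map_mul, map_pow, h1]
    rw [← mul_assoc, ← pow_add, Nat.sub_add_cancel (hM i), mul_comm]
  -- The failure of the transition rule vanishes where b does not, so a power of b kills it;
  -- finitely many overlaps need only one exponent.
  have h2 (ij : c.ι × c.ι) : ∃ m : ℕ, rs inf_le_left (b ij.1) ^ m *
      (rs (inf_le_right : c.U ij.1 ⊓ c.U ij.2 ≤ c.U ij.2) (z ij.2) -
      c.g ij.1 ij.2 ^ (M * d) * rs (inf_le_left : c.U ij.1 ⊓ c.U ij.2 ≤ c.U ij.1) (z ij.1)) = 0 := by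
    obtain ⟨i, j⟩ := ij
    refine exists_pow_mul_eq_zero_of_res_basicOpen_eq_zero_of_isCompact X
      (NoetherianSpace.isCompact _) _ _ ?_
    set B := X.basicOpen (rs (inf_le_left : c.U i ⊓ c.U j ≤ c.U i) (b i))
    have hB : B ≤ c.U i ⊓ c.U j := X.basicOpen_le _
    have hBl : B ≤ locus c b := by
      refine le_trans ?_ (hle i)
      rw [show B = _ ⊓ X.basicOpen (b i) from X.basicOpen_res (b i) (homOfLE inf_le_left).op]
      exact inf_le_right
    change rs hB _ = 0
    rw [map_sub, map_mul, map_pow, rs_rs, rs_rs, hz j B hBl, hz i B hBl,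
      rs_eq_rs_of_inf hb (hB.trans inf_le_left) (hB.trans inf_le_right)]
    ring
  choose m hm using h2
  obtain ⟨K, hK⟩ := exists_nat_bound m
  refine ⟨M + K, fun N hN ↦ ⟨fun i ↦ b i ^ (N - M) * z i, fun i j ↦ ?_, fun i V hV hU ↦ ?_⟩⟩
  · have h3 := hm (i, j)
    have h4 : rs inf_le_left (b i) ^ (N - M) *
      (rs (inf_le_right : c.U i ⊓ c.U j ≤ c.U j) (z j) -
      c.g i j ^ (M * d) * rs (inf_le_left : c.U i ⊓ c.U j ≤ c.U i) (z i)) = 0 := by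
      have := hK (i, j)
      rw [show N - M = (N - M - m (i, j)) + m (i, j) by omega, pow_add, mul_assoc, h3, mul_zero]
    simp only [map_mul, map_pow]
    rw [hb i j, mul_pow, ← pow_mul,
      show N * d = (N - M) * d + M * d by rw [← add_mul, Nat.sub_add_cancel (by omega)], pow_add,
      mul_comm d]
    linear_combination c.g i j ^ ((N - M) * d) * h4
  · rw [map_mul, map_pow, hz i V hV hU, mul_left_comm, ← pow_add, Nat.sub_add_cancel (by omega)]

/-- The line bundle defined by `c` is ample. -/
def AmpleCocycle (c : Cocycle X) : Prop :=
  ∀ x : X, ∃ (d : ℕ) (t : ∀ i, Γ(X, c.U i)), 1 ≤ d ∧ IsSec c d t ∧ x ∈ locus c t ∧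
    IsAffineOpen (locus c t)

lemma IsAmple.ampleCocycle {L : X.Modules} (hL : IsAmple L) (F : Frames L c) :
    AmpleCocycle c := fun x ↦ by
  obtain ⟨d, s, hd, hx, hs⟩ := hL.exists_affine x
  obtain ⟨a, ha, h⟩ := exists_isSec_represents F d s
  rw [h.nonvanishing_eq F ha] at hx hs
  exact ⟨d, a, hd, ha, hx, hs⟩

/-- On an affine X_t, a function f cuts out a neighbourhood inside W, and f t^N extends to a section
a. The further factor t is needed since a alone may be nonzero outside X_t. -/
lemma AmpleCocycle.exists_mem_le [NoetherianSpace X] (hc : AmpleCocycle c) {x : X} {W : X.Opens}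
    (hx : x ∈ W) : ∃ (d : ℕ) (t : ∀ i, Γ(X, c.U i)), 1 ≤ d ∧ IsSec c d t ∧ x ∈ locus c t ∧
      IsAffineOpen (locus c t) ∧ locus c t ≤ W := by
  obtain ⟨d, t, hd, ht, hxt, haff⟩ := hc x
  obtain ⟨f, hf, hxf⟩ := haff.exists_basicOpen_le ⟨x, hx⟩ hxt
  obtain ⟨N, hN⟩ := exists_extension ht f
  obtain ⟨a, ha, hat⟩ := hN N le_rfl
  have key : locus c (a * t) = X.basicOpen f := by
    ext p
    simp only [SetLike.mem_coe]
    rw [mem_locus_mul ha ht]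
    by_cases hp : p ∈ locus c t
    · obtain ⟨i, hi⟩ := c.cover p
      have hpi : p ∈ locus c t ⊓ c.U i := ⟨hp, hi⟩
      have hu := (ht.isUnit_rs (inf_le_left : locus c t ⊓ c.U i ≤ _) inf_le_right).pow N
      rw [ha.mem_locus_iff hi, ← mem_basicOpen_rs (inf_le_right : locus c t ⊓ c.U i ≤ _) _ hpi,
        hat i _ inf_le_left inf_le_right, Scheme.basicOpen_mul,
        ← mem_basicOpen_rs (inf_le_left : locus c t ⊓ c.U i ≤ _) f hpi,
        Scheme.basicOpen_of_isUnit _ hu]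
      exact ⟨fun h ↦ h.1.1, fun h ↦ ⟨⟨h, hpi⟩, hp⟩⟩
    · exact ⟨fun h ↦ (hp h.2).elim, fun h ↦ (hp (X.basicOpen_le f h)).elim⟩
  refine ⟨N * d + d, a * t, by omega, ha.mul ht, ?_, ?_, ?_⟩
  · rwa [key]
  · rw [key]; exact haff.basicOpen f
  · rwa [key]

/-- On the affine nonvanishing locus of `t`, the nonvanishing locus of another section is a basic
open. -/
lemma exists_basicOpen_eq_inf {d e : ℕ} {a t : ∀ i, Γ(X, c.U i)} (hd : 0 < d) (ha : IsSec c d a)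
    (ht : IsSec c e t) (he : 0 < e) :
    ∃ φ : Γ(X, locus c t), X.basicOpen φ = locus c t ⊓ locus c a := by
  obtain ⟨φ, hφ⟩ := exists_ratio (ha.pow e) (b := t ^ d) (by
    rw [mul_comm]; exact ht.pow d)
  have hl : locus c (t ^ d) = locus c t := locus_pow hd
  refine ⟨rs hl.ge φ, ?_⟩
  ext p
  simp only [SetLike.mem_coe]
  by_cases hp : p ∈ locus c t
  · obtain ⟨i, hi⟩ := c.cover p
    have hpi : p ∈ locus c t ⊓ c.U i := ⟨hp, hi⟩
    have h1 := hφ i (locus c t ⊓ c.U i) (inf_le_left.trans hl.ge) inf_le_right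
    rw [← mem_basicOpen_rs (inf_le_left : locus c t ⊓ c.U i ≤ _) _ hpi, rs_rs]
    have h2 : p ∈ X.basicOpen (rs (inf_le_right : locus c t ⊓ c.U i ≤ c.U i) ((a ^ e) i)) ↔
        p ∈ locus c a := by
      rw [mem_basicOpen_rs _ _ hpi, ha.mem_locus_iff hi, Pi.pow_apply, Scheme.basicOpen_pow _ _ he]
    rw [← h1, Scheme.basicOpen_mul, Pi.pow_apply, map_pow,
      Scheme.basicOpen_of_isUnit _ ((ht.isUnit_rs inf_le_left inf_le_right).pow d)] at h2
    exact ⟨fun h ↦ ⟨hp, h2.1 ⟨h, hpi⟩⟩, fun h ↦ (h2.2 h.2).1⟩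
  · exact ⟨fun h ↦ (hp (X.basicOpen_le _ h)).elim, fun h ↦ (hp h.1).elim⟩

/-- Sections of a common degree separating finitely many closed points. -/
lemma AmpleCocycle.exists_separating [NoetherianSpace X] (hc : AmpleCocycle c) (S : Finset X)
    (hS : ∀ s ∈ S, IsClosed {s}) (W : X → X.Opens) (hW : ∀ s ∈ S, s ∈ W s) :
    ∃ (d : ℕ) (t : X → ∀ i, Γ(X, c.U i)), 1 ≤ d ∧ ∀ s ∈ S, IsSec c d (t s) ∧ s ∈ locus c (t s) ∧
      locus c (t s) ≤ W s ∧ ∀ s' ∈ S, s' ≠ s → s' ∉ locus c (t s) := by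
  classical
  have h (s : S) : ∃ (d : ℕ) (t : ∀ i, Γ(X, c.U i)), 1 ≤ d ∧ IsSec c d t ∧ s.1 ∈ locus c t ∧
      locus c t ≤ W s ∧ ∀ s' ∈ S, s' ≠ s.1 → s' ∉ locus c t := by
    have hcl : IsClosed (↑(S.erase s.1) : Set X) := by
      rw [← Set.biUnion_of_singleton (↑(S.erase s.1) : Set X)]
      exact (Finset.finite_toSet _).isClosed_biUnion fun i hi ↦
        hS i (Finset.mem_of_mem_erase hi)
    let W' : X.Opens := W s ⊓ ⟨_, hcl.isOpen_compl⟩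
    have hs : s.1 ∈ W' := ⟨hW s s.2, fun h ↦ (Finset.notMem_erase _ _ h)⟩
    obtain ⟨d, t, hd, ht, hst, -, hle⟩ := hc.exists_mem_le hs
    exact ⟨d, t, hd, ht, hst, hle.trans inf_le_left,
      fun s' hs' hne h ↦ (hle h).2 (Finset.mem_erase.2 ⟨hne, hs'⟩)⟩
  choose d t hd ht hst hle hne using h
  -- Powers bring the sections to the common degree D without changing their loci.
  let D := ∏ s, d s
  have hD : 0 < D := Finset.prod_pos fun s _ ↦ hd s
  have hdvd (s : S) : d s ∣ D := Finset.dvd_prod_of_mem d (Finset.mem_univ s)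
  have hq (s : S) : 0 < D / d s := Nat.div_pos (Nat.le_of_dvd hD (hdvd s)) (hd s)
  refine ⟨D, fun x ↦ if hx : x ∈ S then t ⟨x, hx⟩ ^ (D / d ⟨x, hx⟩) else 0, hD, fun s hs ↦ ?_⟩
  simp only [hs, dif_pos, locus_pow (hq ⟨s, hs⟩)]
  refine ⟨?_, hst _, hle _, hne ⟨s, hs⟩⟩
  have := (ht ⟨s, hs⟩).pow (D / d ⟨s, hs⟩)
  rwa [Nat.div_mul_cancel (hdvd _)] at this

/-- In the residue field at p only one summand survives. -/
lemma mem_basicOpen_sum {κ : Type*} {U : X.Opens} (S : Finset κ) (a : κ → Γ(X, U)) {p : X}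
    {s : κ} (hs : s ∈ S) (h : p ∈ X.basicOpen (a s))
    (h' : ∀ s' ∈ S, s' ≠ s → p ∉ X.basicOpen (a s')) : p ∈ X.basicOpen (∑ s ∈ S, a s) := by
  have hp : p ∈ U := X.basicOpen_le _ h
  by_contra hcon
  rw [← X.evaluation_eq_zero_iff_notMem_basicOpen p hp, map_sum, Finset.sum_eq_single_of_mem s hs
    (fun s' hs' hne ↦ (X.evaluation_eq_zero_iff_notMem_basicOpen p hp _).2 (h' s' hs' hne)),
    X.evaluation_eq_zero_iff_notMem_basicOpen p hp] at hcon
  exact hcon h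

lemma exists_mem_basicOpen_of_sum {κ : Type*} {U : X.Opens} (S : Finset κ) (a : κ → Γ(X, U)) {p : X}
    (h : p ∈ X.basicOpen (∑ s ∈ S, a s)) : ∃ s ∈ S, p ∈ X.basicOpen (a s) := by
  have hp : p ∈ U := X.basicOpen_le _ h
  by_contra! hcon
  refine (X.evaluation_eq_zero_iff_notMem_basicOpen p hp _).1 ?_ h
  rw [map_sum]
  exact Finset.sum_eq_zero fun s hs ↦
    (X.evaluation_eq_zero_iff_notMem_basicOpen p hp _).2 (hcon s hs)

/-- A section which does not vanish at finitely many closed points, but vanishes outside of a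
neighbourhood of them. -/
lemma AmpleCocycle.exists_sec [NoetherianSpace X] (hc : AmpleCocycle c) (S : Finset X)
    (hS : ∀ s ∈ S, IsClosed {s}) (W : X.Opens) (hW : ∀ s ∈ S, s ∈ W) :
    ∃ (d : ℕ) (h : ∀ i, Γ(X, c.U i)), 1 ≤ d ∧ IsSec c d h ∧ (∀ s ∈ S, s ∈ locus c h) ∧
      locus c h ≤ W := by
  obtain ⟨d, t, hd, ht⟩ := hc.exists_separating S hS (fun _ ↦ W) hW
  have hsec : IsSec c d (∑ s ∈ S, t s) := IsSec.sum S fun s hs ↦ (ht s hs).1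
  refine ⟨d, ∑ s ∈ S, t s, hd, hsec, fun s hs ↦ ?_, fun p hp ↦ ?_⟩
  · obtain ⟨i, hi⟩ := c.cover s
    rw [hsec.mem_locus_iff hi, Finset.sum_apply]
    refine mem_basicOpen_sum S _ hs (((ht s hs).1.mem_locus_iff hi).1 (ht s hs).2.1)
      fun s' hs' hne h ↦ (ht s' hs').2.2.2 s hs hne.symm (((ht s' hs').1.mem_locus_iff hi).2 h)
  · obtain ⟨i, hi⟩ := c.cover p
    rw [hsec.mem_locus_iff hi, Finset.sum_apply] at hp
    obtain ⟨s, hs, hps⟩ := exists_mem_basicOpen_of_sum S _ hp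
    exact (ht s hs).2.2.1 (((ht s hs).1.mem_locus_iff hi).2 hps)

end Sections


/-! ### Krull dimension of closed subsets -/

section Dimension

open Topology

lemma isIrreducible_preimage_val {X : Type*} [TopologicalSpace X] {Z s : Set X}
    (hs : IsIrreducible s) (hsZ : s ⊆ Z) : IsIrreducible ((↑) ⁻¹' s : Set Z) := by
  obtain ⟨⟨x, hx⟩, h⟩ := hs
  refine ⟨⟨⟨x, hsZ hx⟩, hx⟩, ?_⟩
  rintro _ _ ⟨u, hu, rfl⟩ ⟨v, hv, rfl⟩ ⟨a, ha, hau⟩ ⟨b, hb, hbv⟩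
  obtain ⟨y, hy, hyuv⟩ := h u v hu hv ⟨a, ha, hau⟩ ⟨b, hb, hbv⟩
  exact ⟨⟨y, hsZ hy⟩, hy, hyuv⟩

/-- A chain of irreducible closed subsets all contained in `Z` bounds the dimension of `Z` from
below. -/
lemma length_le_topologicalKrullDim {X : Type*} [TopologicalSpace X] {Z : Set X}
    (l : LTSeries (IrreducibleCloseds X)) (hl : (l.last : Set X) ⊆ Z) :
    (l.length : WithBot ℕ∞) ≤ topologicalKrullDim Z := by
  have h (i) : (l i : Set X) ⊆ Z := fun x hx ↦ hl ((LTSeries.monotone l (Fin.le_last i)) hx)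
  refine Order.le_krullDim_iff.2 ⟨⟨l.length, fun i ↦ ⟨(↑) ⁻¹' (l i : Set X),
    isIrreducible_preimage_val (l i).isIrreducible (h i),
    (l i).isClosed.preimage continuous_subtype_val⟩, fun i ↦ ?_⟩, rfl⟩
  have hi : l i.castSucc < l i.succ := l.step i
  refine lt_of_le_not_ge (Set.preimage_mono (SetLike.coe_subset_coe.2 hi.le)) fun hcon ↦
    hi.not_ge fun x hx ↦ ?_
  exact hcon (show (⟨x, h _ hx⟩ : Z) ∈ _ from hx)

lemma eq_empty_of_topologicalKrullDim_lt_zero {X : Type*} [TopologicalSpace X] {Z : Set X}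
    (h : topologicalKrullDim Z < (0 : ℕ)) : Z = ∅ := by
  by_contra! hZ
  obtain ⟨x, hx⟩ := hZ
  refine h.not_ge (Order.le_krullDim_iff.2 ⟨⟨0, fun _ ↦ ⟨closure {⟨x, hx⟩},
    isIrreducible_singleton.closure, isClosed_closure⟩, fun i ↦ i.elim0⟩, rfl⟩)

/-- A closed subset avoiding suitable closed points of `Y` has smaller dimension than `Y`. -/
lemma exists_finset_topologicalKrullDim_lt {X : Type*} [TopologicalSpace X] [NoetherianSpace X]
    [T0Space X] {Y : Set X} (hY : IsClosed Y) {m : ℕ}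
    (hdim : topologicalKrullDim Y < (m + 1 : ℕ)) :
    ∃ S : Finset X, (∀ s ∈ S, IsClosed {s}) ∧ ∀ Z, IsClosed Z → Z ⊆ Y →
      (∀ s ∈ S, s ∉ Z) →
      topologicalKrullDim Z < m := by
  classical
  -- One closed point is taken on each component of Y. Excluding them all forces a closed subset to
  -- contain no component.
  have h (C : irreducibleComponents Y) : ∃ s : X, IsClosed {s} ∧ s ∈ (↑) '' (C : Set Y) := by
    have hc : IsClosed ((↑) '' (C : Set Y) : Set X) :=
      hY.isClosedEmbedding_subtypeVal.isClosedMap _ (isClosed_of_mem_irreducibleComponents _ C.2)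
    obtain ⟨s, hs, hs'⟩ := hc.exists_closed_singleton (C.2.1.nonempty.image _)
    exact ⟨s, hs', hs⟩
  choose s hs hsC using h
  have : Finite (irreducibleComponents Y) := NoetherianSpace.finite_irreducibleComponents
  refine ⟨(Set.finite_range s).toFinset, ?_, fun Z hZc hZY hZ ↦ ?_⟩
  · intro x hx
    obtain ⟨C, rfl⟩ := (Set.Finite.mem_toFinset _).1 hx
    exact hs C
  by_contra! hcon
  obtain ⟨l, hl⟩ := Order.le_krullDim_iff.1 hcon
  have hind : IsInducing (Set.inclusion hZY) := (IsEmbedding.inclusion hZY).isInducing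
  let l' := l.map _ (IrreducibleCloseds.map_strictMono_of_isInducing hind)
  obtain ⟨C, hC, hlC⟩ := exists_mem_irreducibleComponents_subset_of_isIrreducible _
    l'.last.isIrreducible
  let C' : IrreducibleCloseds Y := ⟨C, hC.1, isClosed_of_mem_irreducibleComponents _ hC⟩
  -- The chosen point of C is not in Z, so C strictly extends a chain coming from Z; a chain of
  -- length m in Z would give one of length m + 1 in Y.
  have hlt : l'.last < C' := by
    refine lt_of_le_not_ge hlC fun hle ↦ ?_
    obtain ⟨y, hy, hys⟩ := hsC ⟨C, hC⟩
    have h1 : y ∈ l'.last := hle hy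
    rw [LTSeries.last_map] at h1
    have h2 : y ∈ closure (Set.inclusion hZY '' (l.last : Set Z)) := h1
    have h3 : s ⟨C, hC⟩ ∉ Z := hZ _ ((Set.Finite.mem_toFinset _).2 ⟨_, rfl⟩)
    have h4 : Set.inclusion hZY '' (l.last : Set Z) ⊆ (↑) ⁻¹' Z := by
      rintro _ ⟨z, -, rfl⟩
      exact z.2
    exact h3 (hys ▸ closure_minimal h4 (hZc.preimage continuous_subtype_val) h2)
  have hfin := Order.le_krullDim_iff.2 ⟨l'.snoc C' hlt, rfl⟩
  have : (l'.snoc C' hlt).length = m + 1 := by simp [l', hl]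
  rw [this] at hfin
  exact hdim.not_ge hfin

/-- The dimension of a space is attained in every neighbourhood of some point. -/
lemma exists_point_topologicalKrullDim_eq {X : Type*} [TopologicalSpace X] {n : ℕ}
    (h : topologicalKrullDim X = n) :
    ∃ x : X, ∀ (Y : Type*) [TopologicalSpace Y] (f : Y → X), IsOpenEmbedding f → x ∈ Set.range f →
      topologicalKrullDim Y = n := by
  obtain ⟨l, hl⟩ := Order.le_krullDim_iff.1 h.ge
  -- A point of the smallest member of a maximal chain lies in every member, so the whole chain
  -- survives in any neighbourhood of it.
  obtain ⟨x, hx⟩ := l.head.isIrreducible.nonempty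
  refine ⟨x, fun Y _ f hf ⟨y, hy⟩ ↦ le_antisymm (h ▸ hf.isInducing.topologicalKrullDim_le) ?_⟩
  have hne (i) : (f ⁻¹' (l i : Set X)).Nonempty :=
    ⟨y, show f y ∈ l i from hy ▸ LTSeries.monotone l (Fin.zero_le i) hx⟩
  let e := IrreducibleCloseds.orderIsoOfIsOpenEmbedding f hf
  exact Order.le_krullDim_iff.2 ⟨⟨l.length, fun i ↦ e.symm ⟨l i, hne i⟩, fun i ↦
    e.symm.strictMono (l.step i)⟩, hl⟩

end Dimension

/-! ### Sections without common zeros -/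

section CommonZeros

variable {X : Scheme.{u}} {c : Cocycle X}

/-- On a closed subset of dimension less than `m` there are `m` sections without common zeros. -/
lemma AmpleCocycle.exists_no_common_zero [NoetherianSpace X] (hc : AmpleCocycle c) (m : ℕ)
    {Z : Set X} (hZ : IsClosed Z) (hdim : topologicalKrullDim Z < m) :
    ∃ (e : ℕ) (g : Fin m → ∀ i, Γ(X, c.U i)), 1 ≤ e ∧ (∀ j, IsSec c e (g j)) ∧
      ∀ p ∈ Z, ∃ j, p ∈ locus c (g j) := by
  induction m generalizing Z with
  | zero =>
    refine ⟨1, fun j ↦ j.elim0, le_rfl, fun j ↦ j.elim0, fun p hp ↦ ?_⟩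
    rw [eq_empty_of_topologicalKrullDim_lt_zero hdim] at hp
    exact hp.elim
  | succ m ih =>
    -- A section nonzero at the points of S lowers the dimension of the common zero set by one, and
    -- induction applies to what remains.
    obtain ⟨S, hS, hSZ⟩ := exists_finset_topologicalKrullDim_lt hZ hdim
    obtain ⟨d, h, hd, hh, hSh, -⟩ := hc.exists_sec S hS ⊤ (fun _ _ ↦ trivial)
    obtain ⟨e, g, he, hg, hgZ⟩ := ih (Z := Z ∩ (locus c h : Set X)ᶜ)
      (hZ.inter (locus c h).isOpen.isClosed_compl)
      (hSZ _ (hZ.inter (locus c h).isOpen.isClosed_compl) Set.inter_subset_left fun s hs h ↦ h.2 (hSh s hs))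
    refine ⟨d * e, Fin.cons (h ^ e) (fun j ↦ g j ^ d), Nat.mul_pos hd he, ?_, fun p hp ↦ ?_⟩
    · intro j
      refine Fin.cases ?_ (fun j ↦ ?_) j
      · rw [Fin.cons_zero, mul_comm]; exact hh.pow e
      · rw [Fin.cons_succ]; exact (hg j).pow d
    · by_cases hph : p ∈ locus c h
      · exact ⟨0, by rwa [Fin.cons_zero, locus_pow he]⟩
      · obtain ⟨j, hj⟩ := hgZ p ⟨hp, hph⟩
        exact ⟨j.succ, by rwa [Fin.cons_succ, locus_pow hd]⟩

end CommonZeros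


/-! ### Morphisms landing in an affine open set -/

section AffineTarget

variable {X Y : Scheme.{u}}

lemma toSpecΓ_SpecMap_injective {R : CommRingCat.{u}} {V : X.Opens} {α β : R ⟶ Γ(X, V)}
    (h : V.toSpecΓ ≫ Spec.map α = V.toSpecΓ ≫ Spec.map β) : α = β := by
  have h1 := congrArg (fun q : V.toScheme ⟶ Spec R ↦ q.appTop) h
  simp only [Scheme.Hom.comp_appTop, Scheme.Opens.toSpecΓ_appTop, ← Category.assoc,
    Scheme.ΓSpecIso_naturality, cancel_mono] at h1
  simpa [cancel_epi] using h1

lemma hom_ext_of_appLE {U : Y.Opens} (hU : IsAffineOpen U) {f g : X ⟶ Y} (hf : ⊤ ≤ f ⁻¹ᵁ U)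
    (hg : ⊤ ≤ g ⁻¹ᵁ U) (h : f.appLE U ⊤ hf = g.appLE U ⊤ hg) : f = g := by
  have key (f : X ⟶ Y) (hf : ⊤ ≤ f ⁻¹ᵁ U) : (⊤ : X.Opens).ι ≫ f =
      (⊤ : X.Opens).toSpecΓ ≫ Spec.map (f.appLE U ⊤ hf) ≫ hU.fromSpec := by
    rw [Scheme.Opens.toSpecΓ_SpecMap_appLE_assoc, hU.toSpecΓ_fromSpec, Scheme.Hom.resLE_comp_ι]
  have : (⊤ : X.Opens).ι ≫ f = (⊤ : X.Opens).ι ≫ g := by rw [key f hf, key g hg, h]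
  have h2 : (Scheme.topIso X).hom ≫ f = (Scheme.topIso X).hom ≫ g := this
  exact (cancel_epi _).1 h2

lemma appLE_eq_of_ι_comp {U : Y.Opens} (hU : IsAffineOpen U) {V : X.Opens} {f : X ⟶ Y}
    {θ : Γ(Y, U) ⟶ Γ(X, V)} (h : V.ι ≫ f = V.toSpecΓ ≫ Spec.map θ ≫ hU.fromSpec) :
    ∃ hV : V ≤ f ⁻¹ᵁ U, f.appLE U V hV = θ := by
  have hV : V ≤ f ⁻¹ᵁ U := fun p hp ↦ by
    have h1 : f p = (V.toSpecΓ ≫ Spec.map θ ≫ hU.fromSpec) ⟨p, hp⟩ := by rw [← h]; rfl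
    change f p ∈ U
    rw [h1]
    change hU.fromSpec _ ∈ U
    have := hU.range_fromSpec.le
    exact this ⟨_, rfl⟩
  refine ⟨hV, toSpecΓ_SpecMap_injective ?_⟩
  rw [← cancel_mono hU.fromSpec, Category.assoc, Category.assoc, ← h,
    Scheme.Opens.toSpecΓ_SpecMap_appLE_assoc, hU.toSpecΓ_fromSpec, Scheme.Hom.resLE_comp_ι]

end AffineTarget

/-! ### Rings of functions as algebras over the base field -/

section BaseField

variable {k : Type u} [CommRing k] {X Y : Scheme.{u}}

lemma le_preimage_top (f : X ⟶ Y) (V : X.Opens) : V ≤ f ⁻¹ᵁ ⊤ := le_top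

/-- The structure map of the ring of functions on an open set of a `k`-scheme. -/
def kHom (π : X ⟶ Spec (CommRingCat.of k)) (V : X.Opens) : k →+* Γ(X, V) :=
  ((Scheme.ΓSpecIso (CommRingCat.of k)).inv ≫ π.appLE ⊤ V (le_preimage_top _ _)).hom

lemma ι_comp_eq_toSpecΓ (π : X ⟶ Spec (CommRingCat.of k)) (V : X.Opens) :
    V.ι ≫ π = V.toSpecΓ ≫ Spec.map (CommRingCat.ofHom (kHom π V)) := by
  rw [kHom, CommRingCat.ofHom_hom, Spec.map_comp, Scheme.Opens.toSpecΓ_SpecMap_appLE_assoc,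
    Scheme.Opens.toSpecΓ_top, Category.assoc, Scheme.Hom.resLE_comp_ι_assoc]
  simp

lemma rs_kHom (π : X ⟶ Spec (CommRingCat.of k)) {U V : X.Opens} (h : V ≤ U) (a : k) :
    rs h (kHom π U a) = kHom π V a := by
  change ((Scheme.ΓSpecIso (CommRingCat.of k)).inv ≫ π.appLE ⊤ U (le_preimage_top _ _) ≫
    X.presheaf.map (homOfLE h).op) a = _
  rw [Scheme.Hom.appLE_map]; rfl

lemma appLE_kHom (π : Y ⟶ Spec (CommRingCat.of k)) (f : X ⟶ Y) {U : Y.Opens} {V : X.Opens}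
    (h : V ≤ f ⁻¹ᵁ U) (a : k) : f.appLE U V h (kHom π U a) = kHom (f ≫ π) V a := by
  change ((Scheme.ΓSpecIso (CommRingCat.of k)).inv ≫ π.appLE ⊤ U (le_preimage_top _ _) ≫ f.appLE U V h) a = _
  rw [Scheme.Hom.appLE_comp_appLE]; rfl

end BaseField

/-! ### The standard charts of projective space -/

section Charts

variable (k : Type u) [Field k] {n : ℕ}

attribute [local instance] MvPolynomial.gradedAlgebra

open HomogeneousLocalization

/-- The degree zero part of the localization at `xᵢ`. -/
abbrev ChartRing (i : Fin (n + 1)) : Type u := Away (grading k n) (MvPolynomial.X i)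

/-- The element `xⱼ / xᵢ`. -/
def ChartRing.ratio (i j : Fin (n + 1)) : ChartRing k i :=
  Away.mk (grading k n) (PSpace.X_mem_grading k i) 1 (MvPolynomial.X j)
      (by simpa only [smul_eq_mul, mul_one] using PSpace.X_mem_grading k j)

lemma PSpace.ratio_eq (i j : Fin (n + 1)) :
    PSpace.ratio k i j = Proj.awayToSection (grading k n) (MvPolynomial.X i)
      (ChartRing.ratio k i j) := rfl

lemma PSpace.isAffineOpen_chart (i : Fin (n + 1)) : IsAffineOpen (PSpace.chart k i) :=
  Proj.isAffineOpen_basicOpen _ _ (PSpace.X_mem_grading k i) one_pos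

lemma PSpace.awayToSection_bijective (i : Fin (n + 1)) : Function.Bijective
    (Proj.awayToSection (grading k n) (MvPolynomial.X i)).hom := by
  rw [← Proj.basicOpenIsoAway_hom _ _ (PSpace.X_mem_grading k i) one_pos]
  exact ConcreteCategory.bijective_of_isIso
    (Proj.basicOpenIsoAway (grading k n) _ (PSpace.X_mem_grading k i) one_pos).hom

/-- The structure map of the ring of a chart. -/
def ChartRing.scalar (i : Fin (n + 1)) : k →+* ChartRing k i :=
  (fromZeroRingHom (grading k n) _).comp (algebraMap k (grading k n 0))

lemma PSpace.kHom_structureMap (i : Fin (n + 1)) (a : k) :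
    kHom (PSpace.structureMap k n) (PSpace.chart k i) a =
      Proj.awayToSection (grading k n) (MvPolynomial.X i) (ChartRing.scalar k i a) := by
  have h : CommRingCat.ofHom (kHom (PSpace.structureMap k n) (PSpace.chart k i)) =
      CommRingCat.ofHom (ChartRing.scalar k i) ≫
        Proj.awayToSection (grading k n) (MvPolynomial.X i) := by
    refine toSpecΓ_SpecMap_injective (X := PSpace k n) (V := PSpace.chart k i) ?_
    rw [← ι_comp_eq_toSpecΓ, Spec.map_comp]
    have h1 : (PSpace.chart k i).ι = Proj.basicOpenToSpec (grading k n) (MvPolynomial.X i) ≫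
        Proj.awayι (grading k n) _ (PSpace.X_mem_grading k i) one_pos := by
      rw [← Proj.basicOpenIsoSpec_inv_ι,
        ← Proj.basicOpenIsoSpec_hom _ _ (PSpace.X_mem_grading k i) one_pos, Iso.hom_inv_id_assoc]
    rw [h1, PSpace.structureMap, Category.assoc, Proj.awayι_toSpecZero_assoc, ← Spec.map_comp,
      Proj.basicOpenToSpec, Category.assoc]
    rfl
  exact DFunLike.congr_fun (congrArg CommRingCat.Hom.hom h) a

lemma ChartRing.ratio_self (i : Fin (n + 1)) : ChartRing.ratio k i i = 1 := by
  apply val_injective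
  rw [ChartRing.ratio, Away.val_mk, val_one, Localization.mk_eq_mk', IsLocalization.mk'_eq_iff_eq_mul]
  simp

lemma ChartRing.ratio_mul (i j : Fin (n + 1)) :
    (ChartRing.ratio k i j).val *
      algebraMap (MvPolynomial (Fin (n + 1)) k) _ (MvPolynomial.X i) =
      algebraMap (MvPolynomial (Fin (n + 1)) k) _ (MvPolynomial.X j) := by
  rw [ChartRing.ratio, Away.val_mk, Localization.mk_eq_mk']
  simpa only [pow_one] using IsLocalization.mk'_spec _
    (MvPolynomial.X j : MvPolynomial (Fin (n + 1)) k)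
    (⟨MvPolynomial.X i ^ 1, ⟨1, rfl⟩⟩ : Submonoid.powers (MvPolynomial.X i))

lemma PSpace.ratio_self (i : Fin (n + 1)) : PSpace.ratio k i i = 1 := by
  rw [PSpace.ratio_eq, ChartRing.ratio_self]
  exact map_one (Proj.awayToSection (grading k n) (MvPolynomial.X i)).hom

lemma ChartRing.val_scalar (i : Fin (n + 1)) (a : k) :
    (ChartRing.scalar k i a).val = algebraMap _ _ (MvPolynomial.C (σ := Fin (n + 1)) a) := by
  rw [ChartRing.scalar, RingHom.comp_apply]
  exact Localization.mk_one_eq_algebraMap _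

/-- Polynomials in the ratios. -/
def ChartRing.evalRatio (i : Fin (n + 1)) : MvPolynomial (Fin (n + 1)) k →+* ChartRing k i :=
  MvPolynomial.eval₂Hom (ChartRing.scalar k i) (ChartRing.ratio k i)

/-- This is P(x / x_i) · x_i^m = P, checked monomial by monomial. It yields surjectivity of
`evalRatio`, so that maps out of a chart are determined by their values on scalars and ratios. -/
lemma ChartRing.evalRatio_of_isHomogeneous (i : Fin (n + 1)) (m : ℕ)
    {P : MvPolynomial (Fin (n + 1)) k} (hP : P.IsHomogeneous m) :
    (ChartRing.evalRatio k i P).val * algebraMap _ _ ((MvPolynomial.X i : MvPolynomial (Fin (n + 1)) k) ^ m) =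
      algebraMap _ (Localization.Away (MvPolynomial.X i)) P := by
  rw [P.as_sum, map_sum, map_sum, ← HomogeneousLocalization.algebraMap_apply, map_sum, Finset.sum_mul]
  refine Finset.sum_congr rfl fun s hs ↦ ?_
  have hs' : s.sum (fun _ e ↦ e) = m := by
    have := hP (MvPolynomial.mem_support_iff.1 hs)
    simpa [Finsupp.weight_apply] using this
  rw [evalRatio, MvPolynomial.coe_eval₂Hom, MvPolynomial.eval₂_monomial, MvPolynomial.monomial_eq,
    map_mul, map_mul, HomogeneousLocalization.algebraMap_apply, val_scalar, mul_assoc]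
  congr 1
  rw [← hs', Finsupp.prod, Finsupp.prod, Finsupp.sum, ← Finset.prod_pow_eq_pow_sum, map_prod,
    map_prod, map_prod, ← Finset.prod_mul_distrib]
  refine Finset.prod_congr rfl fun j _ ↦ ?_
  rw [map_pow, map_pow, map_pow, ← mul_pow, HomogeneousLocalization.algebraMap_apply, ratio_mul]

lemma ChartRing.evalRatio_surjective (i : Fin (n + 1)) :
    Function.Surjective (ChartRing.evalRatio k i) := by
  intro x
  obtain ⟨m, P, hP, rfl⟩ := Away.mk_surjective (grading k n) (PSpace.X_mem_grading k i) x
  have hP' : P.IsHomogeneous m := by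
    simpa using (MvPolynomial.mem_homogeneousSubmodule _ _).1 hP
  refine ⟨P, val_injective _ ?_⟩
  rw [Away.val_mk, Localization.mk_eq_mk', IsLocalization.eq_mk'_iff_mul_eq]
  exact ChartRing.evalRatio_of_isHomogeneous k i m hP'

lemma PSpace.exists_evalRatio (i : Fin (n + 1)) (x : Γ(PSpace k n, PSpace.chart k i)) :
    ∃ P : MvPolynomial (Fin (n + 1)) k, x = MvPolynomial.eval₂Hom
      (kHom (PSpace.structureMap k n) (PSpace.chart k i)) (PSpace.ratio k i) P := by
  obtain ⟨y, rfl⟩ := (PSpace.awayToSection_bijective k i).2 x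
  obtain ⟨P, rfl⟩ := ChartRing.evalRatio_surjective k i y
  refine ⟨P, ?_⟩
  rw [ChartRing.evalRatio, MvPolynomial.coe_eval₂Hom, MvPolynomial.coe_eval₂Hom,
    ← RingHom.coe_coe (Proj.awayToSection (grading k n) (MvPolynomial.X i)).hom,
    MvPolynomial.hom_eval₂]
  congr 1
  ext a
  exact (PSpace.kHom_structureMap k i a).symm

/-- Functions on a chart are polynomials in the ratios. -/
lemma PSpace.ringHom_ext (i : Fin (n + 1)) {B : Type*} [CommRing B]
    {θ θ' : Γ(PSpace k n, PSpace.chart k i) →+* B}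
    (h : ∀ a, θ (kHom (PSpace.structureMap k n) _ a) = θ' (kHom (PSpace.structureMap k n) _ a))
    (hr : ∀ j, θ (PSpace.ratio k i j) = θ' (PSpace.ratio k i j)) : θ = θ' := by
  ext x
  obtain ⟨P, rfl⟩ := PSpace.exists_evalRatio k i x
  rw [MvPolynomial.coe_eval₂Hom, MvPolynomial.hom_eval₂, MvPolynomial.hom_eval₂]
  congr 1
  · ext a; exact h a
  · funext j; exact hr j

/-- Evaluation x_j ↦ r_j sends x_i to 1, so it extends to the localization at x_i and restricts to
its degree zero part. -/
lemma ChartRing.exists_ringHom (i : Fin (n + 1)) {B : Type*} [CommRing B] (κ : k →+* B)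
    (r : Fin (n + 1) → B) (hr : r i = 1) : ∃ θ : ChartRing k i →+* B,
      (∀ a, θ (ChartRing.scalar k i a) = κ a) ∧ ∀ j, θ (ChartRing.ratio k i j) = r j := by
  have hu : IsUnit (MvPolynomial.eval₂Hom κ r (MvPolynomial.X i)) := by simp [hr]
  let φ : Localization.Away (MvPolynomial.X i : MvPolynomial (Fin (n + 1)) k) →+* B :=
    IsLocalization.Away.lift _ hu
  have hφ (P : MvPolynomial (Fin (n + 1)) k) :
      φ (algebraMap _ _ P) = MvPolynomial.eval₂Hom κ r P := IsLocalization.Away.lift_eq _ hu P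
  refine ⟨φ.comp (algebraMap (ChartRing k i) (Localization.Away _)), fun a ↦ ?_, fun j ↦ ?_⟩
  · rw [RingHom.comp_apply, HomogeneousLocalization.algebraMap_apply, val_scalar, hφ]
    simp
  · have := congrArg φ (ChartRing.ratio_mul k i j)
    rw [map_mul, hφ, hφ] at this
    simpa [hr] using this

/-- A chart is an affine space with the ratios as coordinates. -/
lemma PSpace.exists_ringHom (i : Fin (n + 1)) {B : Type*} [CommRing B] (κ : k →+* B)
    (r : Fin (n + 1) → B) (hr : r i = 1) : ∃ θ : Γ(PSpace k n, PSpace.chart k i) →+* B,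
      (∀ a, θ (kHom (PSpace.structureMap k n) _ a) = κ a) ∧
        ∀ j, θ (PSpace.ratio k i j) = r j := by
  obtain ⟨θ, h1, h2⟩ := ChartRing.exists_ringHom k i κ r hr
  let e := RingEquiv.ofBijective _ (PSpace.awayToSection_bijective k i)
  refine ⟨θ.comp e.symm.toRingHom, fun a ↦ ?_, fun j ↦ ?_⟩
  · rw [PSpace.kHom_structureMap, ← h1]
    exact congrArg θ (e.symm_apply_apply _)
  · rw [PSpace.ratio_eq, ← h2]
    exact congrArg θ (e.symm_apply_apply _)

lemma PSpace.chart_inf_chart (i j : Fin (n + 1)) : PSpace.chart k i ⊓ PSpace.chart k j =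
    (PSpace k n).basicOpen (PSpace.ratio k i j) := by
  have h1 : (PSpace.chart k i).ι ⁻¹ᵁ PSpace.chart k j =
      (PSpace.chart k i).ι ⁻¹ᵁ (PSpace k n).basicOpen (PSpace.ratio k i j) := by
    rw [← Scheme.Opens.toSpecΓ_preimage_basicOpen, PSpace.ratio_eq]
    have h1 : (PSpace.chart k i).ι = Proj.basicOpenToSpec (grading k n) (MvPolynomial.X i) ≫
        Proj.awayι (grading k n) _ (PSpace.X_mem_grading k i) one_pos := by
      rw [← Proj.basicOpenIsoSpec_inv_ι,
        ← Proj.basicOpenIsoSpec_hom _ _ (PSpace.X_mem_grading k i) one_pos, Iso.hom_inv_id_assoc]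
    have : Away.isLocalizationElem (PSpace.X_mem_grading k i) (PSpace.X_mem_grading k j) =
      ChartRing.ratio k i j := by
      apply val_injective
      simp [ChartRing.ratio, Away.val_mk]
    rw [h1, Scheme.Hom.comp_preimage, Proj.awayι_preimage_basicOpen _ _ _
      (PSpace.X_mem_grading k j) one_pos, this, Proj.basicOpenToSpec]
    rfl
  ext p
  refine ⟨fun hp ↦ ?_, fun hp ↦ ?_⟩
  · exact (SetLike.ext_iff.1 h1 ⟨p, hp.1⟩).1 hp.2
  · have hp1 := (PSpace k n).basicOpen_le _ hp
    exact ⟨hp1, (SetLike.ext_iff.1 h1 ⟨p, hp1⟩).2 hp⟩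

lemma ChartRing.awayMap_ratio_mul {f : MvPolynomial (Fin (n + 1)) k} (i j : Fin (n + 1)) {d : ℕ}
    {g : MvPolynomial (Fin (n + 1)) k} (hg : g ∈ grading k n d) (hf : f = MvPolynomial.X i * g) :
    (awayMap (grading k n) hg hf (ChartRing.ratio k i j)).val *
      algebraMap (MvPolynomial (Fin (n + 1)) k) _ (MvPolynomial.X i) =
        algebraMap (MvPolynomial (Fin (n + 1)) k) _ (MvPolynomial.X j) := by
  have h : IsUnit (algebraMap (MvPolynomial (Fin (n + 1)) k) (Localization.Away f)
      (MvPolynomial.X i)) :=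
    isUnit_of_dvd_unit (map_dvd _ ⟨_, hf⟩) (IsLocalization.Away.algebraMap_isUnit f)
  rw [val_awayMap]
  have := congrArg (Localization.awayLift (algebraMap _ (Localization.Away f)) _ h)
    (ChartRing.ratio_mul k i j)
  rw [map_mul] at this
  convert this using 2
  · exact (IsLocalization.Away.lift_eq _ h _).symm
  · exact (IsLocalization.Away.lift_eq _ h _).symm

/-- The identity is verified in the localization at x_i x_j, after multiplication by the unit x_i.
-/
lemma PSpace.rs_ratio (i j l : Fin (n + 1)) {V : (PSpace k n).Opens} (hi : V ≤ PSpace.chart k i)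
    (hj : V ≤ PSpace.chart k j) : rs hi (PSpace.ratio k i l) =
      rs hi (PSpace.ratio k i j) * rs hj (PSpace.ratio k j l) := by
  set f : MvPolynomial (Fin (n + 1)) k := MvPolynomial.X i * MvPolynomial.X j with hf
  have hf' : f = MvPolynomial.X j * MvPolynomial.X i := mul_comm _ _
  have hV : V ≤ Proj.basicOpen (grading k n) f := by
    rw [hf, Proj.basicOpen_mul]; exact le_inf hi hj
  have hi' : Proj.basicOpen (grading k n) f ≤ PSpace.chart k i := Proj.basicOpen_mono _ _ _ ⟨_, hf⟩
  have hj' : Proj.basicOpen (grading k n) f ≤ PSpace.chart k j := Proj.basicOpen_mono _ _ _ ⟨_, hf'⟩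
  have hs (l) : rs hi' (PSpace.ratio k i l) = (Proj.awayToSection (grading k n) f).hom
      (awayMap (grading k n) (PSpace.X_mem_grading k j) hf (ChartRing.ratio k i l)) :=
    (DFunLike.congr_fun (congrArg CommRingCat.Hom.hom (Proj.awayMap_awayToSection (grading k n)
      (PSpace.X_mem_grading k j) hf)) (ChartRing.ratio k i l)).symm
  have hs' (l) : rs hj' (PSpace.ratio k j l) = (Proj.awayToSection (grading k n) f).hom
      (awayMap (grading k n) (PSpace.X_mem_grading k i) hf' (ChartRing.ratio k j l)) :=
    (DFunLike.congr_fun (congrArg CommRingCat.Hom.hom (Proj.awayMap_awayToSection (grading k n)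
      (PSpace.X_mem_grading k i) hf')) (ChartRing.ratio k j l)).symm
  have key : rs hi' (PSpace.ratio k i l) =
      rs hi' (PSpace.ratio k i j) * rs hj' (PSpace.ratio k j l) := by
    rw [hs, hs, hs', ← map_mul]
    congr 1
    apply val_injective
    have h : IsUnit (algebraMap (MvPolynomial (Fin (n + 1)) k) (Localization.Away f)
        (MvPolynomial.X i)) :=
      isUnit_of_dvd_unit (map_dvd _ ⟨_, hf⟩) (IsLocalization.Away.algebraMap_isUnit f)
    rw [← h.mul_left_inj, val_mul, mul_right_comm]
    erw [ChartRing.awayMap_ratio_mul, ChartRing.awayMap_ratio_mul, mul_comm,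
      ChartRing.awayMap_ratio_mul]
  rw [← rs_rs hi' hV, ← rs_rs hi' hV, ← rs_rs hj' hV, key, map_mul]

end Charts


/-! ### Morphisms to projective space from sections -/

section MapsToProjectiveSpace

variable {k : Type u} [Field k] {n : ℕ} {X T : Scheme.{u}}

lemma appLE_rs {Y : Scheme.{u}} (f : X ⟶ Y) {U U' : Y.Opens} {V : X.Opens} (h : V ≤ f ⁻¹ᵁ U')
    (h' : U' ≤ U) (a : Γ(Y, U)) : f.appLE U' V h (rs h' a) =
      f.appLE U V (h.trans (f.preimage_mono h')) a := by
  change (Y.presheaf.map (homOfLE h').op ≫ f.appLE U' V h) a = _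
  rw [Scheme.Hom.map_appLE]

lemma rs_appLE {Y : Scheme.{u}} (f : X ⟶ Y) {U : Y.Opens} {V V' : X.Opens} (h : V ≤ f ⁻¹ᵁ U)
    (h' : V' ≤ V) (a : Γ(Y, U)) : rs h' (f.appLE U V h a) = f.appLE U V' (h'.trans h) a := by
  change (f.appLE U V h ≫ X.presheaf.map (homOfLE h').op) a = _
  rw [Scheme.Hom.appLE_map]

lemma appLE_comp_apply {Y Z : Scheme.{u}} (f : X ⟶ Y) (g : Y ⟶ Z) {U : Z.Opens} {V : Y.Opens}
    {W : X.Opens} (h : V ≤ g ⁻¹ᵁ U) (h' : W ≤ f ⁻¹ᵁ V) (a : Γ(Z, U)) :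
    f.appLE V W h' (g.appLE U V h a) =
      (f ≫ g).appLE U W (h'.trans (f.preimage_mono h)) a := by
  change (g.appLE U V h ≫ f.appLE V W h') a = _
  rw [Scheme.Hom.appLE_comp_appLE]

lemma preimage_basicOpen_inf {Y : Scheme.{u}} (f : X ⟶ Y) {U : Y.Opens} {V : X.Opens}
    (h : V ≤ f ⁻¹ᵁ U) (a : Γ(Y, U)) :
    X.basicOpen (f.appLE U V h a) = V ⊓ f ⁻¹ᵁ Y.basicOpen a := by
  rw [Scheme.Hom.preimage_basicOpen, ← Scheme.basicOpen_res]
  rfl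

/-- Proportional homogeneous coordinates give the same map. Invertibility of x_l / x_m brings `q'`
into chart l, where ratios can be compared; this is the agreement needed for gluing. -/
lemma PSpace.hom_ext_of_ratio {q q' : T ⟶ PSpace k n} {l m : Fin (n + 1)}
    (hk : q ≫ PSpace.structureMap k n = q' ≫ PSpace.structureMap k n)
    (h : ⊤ ≤ q ⁻¹ᵁ PSpace.chart k l) (h' : ⊤ ≤ q' ⁻¹ᵁ PSpace.chart k m)
    (hu : IsUnit (q'.appLE _ ⊤ h' (PSpace.ratio k m l)))
    (hr : ∀ j, q'.appLE _ ⊤ h' (PSpace.ratio k m j) =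
      q'.appLE _ ⊤ h' (PSpace.ratio k m l) * q.appLE _ ⊤ h (PSpace.ratio k l j)) : q = q' := by
  have h2 : ⊤ ≤ q' ⁻¹ᵁ (PSpace.chart k m ⊓ PSpace.chart k l) := by
    rw [PSpace.chart_inf_chart]
    have h3 := preimage_basicOpen_inf q' h' (PSpace.ratio k m l)
    rw [Scheme.basicOpen_of_isUnit _ hu] at h3
    exact h3.le.trans inf_le_right
  have h3 : ⊤ ≤ q' ⁻¹ᵁ PSpace.chart k l := h2.trans (q'.preimage_mono inf_le_right)
  refine hom_ext_of_appLE (PSpace.isAffineOpen_chart k l) h h3 ?_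
  ext1
  refine PSpace.ringHom_ext k l (fun a ↦ ?_) fun j ↦ ?_
  · exact (appLE_kHom _ q h a).trans ((by rw [hk] : kHom _ _ a = kHom _ _ a).trans
      (appLE_kHom _ q' h3 a).symm)
  · rw [← hu.mul_right_inj]
    have h4 := PSpace.rs_ratio k m l j (V := PSpace.chart k m ⊓ PSpace.chart k l)
      inf_le_left inf_le_right
    have h5 := congrArg (q'.appLE _ ⊤ h2).hom h4
    rw [map_mul] at h5
    erw [appLE_rs, appLE_rs, appLE_rs] at h5
    exact (hr j).symm.trans h5

lemma appLE_comp_toSpecΓ {Y : Scheme.{u}} {U : Y.Opens} (hU : IsAffineOpen U) {V : X.Opens}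
    (θ : Γ(Y, U) ⟶ Γ(X, V)) (t : T ⟶ V) (W : T.Opens) :
    ∃ (h : W ≤ (t ≫ V.toSpecΓ ≫ Spec.map θ ≫ hU.fromSpec) ⁻¹ᵁ U)
      (h' : W ≤ (t ≫ V.ι) ⁻¹ᵁ V), ∀ a, (t ≫ V.toSpecΓ ≫ Spec.map θ ≫ hU.fromSpec).appLE U W h a =
      (t ≫ V.ι).appLE V W h' (θ a) := by
  have h' : W ≤ (t ≫ V.ι) ⁻¹ᵁ V := fun p _ ↦ (t p).2
  have h1 : W.ι ≫ t = (t ≫ V.ι).resLE V W h' := by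
    rw [← cancel_mono V.ι, Scheme.Hom.resLE_comp_ι, Category.assoc]
  obtain ⟨h, h2⟩ := appLE_eq_of_ι_comp hU (V := W)
    (f := t ≫ V.toSpecΓ ≫ Spec.map θ ≫ hU.fromSpec) (θ := θ ≫ (t ≫ V.ι).appLE V W h') (by
      rw [Spec.map_comp, Category.assoc, Scheme.Opens.toSpecΓ_SpecMap_appLE_assoc, ← h1,
        Category.assoc])
  exact ⟨h, h', fun a ↦ by rw [h2]; rfl⟩

lemma fromSpec_comp (π : X ⟶ Spec (CommRingCat.of k)) {U : X.Opens} (hU : IsAffineOpen U) :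
    hU.fromSpec ≫ π = Spec.map (CommRingCat.ofHom (kHom π U)) := by
  rw [← cancel_epi hU.isoSpec.hom, hU.isoSpec_hom, hU.toSpecΓ_fromSpec_assoc, ι_comp_eq_toSpecΓ]

lemma exists_glue {ι : Type*} {Y : Scheme.{u}} (V : ι → X.Opens) (hV : ∀ p, ∃ l, p ∈ V l)
    (φ : ∀ l, (V l).toScheme ⟶ Y) (h : ∀ l m (T : Scheme.{u}) (t : T ⟶ V l) (t' : T ⟶ V m),
      t ≫ (V l).ι = t' ≫ (V m).ι → t ≫ φ l = t' ≫ φ m) :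
    ∃ f : X ⟶ Y, ∀ l, (V l).ι ≫ f = φ l := by
  let 𝒰 := X.openCoverOfIsOpenCover V (top_unique fun p _ ↦ Opens.mem_iSup.2 (hV p))
  exact ⟨𝒰.glueMorphisms φ fun l m ↦ h l m _ _ _ Limits.pullback.condition,
    fun l ↦ 𝒰.ι_glueMorphisms φ _ l⟩

lemma hom_ext_of_opens {ι : Type*} {Y : Scheme.{u}} (V : ι → X.Opens) (hV : ∀ p, ∃ l, p ∈ V l)
    {f g : X ⟶ Y} (h : ∀ l, (V l).ι ≫ f = (V l).ι ≫ g) : f = g := by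
  let 𝒰 := X.openCoverOfIsOpenCover V (top_unique fun p _ ↦ Opens.mem_iSup.2 (hV p))
  exact 𝒰.hom_ext _ _ h

/-- Each V_l maps to chart l by the functions r_l. The change-of-chart rule `hr` makes the maps
glue, and `hbasic` keeps the preimage of a chart from exceeding V_l. -/
lemma PSpace.exists_hom (π : X ⟶ Spec (CommRingCat.of k)) (V : Fin (n + 1) → X.Opens)
    (hV : ∀ p, ∃ l, p ∈ V l) (r : ∀ l, Fin (n + 1) → Γ(X, V l)) (hself : ∀ l, r l l = 1)
    (hbasic : ∀ l m, V l ⊓ V m = X.basicOpen (r l m))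
    (hr : ∀ l m j, rs (inf_le_left : V l ⊓ V m ≤ V l) (r l j) =
      rs (inf_le_left : V l ⊓ V m ≤ V l) (r l m) *
        rs (inf_le_right : V l ⊓ V m ≤ V m) (r m j)) :
    ∃ f : X ⟶ PSpace k n, f ≫ PSpace.structureMap k n = π ∧
      ∀ l, ∃ h : f ⁻¹ᵁ PSpace.chart k l = V l, ∀ j,
        f.appLE _ (V l) h.ge (PSpace.ratio k l j) = r l j := by
  choose θ hθ hθr using fun l ↦ PSpace.exists_ringHom k l (kHom π (V l)) (r l) (hself l)
  let φ (l : Fin (n + 1)) : (V l).toScheme ⟶ PSpace k n := (V l).toSpecΓ ≫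
    Spec.map (CommRingCat.ofHom (θ l)) ≫ (PSpace.isAffineOpen_chart k l).fromSpec
  have hφ (l) {T : Scheme.{u}} (t : T ⟶ V l) (W : T.Opens) :
      ∃ (h : W ≤ (t ≫ φ l) ⁻¹ᵁ PSpace.chart k l) (h' : W ≤ (t ≫ (V l).ι) ⁻¹ᵁ V l),
        ∀ a, (t ≫ φ l).appLE _ W h a = (t ≫ (V l).ι).appLE (V l) W h' (θ l a) :=
    appLE_comp_toSpecΓ (PSpace.isAffineOpen_chart k l) _ t W
  have hφk (l) : φ l ≫ PSpace.structureMap k n = (V l).ι ≫ π := by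
    rw [Category.assoc, Category.assoc, fromSpec_comp, ι_comp_eq_toSpecΓ, ← Spec.map_comp]
    congr 2
    ext a
    exact hθ l a
  have hglue (l m) (T : Scheme.{u}) (t : T ⟶ V l) (t' : T ⟶ V m)
      (h : t ≫ (V l).ι = t' ≫ (V m).ι) : t ≫ φ l = t' ≫ φ m := by
    obtain ⟨h1, h1', H1⟩ := hφ l t ⊤
    obtain ⟨h2, h2', H2⟩ := hφ m t' ⊤
    have h2'' : ⊤ ≤ (t ≫ (V l).ι) ⁻¹ᵁ V m := by rw [h]; exact h2'
    replace H2 (a) : (t' ≫ φ m).appLE _ ⊤ h2 a = (t ≫ (V l).ι).appLE (V m) ⊤ h2'' (θ m a) := by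
      rw [H2]; simp only [h]
    have h3 : ⊤ ≤ (t ≫ (V l).ι) ⁻¹ᵁ (V m ⊓ V l) := fun p hp ↦ ⟨h2'' hp, h1' hp⟩
    refine PSpace.hom_ext_of_ratio (l := l) (m := m) ?_ h1 h2 ?_ fun j ↦ ?_
    · rw [Category.assoc t, Category.assoc t', hφk, hφk, reassoc_of% h]
    · rw [H2, hθr, ← rs_self le_rfl (Scheme.Hom.appLE _ _ _ _ _)]
      refine isUnit_rs_of_le le_rfl ?_
      rw [preimage_basicOpen_inf, ← hbasic]
      exact le_inf le_rfl h3
    · rw [H2, H2, H1, hθr, hθr, hθr]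
      have := congrArg ((t ≫ (V l).ι).appLE _ ⊤ h3).hom (hr m l j)
      rw [map_mul] at this
      erw [appLE_rs, appLE_rs, appLE_rs] at this
      exact this
  obtain ⟨f, hf⟩ := exists_glue V hV φ hglue
  have hle (l) : V l ≤ f ⁻¹ᵁ PSpace.chart k l := fun p hp ↦ by
    obtain ⟨h1, h1', H1⟩ := hφ l (𝟙 _) ⊤
    have := h1 (x := ⟨p, hp⟩) trivial
    rw [Category.id_comp, ← hf l] at this
    exact this
  have happ (l j) : f.appLE _ (V l) (hle l) (PSpace.ratio k l j) = r l j := by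
    obtain ⟨h, h1⟩ := appLE_eq_of_ι_comp (PSpace.isAffineOpen_chart k l) (hf l)
    rw [h1]
    exact hθr l j
  refine ⟨f, hom_ext_of_opens V hV fun l ↦ ?_, fun l ↦ ⟨le_antisymm (fun p hp ↦ ?_) (hle l), ?_⟩⟩
  · rw [reassoc_of% hf l, hφk]
  -- If p lies in V_m and maps into chart l, then r_{ml} does not vanish at p, which by `hbasic`
  -- puts p in V_l.
  · obtain ⟨m, hm⟩ := hV p
    have h1 : p ∈ V m ⊓ f ⁻¹ᵁ (PSpace.chart k m ⊓ PSpace.chart k l) := ⟨hm, hle m hm, hp⟩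
    rw [PSpace.chart_inf_chart, ← preimage_basicOpen_inf f (hle m), happ, ← hbasic] at h1
    exact h1.2
  · exact happ l

lemma rs_injective_of_isSec {c : Cocycle X} {d : ℕ} {a : ∀ i, Γ(X, c.U i)} (ha : IsSec c d a)
    {V : X.Opens} (hV : V ≤ locus c a) {x y : Γ(X, V)}
    (h : ∀ (i : c.ι) (W : X.Opens) (hW : W ≤ V) (hU : W ≤ c.U i),
      rs hW x * rs hU (a i) = rs hW y * rs hU (a i)) : x = y := by
  refine rs_ext fun p hp ↦ ?_
  obtain ⟨i, hi⟩ := c.cover p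
  refine ⟨V ⊓ c.U i, inf_le_left, ⟨hp, hi⟩, ?_⟩
  exact (ha.isUnit_rs (inf_le_left.trans hV) inf_le_right).mul_left_injective
    (h i _ inf_le_left inf_le_right)

/-- Sections without common zeros define a morphism to projective space. -/
lemma exists_hom_of_isSec (π : X ⟶ Spec (CommRingCat.of k)) {c : Cocycle X} {d : ℕ}
    {a : Fin (n + 1) → ∀ i, Γ(X, c.U i)} (ha : ∀ l, IsSec c d (a l))
    (hV : ∀ p, ∃ l, p ∈ locus c (a l)) :
    ∃ f : X ⟶ PSpace k n, f ≫ PSpace.structureMap k n = π ∧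
      ∀ l, ∃ h : f ⁻¹ᵁ PSpace.chart k l = locus c (a l), ∀ j (i : c.ι) (V : X.Opens)
        (hV : V ≤ locus c (a l)) (hU : V ≤ c.U i),
        f.appLE _ V (hV.trans h.ge) (PSpace.ratio k l j) * rs hU (a l i) = rs hU (a j i) := by
  choose r hr using fun l j ↦ exists_ratio (ha j) (ha l)
  have h1 (l) : r l l = 1 := by
    refine rs_injective_of_isSec (ha l) le_rfl fun i W hW hU ↦ ?_
    rw [hr, map_one, one_mul]
  have h2 (l m) : locus c (a l) ⊓ locus c (a m) = X.basicOpen (r l m) := by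
    ext p
    simp only [SetLike.mem_coe]
    have key (hp : p ∈ locus c (a l)) : p ∈ X.basicOpen (r l m) ↔ p ∈ locus c (a m) := by
      obtain ⟨i, hi⟩ := c.cover p
      have h2 : p ∈ locus c (a l) ⊓ c.U i := ⟨hp, hi⟩
      rw [(ha m).mem_locus_iff hi, ← mem_basicOpen_rs inf_le_left (r l m) h2,
        ← mem_basicOpen_rs inf_le_right (a m i) h2, ← hr l m i _ inf_le_left inf_le_right,
        Scheme.basicOpen_mul]
      refine ⟨fun h ↦ ⟨h, ?_⟩, fun h ↦ h.1⟩
      exact (mem_basicOpen_rs inf_le_right _ h2).2 (((ha l).mem_locus_iff hi).1 hp)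
    refine ⟨fun hp ↦ (key hp.1).2 hp.2, fun hp ↦ ?_⟩
    have h1 := X.basicOpen_le _ hp
    exact ⟨h1, (key h1).1 hp⟩
  have h3 (l m j) : rs (inf_le_left : locus c (a l) ⊓ locus c (a m) ≤ _) (r l j) =
      rs (inf_le_left : locus c (a l) ⊓ locus c (a m) ≤ _) (r l m) *
        rs (inf_le_right : locus c (a l) ⊓ locus c (a m) ≤ _) (r m j) := by
    refine rs_injective_of_isSec (ha l) inf_le_left fun i W hW hU ↦ ?_
    rw [map_mul, rs_rs, rs_rs, rs_rs, hr, mul_right_comm, hr, mul_comm, hr]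
  obtain ⟨f, hf, h⟩ := PSpace.exists_hom π (fun l ↦ locus c (a l)) hV r h1 h2 h3
  refine ⟨f, hf, fun l ↦ ⟨(h l).1, fun j i V hV hU ↦ ?_⟩⟩
  rw [← hr l j i V hV hU, ← (h l).2, rs_appLE]

/-- The morphism defined by sections is induced by the corresponding sections of the line bundle. -/
lemma isInducedBy_of_isSec {L : X.Modules} {c : Cocycle X} (F : Frames L c) {d : ℕ}
    {a : Fin (n + 1) → ∀ i, Γ(X, c.U i)} (ha : ∀ l, IsSec c d (a l)) {f : X ⟶ PSpace k n}
    (hf : ∀ l, ∃ h : f ⁻¹ᵁ PSpace.chart k l = locus c (a l), ∀ j (i : c.ι) (V : X.Opens)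
        (hV : V ≤ locus c (a l)) (hU : V ≤ c.U i),
        f.appLE _ V (hV.trans h.ge) (PSpace.ratio k l j) * rs hU (a l i) = rs hU (a j i)) :
    ∃ s : Fin (n + 1) → Γ(tensorPow L d, ⊤), IsInducedBy f (tensorPow L d) s := by
  choose s hs using fun l ↦ exists_represents F (ha l)
  refine ⟨s, fun l ↦ ?_⟩
  obtain ⟨h, H⟩ := hf l
  refine ⟨by rw [h, (hs l).nonvanishing_eq F (ha l)], fun j ↦ ?_⟩
  refine (hs l).res_eq_smul F (hs j) _ fun i ↦ ?_
  rw [← H j i _ (inf_le_left.trans h.le) inf_le_right, Scheme.Hom.app_eq_appLE, rs_appLE]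

end MapsToProjectiveSpace


/-! ### Finiteness from properness and ampleness -/

section Finiteness

variable {X Y : Scheme.{u}}

lemma adjoin_eq_top_of_tower (R : Type*) {S A : Type*} [CommSemiring R] [CommSemiring S]
    [Semiring A] [Algebra R S] [Algebra S A] [Algebra R A] [IsScalarTower R S A] {s : Set A}
    (h : Algebra.adjoin R s = ⊤) : Algebra.adjoin S s = ⊤ := by
  have h2 : Algebra.adjoin R s ≤ (Algebra.adjoin S s).restrictScalars R :=
    Algebra.adjoin_le Algebra.subset_adjoin
  rw [h] at h2
  exact top_unique fun x _ ↦ h2 (Algebra.mem_top (x := x))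

/-- For quasi-affine X the map to Spec Γ(X) is an immersion. It is proper because its composite to
Spec Γ(Y) is, so it is a closed immersion into an affine scheme. -/
lemma isAffine_of_isProper [X.IsQuasiAffine] [IsAffine Y] (f : X ⟶ Y) [IsProper f] :
    IsAffine X := by
  have h : IsProper (X.toSpecΓ ≫ Spec.map f.appTop) := by
    rw [← Scheme.toSpecΓ_naturality]; infer_instance
  have h1 : IsProper X.toSpecΓ := IsProper.of_comp _ (Spec.map f.appTop)
  have : IsClosedImmersion X.toSpecΓ := .of_isPreimmersion _ X.toSpecΓ.isClosedMap.isClosed_range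
  exact isAffine_of_isAffineHom X.toSpecΓ

lemma isQuasiAffine_locus [NoetherianSpace X] {c : Cocycle X} (hc : AmpleCocycle c) {d : ℕ}
    (hd : 0 < d) {a : ∀ i, Γ(X, c.U i)} (ha : IsSec c d a) :
    (locus c a).toScheme.IsQuasiAffine := by
  have : CompactSpace (locus c a).toScheme :=
    isCompact_iff_compactSpace.1 (NoetherianSpace.isCompact (locus c a : Set X))
  refine .of_forall_exists_mem_basicOpen _ fun x ↦ ?_
  obtain ⟨e, t, he, ht, hxt, haff⟩ := hc x.1
  -- X_a ∩ X_t is a basic open set in both factors: in X_t, which makes it affine, and in X_a, as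
  -- the definition of quasi-affineness demands.
  obtain ⟨φ, hφ⟩ := exists_basicOpen_eq_inf he ht ha hd
  obtain ⟨ψ, hψ⟩ := exists_basicOpen_eq_inf hd ha ht he
  let φ' : Γ((locus c a).toScheme, ⊤) :=
    (locus c a).ι.appLE (locus c a) ⊤ (locus c a).ι_preimage_self.ge φ
  have h1 : (locus c a).ι ''ᵁ (locus c a).toScheme.basicOpen φ' = locus c a ⊓ locus c t := by
    rw [preimage_basicOpen_inf, top_inf_eq, hφ, Scheme.Hom.image_preimage_eq_opensRange_inf,
      Scheme.Opens.opensRange_ι, ← inf_assoc, inf_idem]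
  refine ⟨φ', ?_, ?_⟩
  · rw [← Scheme.Hom.isAffineOpen_iff_of_isOpenImmersion (locus c a).ι, h1, inf_comm, ← hψ]
    exact haff.basicOpen ψ
  · have h2 : x.1 ∈ (locus c a).ι ''ᵁ (locus c a).toScheme.basicOpen φ' := by
      rw [h1]; exact ⟨x.2, hxt⟩
    obtain ⟨y, hy, hyx⟩ := h2
    rwa [← Subtype.ext hyx]

attribute [local instance] MvPolynomial.gradedAlgebra

instance PSpace.isProper_structureMap (k : Type u) [Field k] (n : ℕ) :
    IsProper (PSpace.structureMap k n) := by
  have : IsScalarTower k (grading k n 0) (MvPolynomial (Fin (n + 1)) k) :=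
    ⟨fun a b c ↦ smul_mul_assoc a b.1 c⟩
  have : Algebra.FiniteType (grading k n 0) (MvPolynomial (Fin (n + 1)) k) :=
    .of_restrictScalars_finiteType k _ _
  -- Homogeneous polynomials of degree zero are constants, so properness over the degree zero part
  -- is properness over k.
  have : IsClosedImmersion (Spec.map (CommRingCat.ofHom (algebraMap k (grading k n 0)))) := by
    refine IsClosedImmersion.spec_of_surjective _ fun ⟨P, hP⟩ ↦ ?_
    refine ⟨MvPolynomial.coeff 0 P, Subtype.ext ?_⟩
    have := (MvPolynomial.mem_homogeneousSubmodule _ _).1 hP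
    exact (MvPolynomial.totalDegree_eq_zero_iff_eq_C.1
      (Nat.le_zero.1 this.totalDegree_le)).symm
  unfold PSpace.structureMap
  infer_instance

variable {k : Type u} [Field k] {n : ℕ}

/-- A morphism to projective space defined by powers of an ample line bundle is finite. -/
lemma isFinite_of_preimage_chart [NoetherianSpace X] {c : Cocycle X} (hc : AmpleCocycle c)
    {π : X ⟶ Spec (CommRingCat.of k)} [IsProper π] {d : ℕ} (hd : 0 < d)
    {a : Fin (n + 1) → ∀ i, Γ(X, c.U i)} (ha : ∀ l, IsSec c d (a l)) {f : X ⟶ PSpace k n}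
    (hf : f ≫ PSpace.structureMap k n = π)
    (h : ∀ l, f ⁻¹ᵁ PSpace.chart k l = locus c (a l)) : IsFinite f := by
  have : IsProper (f ≫ PSpace.structureMap k n) := hf ▸ inferInstance
  have hp : IsProper f := IsProper.of_comp f (PSpace.structureMap k n)
  refine IsFinite.iff_isProper_and_isAffineHom.2 ⟨hp, ?_⟩
  refine isAffineHom_of_forall_exists_isAffineOpen f fun y ↦ ?_
  have hy : ∃ l, y ∈ PSpace.chart k l := by
    have h1 : ⨆ l, PSpace.chart k l = (⊤ : (PSpace k n).Opens) := by
      refine Proj.iSup_basicOpen_eq_top' (grading k n) _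
        (fun l ↦ ⟨1, PSpace.X_mem_grading k l⟩) ?_
      have : IsScalarTower k (grading k n 0) (MvPolynomial (Fin (n + 1)) k) :=
        ⟨fun a b c ↦ smul_mul_assoc a b.1 c⟩
      exact adjoin_eq_top_of_tower k MvPolynomial.adjoin_range_X
    exact Opens.mem_iSup.1 (h1.ge (Opens.mem_top y))
  obtain ⟨l, hl⟩ := hy
  refine ⟨PSpace.chart k l, hl, PSpace.isAffineOpen_chart k l, ?_⟩
  have : (f ⁻¹ᵁ PSpace.chart k l).toScheme.IsQuasiAffine := by
    rw [h l]; exact isQuasiAffine_locus hc hd (ha l)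
  have : IsAffine (PSpace.chart k l).toScheme := PSpace.isAffineOpen_chart k l
  have : IsProper (f ∣_ PSpace.chart k l) := inferInstance
  exact isAffine_of_isProper (f ∣_ PSpace.chart k l)

end Finiteness


/-! ### Étale coordinates and differentials -/

section EtaleCoordinates

open TensorProduct KaehlerDifferential

variable {k : Type*} [Field k] {σ : Type*} {B : Type*} [CommRing B] [Algebra k B]

section

variable [Algebra (MvPolynomial σ k) B] [IsScalarTower k (MvPolynomial σ k) B]

lemma exists_basis_of_formallyEtale [Algebra.FormallyEtale (MvPolynomial σ k) B] :
    ∃ b : Module.Basis σ B Ω[B⁄k], ∀ i,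
      b i = D k B (algebraMap (MvPolynomial σ k) B (MvPolynomial.X i)) := by
  refine ⟨((mvPolynomialBasis k σ).baseChange B).map
    (tensorKaehlerEquivOfFormallyEtale k (MvPolynomial σ k) B), fun i ↦ ?_⟩
  simp

/-- A basis of differentials makes the base change map an isomorphism. In the Jacobi–Zariski
sequence this kills the relative differentials, and together with H1(B/k) = 0 it kills the relative
H1. -/
lemma formallyEtale_of_basis [Algebra.FormallySmooth k B] (b : Module.Basis σ B Ω[B⁄k])
    (hb : ∀ i, b i = D k B (algebraMap (MvPolynomial σ k) B (MvPolynomial.X i))) :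
    Algebra.FormallyEtale (MvPolynomial σ k) B := by
  let e := ((mvPolynomialBasis k σ).baseChange B).equiv b (Equiv.refl _)
  have he : mapBaseChange k (MvPolynomial σ k) B = e.toLinearMap := by
    refine ((mvPolynomialBasis k σ).baseChange B).ext fun i ↦ ?_
    rw [LinearEquiv.coe_coe, Module.Basis.equiv_apply, Equiv.refl_apply, hb]
    simp
  have hbij : Function.Bijective (mapBaseChange k (MvPolynomial σ k) B) := by
    rw [he]; exact e.bijective
  constructor
  · refine ⟨fun x y ↦ ?_⟩
    obtain ⟨x, rfl⟩ := KaehlerDifferential.map_surjective k (MvPolynomial σ k) B x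
    obtain ⟨y, rfl⟩ := KaehlerDifferential.map_surjective k (MvPolynomial σ k) B y
    rw [(exact_mapBaseChange_map k (MvPolynomial σ k) B x).2 (hbij.2 x),
      (exact_mapBaseChange_map k (MvPolynomial σ k) B y).2 (hbij.2 y)]
  · refine ⟨fun x y ↦ ?_⟩
    have key (x : Algebra.H1Cotangent (MvPolynomial σ k) B) : x = 0 := by
      have h1 : Algebra.H1Cotangent.δ k (MvPolynomial σ k) B x = 0 :=
        hbij.1 (by rw [map_zero]; exact
          (Algebra.H1Cotangent.exact_δ_mapBaseChange k (MvPolynomial σ k) B _).2 ⟨x, rfl⟩)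
      obtain ⟨z, rfl⟩ := (Algebra.H1Cotangent.exact_map_δ k (MvPolynomial σ k) B x).1 h1
      rw [Subsingleton.elim z 0, map_zero]
    rw [key x, key y]

end

/-- The elements `y` are étale coordinates of the `k`-algebra `B`. -/
def EtaleCoords (k : Type*) [Field k] {σ : Type*} {B : Type*} [CommRing B] [Algebra k B]
    (y : σ → B) : Prop :=
  (MvPolynomial.aeval (R := k) y).toRingHom.Etale

/-- This splits étaleness into conditions on B alone and one on the differentials dy_i, so a change
of coordinates only has to be followed on differentials. -/
lemma etaleCoords_iff [Finite σ] {y : σ → B} : EtaleCoords k y ↔ Algebra.FiniteType k B ∧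
    Algebra.FormallySmooth k B ∧ ∃ b : Module.Basis σ B Ω[B⁄k], ∀ i, b i = D k B (y i) := by
  let := (MvPolynomial.aeval (R := k) y).toRingHom.toAlgebra
  have : IsScalarTower k (MvPolynomial σ k) B :=
    .of_algebraMap_eq fun a ↦ ((MvPolynomial.aeval (R := k) y).commutes a).symm
  have hX (i) : algebraMap (MvPolynomial σ k) B (MvPolynomial.X i) = y i :=
    MvPolynomial.aeval_X y i
  refine ⟨fun h ↦ ?_, fun ⟨h1, h2, b, hb⟩ ↦ ?_⟩
  · have : Algebra.Etale (MvPolynomial σ k) B := h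
    obtain ⟨b, hb⟩ := exists_basis_of_formallyEtale (k := k) (σ := σ) (B := B)
    refine ⟨.trans (S := MvPolynomial σ k) inferInstance inferInstance,
      .comp k (MvPolynomial σ k) B, b, fun i ↦ by rw [hb, hX]⟩
  · have h3 := formallyEtale_of_basis (σ := σ) b fun i ↦ by rw [hb, hX]
    have : Algebra.FiniteType (MvPolynomial σ k) B := .of_restrictScalars_finiteType k _ _
    have : Algebra.FinitePresentation (MvPolynomial σ k) B :=
      Algebra.FinitePresentation.of_finiteType.1 this
    exact (⟨h3, this⟩ : Algebra.Etale (MvPolynomial σ k) B)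

/-- The differential of z^p is p z^(p-1) dz = 0, so the basis of differentials is literally
unchanged. -/
lemma EtaleCoords.add_pow [Finite σ] {y : σ → B} (h : EtaleCoords k y) (p : ℕ) [CharP k p]
    (z : σ → B) : EtaleCoords k (fun i ↦ y i + z i ^ p) := by
  rw [etaleCoords_iff] at h ⊢
  obtain ⟨h1, h2, b, hb⟩ := h
  refine ⟨h1, h2, b, fun i ↦ ?_⟩
  have hp : (p : B) = 0 := by rw [← map_natCast (algebraMap k B), CharP.cast_eq_zero, map_zero]
  rw [hb, map_add, Derivation.leibniz_pow, ← Nat.cast_smul_eq_nsmul B, hp, zero_smul, add_zero]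

lemma EtaleCoords.localization [Finite σ] {y : σ → B} (h : EtaleCoords k y) (f : B) {C : Type*}
    [CommRing C] [Algebra k C] [Algebra B C] [IsScalarTower k B C] [IsLocalization.Away f C] :
    EtaleCoords k (fun i ↦ algebraMap B C (y i)) := by
  let := (MvPolynomial.aeval (R := k) y).toRingHom.toAlgebra
  let := (MvPolynomial.aeval (R := k) fun i ↦ algebraMap B C (y i)).toRingHom.toAlgebra
  have : IsScalarTower (MvPolynomial σ k) B C := .of_algebraMap_eq fun P ↦
    MvPolynomial.aeval_algebraMap_apply C y P
  have h1 : Algebra.Etale B C := .of_isLocalizationAway f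
  have h2 : Algebra.Etale (MvPolynomial σ k) B := h
  exact Algebra.Etale.comp (MvPolynomial σ k) B C

lemma D_mem_of_mem_sq (q : Ideal B) {x : B} (hx : x ∈ q ^ 2) :
    D k B x ∈ q • (⊤ : Submodule B Ω[B⁄k]) := by
  rw [pow_two] at hx
  refine Submodule.mul_induction_on hx (fun a ha b hb ↦ ?_) fun a b ha hb ↦ ?_
  · rw [Derivation.leibniz]
    exact add_mem (Submodule.smul_mem_smul ha trivial) (Submodule.smul_mem_smul hb trivial)
  · rw [map_add]; exact add_mem ha hb

/-- Étale coordinates at a point remain so after a change of second order. -/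
lemma EtaleCoords.exists_of_sub_mem_sq [Finite σ] {y : σ → B} (h : EtaleCoords k y) (q : Ideal B)
    [q.IsPrime] {Y : σ → B} (hY : ∀ i, Y i - y i ∈ q ^ 2) :
    ∃ f ∉ q, ∀ (C : Type*) [CommRing C] [Algebra k C] [Algebra B C] [IsScalarTower k B C]
      [IsLocalization.Away f C], EtaleCoords k (fun i ↦ algebraMap B C (Y i)) := by
  classical
  cases nonempty_fintype σ
  obtain ⟨h1, h2, b, hb⟩ := etaleCoords_iff.1 h
  -- M expresses the dY_j in the basis dy_i. It is the identity modulo q, since d maps q² into q Ω;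
  -- inverting its determinant, which is not in q, makes the dY_j a basis.
  let M : Matrix σ σ B := fun i j ↦ b.repr (D k B (Y j)) i
  have hM (i j) : Ideal.Quotient.mk q (M i j) = (1 : Matrix σ σ (B ⧸ q)) i j := by
    have h3 := D_mem_of_mem_sq (k := k) q (hY j)
    have h4 : b.repr (D k B (Y j - y j)) i ∈ q := by
      refine Submodule.smul_induction_on h3 (fun a ha m _ ↦ ?_) fun u v hu hv ↦ ?_
      · rw [map_smul, Finsupp.smul_apply]; exact Ideal.mul_mem_right _ _ ha
      · rw [map_add, Finsupp.add_apply]; exact add_mem hu hv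
    rw [map_sub, ← hb, map_sub, Finsupp.sub_apply, b.repr_self, ← Ideal.Quotient.eq_zero_iff_mem,
      map_sub, sub_eq_zero] at h4
    rw [h4, Finsupp.single_apply, Matrix.one_apply]
    by_cases hij : i = j
    · rw [if_pos hij, if_pos hij.symm, map_one]
    · rw [if_neg hij, if_neg (Ne.symm hij), map_zero]
  refine ⟨M.det, fun hf ↦ ?_, fun C _ _ _ _ _ ↦ ?_⟩
  · rw [← Ideal.Quotient.eq_zero_iff_mem, RingHom.map_det] at hf
    have h5 : (Ideal.Quotient.mk q).mapMatrix M = 1 := by ext i j; exact hM i j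
    rw [h5, Matrix.det_one] at hf
    exact one_ne_zero hf
  · obtain ⟨h1', h2', b', hb'⟩ := etaleCoords_iff.1 (h.localization M.det (C := C))
    refine etaleCoords_iff.2 ⟨h1', h2', ?_⟩
    let M' := (algebraMap B C).mapMatrix M
    have hdet : IsUnit M'.det := by
      rw [← RingHom.map_det]; exact IsLocalization.Away.algebraMap_isUnit M.det
    have hM' : b'.toMatrix (fun i ↦ D k C (algebraMap B C (Y i))) = M' := by
      ext i j
      have h6 : D k C (algebraMap B C (Y j)) = ∑ l, algebraMap B C (M l j) • b' l := by
        rw [← KaehlerDifferential.map_D k k B C, ← b.sum_repr (D k B (Y j)), map_sum]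
        refine Finset.sum_congr rfl fun l _ ↦ ?_
        rw [map_smul, hb, KaehlerDifferential.map_D, hb', algebraMap_smul]
      rw [Module.Basis.toMatrix_apply, h6, b'.repr_sum_self]
      rfl
    obtain ⟨h7, h8⟩ := (b'.is_basis_iff_det (v := fun i ↦ D k C (algebraMap B C (Y i)))).2
      (by rw [b'.det_apply, hM']; exact hdet)
    exact ⟨Module.Basis.mk h7 h8.ge, fun i ↦ Module.Basis.mk_apply ..⟩

end EtaleCoordinates


/-! ### Separable generation at minimal primes -/

section GenericSmoothness

open TensorProduct KaehlerDifferential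

/-- Incomparability gives one inequality; lying over followed by going up lifts chains and gives the
other. -/
lemma ringKrullDim_eq_of_isIntegral {R S : Type*} [CommRing R] [CommRing S] [Algebra R S]
    [Algebra.IsIntegral R S] (hinj : Function.Injective (algebraMap R S)) :
    ringKrullDim S = ringKrullDim R := by
  refine le_antisymm (Order.krullDim_le_of_strictMono (PrimeSpectrum.comap (algebraMap R S))
    fun P Q h ↦ Ideal.IsIntegral.comap_lt_comap h) (iSup_le fun l ↦ ?_)
  have : FaithfulSMul R S := (faithfulSMul_iff_algebraMap_injective R S).2 hinj
  obtain ⟨Q, hQ1, hQ2⟩ := Ideal.exists_ideal_over_prime_of_isIntegral l.head.asIdeal (⊥ : Ideal S) (by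
    rw [← RingHom.ker_eq_comap_bot, (RingHom.injective_iff_ker_eq_bot _).1 hinj]; exact bot_le)
  have := hQ2.1
  have : Q.LiesOver l.head.asIdeal := ⟨hQ2.2.symm⟩
  obtain ⟨L, hL, -⟩ := Ideal.exists_ltSeries_of_hasGoingUp (S := S) l Q
  rw [← hL]
  exact le_iSup (fun l : LTSeries (PrimeSpectrum S) ↦ (l.length : WithBot ℕ∞)) L

variable {k B K : Type*} [Field k] [CommRing B] [Algebra k B] [Field K] [Algebra B K] [Algebra k K]
  [IsScalarTower k B K]

/-- From Σ a_i x_i^p = 0 take p-th roots β_i of the a_i in the algebraic closure. Then Σ β_i ⊗ x_i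
has p-th power zero, so it vanishes by reducedness, and independence of the x_i makes every β_i
zero. -/
lemma linearIndependent_pow_of_isReduced (p : ℕ) [CharP k p] (hp : p.Prime)
    [IsReduced (AlgebraicClosure k ⊗[k] K)] {ι : Type*} {x : ι → K} (hx : LinearIndependent k x) :
    LinearIndependent k (fun i ↦ x i ^ p) := by
  rw [linearIndependent_iff'] 
  intro s a ha i hi
  have : Fact p.Prime := ⟨hp⟩
  have : CharP (AlgebraicClosure k) p := charP_of_injective_algebraMap (algebraMap k _).injective p
  choose β hβ using fun i ↦ IsAlgClosed.exists_pow_nat_eq (algebraMap k (AlgebraicClosure k) (a i)) hp.pos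
  have : CharP (AlgebraicClosure k ⊗[k] K) p :=
    charP_of_injective_algebraMap (algebraMap k _).injective p
  have h1 : (∑ i ∈ s, β i ⊗ₜ[k] x i) ^ p = 0 := by
    rw [sum_pow_char p]
    simp only [Algebra.TensorProduct.tmul_pow, hβ]
    simp only [Algebra.algebraMap_eq_smul_one, TensorProduct.smul_tmul]
    rw [← TensorProduct.tmul_sum, ha, TensorProduct.tmul_zero]
  have h2 : ∑ i ∈ s, β i ⊗ₜ[k] x i = 0 := pow_eq_zero_iff hp.ne_zero |>.1 h1
  classical
  obtain ⟨φ, hφ'⟩ := ((Module.Basis.span hx).coord i).exists_extend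
  have hφ (j) : φ (x j) = if j = i then 1 else 0 := by
    have h3 : φ (x j) = (Module.Basis.span hx).coord i (Module.Basis.span hx j) := by
      rw [← hφ', LinearMap.comp_apply, Submodule.subtype_apply, Module.Basis.span_apply]
    rw [h3, Module.Basis.coord_apply, Module.Basis.repr_self, Finsupp.single_apply]
  have h4 := congrArg (TensorProduct.rid k (AlgebraicClosure k) ∘ φ.lTensor _) h2
  simp only [Function.comp_apply, map_sum, map_zero, LinearMap.lTensor_tmul, TensorProduct.rid_tmul,
    hφ, ite_smul, one_smul, zero_smul, Finset.sum_ite_eq', if_pos hi] at h4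
  have h5 := hβ i
  rw [h4, zero_pow hp.ne_zero] at h5
  exact ((algebraMap k (AlgebraicClosure k)).injective (by rw [map_zero, h5])).symm

lemma isReduced_tensorProduct_localization {K : Type*} [CommRing K] [Algebra B K] [Algebra k K]
    [IsScalarTower k B K] (M : Submonoid B) [IsLocalization M K]
    [IsReduced (AlgebraicClosure k ⊗[k] B)] : IsReduced (AlgebraicClosure k ⊗[k] K) := by
  let φ : AlgebraicClosure k ⊗[k] B →ₐ[AlgebraicClosure k] AlgebraicClosure k ⊗[k] K :=
    Algebra.TensorProduct.map (AlgHom.id _ _) (IsScalarTower.toAlgHom k B K)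
  let := φ.toRingHom.toAlgebra
  have : IsScalarTower (AlgebraicClosure k) (AlgebraicClosure k ⊗[k] B)
    (AlgebraicClosure k ⊗[k] K) := .of_algebraMap_eq fun x ↦ (φ.commutes x).symm
  have := IsLocalization.tensorProduct_tensorProduct_right k (AlgebraicClosure k) M K (by
    ext b
    change φ (1 ⊗ₜ b) = 1 ⊗ₜ _
    simp [φ])
  exact isReduced_of_injective _ (IsLocalization.algEquiv (M.map
    (Algebra.TensorProduct.includeRight (R := k) (A := AlgebraicClosure k)))
    (AlgebraicClosure k ⊗[k] K) (Localization (M.map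
    (Algebra.TensorProduct.includeRight (R := k) (A := AlgebraicClosure k))))).injective

/-- K is a field, so B / P embeds in it with K algebraic over the image. Noether normalization of B
/ P then gives a transcendence basis, whose size is the Krull dimension. -/
lemma exists_isTranscendenceBasis_of_localization [Algebra.FiniteType k B] (P : Ideal B)
    [P.IsPrime] [IsLocalization.AtPrime K P] {n : ℕ} (hn : ringKrullDim (B ⧸ P) = n) :
    ∃ x : Fin n → K, IsTranscendenceBasis k x := by
  have hker (b : B) : algebraMap B K b = 0 ↔ b ∈ P := by
    rw [← not_iff_not, ← ne_eq, ← isUnit_iff_ne_zero, IsLocalization.AtPrime.isUnit_to_map_iff K P]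
    rfl
  obtain ⟨r, g, hg, hg_int⟩ := exists_integral_inj_algHom_of_fg k (B ⧸ P)
  let ψ : B ⧸ P →ₐ[k] K := Ideal.Quotient.liftₐ P (IsScalarTower.toAlgHom k B K)
    fun a ha ↦ (hker a).2 ha
  have hψ : Function.Injective ψ := by
    refine (injective_iff_map_eq_zero _).2 fun a ha ↦ ?_
    obtain ⟨a, rfl⟩ := Ideal.Quotient.mk_surjective a
    exact Ideal.Quotient.eq_zero_iff_mem.2 ((hker a).1 ha)
  have hr : r = n := by
    let := g.toRingHom.toAlgebra
    have : Algebra.IsIntegral (MvPolynomial (Fin r) k) (B ⧸ P) := ⟨hg_int⟩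
    have h1 := ringKrullDim_eq_of_isIntegral (R := MvPolynomial (Fin r) k) (S := B ⧸ P) hg
    rw [hn, MvPolynomial.ringKrullDim_of_isNoetherianRing, ringKrullDim_eq_zero_of_field] at h1
    simpa using h1.symm
  subst hr
  let x : Fin r → K := fun i ↦ ψ (g (MvPolynomial.X i))
  have hx : MvPolynomial.aeval x = ψ.comp g := by ext i; simp [x]
  refine ⟨x, isTranscendenceBasis_iff_algebraicIndependent_isAlgebraic.2 ⟨?_, ?_⟩⟩
  · rw [AlgebraicIndependent, hx]
    exact hψ.comp hg
  · have key (b : B) : IsAlgebraic (Algebra.adjoin k (Set.range x)) (algebraMap B K b) := by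
      have h1 := hg_int (Ideal.Quotient.mk P b)
      let ρ : MvPolynomial (Fin r) k →ₐ[k] Algebra.adjoin k (Set.range x) :=
        MvPolynomial.aeval fun i ↦ ⟨x i, Algebra.subset_adjoin ⟨i, rfl⟩⟩
      have hρ : (Subalgebra.val _).comp ρ = ψ.comp g := by ext i; simp [ρ, x]
      obtain ⟨f, hf, hfb⟩ := h1
      refine IsIntegral.isAlgebraic ⟨f.map ρ.toRingHom, hf.map _, ?_⟩
      rw [Polynomial.eval₂_map]
      have h2 : (algebraMap (Algebra.adjoin k (Set.range x)) K).comp ρ.toRingHom =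
          ψ.toRingHom.comp g.toRingHom := congrArg AlgHom.toRingHom hρ
      have h3 := congrArg ψ.toRingHom hfb
      rw [Polynomial.hom_eval₂, map_zero] at h3
      rw [h2]
      exact h3
    refine ⟨fun z ↦ ?_⟩
    obtain ⟨b, s, rfl⟩ := IsLocalization.exists_mk'_eq P.primeCompl z
    have h2 : IsLocalization.mk' K b s = algebraMap B K b * (algebraMap B K s)⁻¹ := by
      rw [eq_mul_inv_iff_mul_eq₀ (mt (hker _).1 s.2), IsLocalization.mk'_spec]
    rw [h2]
    exact (key b).mul (key s).inv

open scoped IntermediateField.algebraAdjoinAdjoin in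
-- K is formally étale over the polynomial ring on v: pass to its isomorphic image, then to the
-- fraction field, then to a separable algebraic extension.
lemma rank_kaehlerDifferential_of_isSeparable {ι : Type*} {v : ι → K}
    (hv : AlgebraicIndependent k v)
    [Algebra.IsSeparable (IntermediateField.adjoin k (Set.range v)) K] :
    Nonempty (Module.Basis ι K Ω[K⁄k]) := by
  have h1 : Algebra.FormallyEtale (IntermediateField.adjoin k (Set.range v)) K :=
    Algebra.FormallyEtale.of_isSeparable _ K
  have h2 : Algebra.FormallyEtale (Algebra.adjoin k (Set.range v))
      (IntermediateField.adjoin k (Set.range v)) := .of_isLocalization (nonZeroDivisors _)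
  have h3 : Algebra.FormallyEtale (Algebra.adjoin k (Set.range v)) K :=
    .comp _ (IntermediateField.adjoin k (Set.range v)) _
  let := (MvPolynomial.aeval (R := k) v).toRingHom.toAlgebra
  have : IsScalarTower k (MvPolynomial ι k) K :=
    .of_algebraMap_eq fun a ↦ ((MvPolynomial.aeval (R := k) v).commutes a).symm
  have : Algebra.FormallyEtale (MvPolynomial ι k) K := by
    let := hv.aevalEquiv.toRingEquiv.toRingHom.toAlgebra
    have : IsScalarTower (MvPolynomial ι k) (Algebra.adjoin k (Set.range v)) K :=
      .of_algebraMap_eq fun a ↦ (hv.algebraMap_aevalEquiv a).symm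
    have h4 : Algebra.FormallyEtale (MvPolynomial ι k) (Algebra.adjoin k (Set.range v)) := by
      exact .of_equiv (AlgEquiv.ofBijective (Algebra.ofId _ _) hv.aevalEquiv.bijective)
    exact .comp _ (Algebra.adjoin k (Set.range v)) _
  obtain ⟨b, -⟩ := exists_basis_of_formallyEtale (k := k) (σ := ι) (B := K)
  exact ⟨b⟩

/-- The local ring of a geometrically reduced algebra at a minimal prime is formally smooth, and its
module of differentials has the expected rank. -/
theorem formallySmooth_and_finrank (p : ℕ) [CharP k p] (hp : p.Prime) [Algebra.FiniteType k B]
    [IsReduced (AlgebraicClosure k ⊗[k] B)] (P : Ideal B) [P.IsPrime] [IsLocalization.AtPrime K P]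
    {n : ℕ} (hn : ringKrullDim (B ⧸ P) = n) :
    Algebra.FormallySmooth k K ∧ Module.finrank K Ω[K⁄k] = n := by
  have := isReduced_tensorProduct_localization (k := k) (K := K) P.primeCompl
  have : Algebra.EssFiniteType B K := .of_isLocalization _ P.primeCompl
  have : Algebra.EssFiniteType k K := .comp k B K
  have : ExpChar k p := .prime hp
  obtain ⟨s, hs, hsep⟩ :=
    exists_isTranscendenceBasis_and_isSeparable_of_linearIndepOn_pow_of_essFiniteType (k := k)
      (K := K) p hp fun s hs ↦ linearIndependent_pow_of_isReduced p hp hs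
  have : Algebra.IsSeparable (IntermediateField.adjoin k (Set.range ((↑) : s → K))) K := by
    convert! hsep <;> simp
  refine ⟨.of_algebraicIndependent_of_isSeparable hs.1, ?_⟩
  obtain ⟨b⟩ := rank_kaehlerDifferential_of_isSeparable hs.1
  -- The basis from Noether normalization need not be separating; it serves only to count the
  -- separating one.
  obtain ⟨x, hx⟩ := exists_isTranscendenceBasis_of_localization (k := k) (K := K) P hn
  have h1 := hs.lift_cardinalMk_eq hx
  rw [Module.finrank_eq_nat_card_basis b]
  simpa using h1

end GenericSmoothness


/-! ### Dimension and reducedness on affine charts -/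

section GenericPoints

open TensorProduct

variable {k : Type u} [Field k] {X : Scheme.{u}} (π : X ⟶ Spec (CommRingCat.of k))

lemma kHom_finiteType [LocallyOfFiniteType π] {W : X.Opens} (hW : IsAffineOpen W) :
    (kHom π W).FiniteType := by
  have h1 : LocallyOfFiniteType (hW.fromSpec ≫ π) := inferInstance
  rw [fromSpec_comp, HasRingHomProperty.Spec_iff (P := @LocallyOfFiniteType)] at h1
  exact h1

lemma smooth_of_kHom {W : X.Opens} (hW : IsAffineOpen W) (h : (kHom π W).Smooth) :
    Smooth (W.ι ≫ π) := by
  have h1 : Smooth (hW.fromSpec ≫ π) := by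
    rw [fromSpec_comp, HasRingHomProperty.Spec_iff (P := @Smooth)]
    exact h
  rw [← hW.toSpecΓ_fromSpec, ← hW.isoSpec_hom, Category.assoc]
  infer_instance

lemma isReduced_tensorProduct [GeometricallyReduced π] {W : X.Opens} (hW : IsAffineOpen W) :
    letI := (kHom π W).toAlgebra
    _root_.IsReduced (AlgebraicClosure k ⊗[k] Γ(X, W)) := by
  let := (kHom π W).toAlgebra
  let g : Spec (.of (AlgebraicClosure k)) ⟶ Spec (CommRingCat.of k) :=
    Spec.map (CommRingCat.ofHom (algebraMap k (AlgebraicClosure k)))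
  have h1 : IsReduced (Limits.pullback π g) :=
    GeometricallyReduced.geometrically_isReduced g _ _ (.of_hasPullback π g)
  have h2 : IsReduced (Limits.pullback hW.fromSpec (Limits.pullback.fst π g)) :=
    isReduced_of_isOpenImmersion (Limits.pullback.snd _ _)
  have h3 : IsReduced (Limits.pullback (hW.fromSpec ≫ π) g) :=
    isReduced_of_isOpenImmersion (Limits.pullbackRightPullbackFstIso π g hW.fromSpec).inv
  rw [fromSpec_comp] at h3
  have h4 : IsReduced (Spec (.of (Γ(X, W) ⊗[k] AlgebraicClosure k))) :=
    isReduced_of_isOpenImmersion (pullbackSpecIso k Γ(X, W) (AlgebraicClosure k)).inv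
  rw [affine_isReduced_iff] at h4
  exact isReduced_of_injective _ (Algebra.TensorProduct.comm k (AlgebraicClosure k) Γ(X, W)).injective

/-- An arbitrary affine open set could a priori see too small a dimension, so W is taken around a
point where the dimension of Z is attained. Spec of the quotient is then homeomorphic to Z ∩ W. -/
lemma ringKrullDim_quotient_primeIdealOf {Z : Set X} {n : ℕ} (hdim : topologicalKrullDim Z = n)
    {η : X} (hη : closure {η} = Z) : ∃ (W : X.Opens) (hW : IsAffineOpen W) (h : η ∈ W),
      ringKrullDim (Γ(X, W) ⧸ (hW.primeIdealOf ⟨η, h⟩).asIdeal) = n := by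
  obtain ⟨z, hz⟩ := exists_point_topologicalKrullDim_eq hdim
  obtain ⟨_, ⟨(W : X.Opens), (hW : IsAffineOpen W), rfl⟩, hzW, -⟩ :=
    X.isBasis_affineOpens.exists_subset_of_mem_open (Set.mem_univ z.1) isOpen_univ
  have hηz : η ⤳ z.1 := by rw [specializes_iff_mem_closure, hη]; exact z.2
  have hηW : η ∈ W := hηz.mem_open W.isOpen hzW
  refine ⟨W, hW, hηW, ?_⟩
  set P := hW.primeIdealOf ⟨η, hηW⟩ with hP
  have hPη : hW.fromSpec P = η := hW.fromSpec_primeIdealOf ⟨η, hηW⟩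
  have hclosed := PrimeSpectrum.isClosedEmbedding_comap_of_surjective _
    (Ideal.Quotient.mk P.asIdeal) Ideal.Quotient.mk_surjective
  have hopen : Topology.IsOpenEmbedding hW.fromSpec := hW.fromSpec.isOpenEmbedding
  let φ : PrimeSpectrum (Γ(X, W) ⧸ P.asIdeal) → X :=
    hW.fromSpec ∘ PrimeSpectrum.comap (Ideal.Quotient.mk P.asIdeal)
  have hφ : Topology.IsEmbedding φ := hopen.isEmbedding.comp hclosed.isEmbedding
  have hspec (q : PrimeSpectrum Γ(X, W)) : hW.fromSpec q ∈ Z ↔ P.asIdeal ≤ q.asIdeal := by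
    rw [← hη, ← specializes_iff_mem_closure, ← hPη]
    exact hopen.isInducing.specializes_iff.trans (PrimeSpectrum.le_iff_specializes P q).symm
  have hmem (q) : φ q ∈ Z := (hspec _).2 (by
    rw [PrimeSpectrum.comap_asIdeal]
    exact fun a ha ↦ by
      rw [Ideal.mem_comap, Ideal.Quotient.eq_zero_iff_mem.2 ha]; exact zero_mem _)
  have hrange (z : Z) : z ∈ Set.range (Set.codRestrict φ Z hmem) ↔ z.1 ∈ W := by
    refine ⟨?_, fun h ↦ ?_⟩
    · rintro ⟨q, rfl⟩
      exact hW.range_fromSpec.le ⟨_, rfl⟩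
    · obtain ⟨q, hq⟩ := hW.range_fromSpec.ge h
      have h1 : P.asIdeal ≤ q.asIdeal := (hspec q).1 (by rw [hq]; exact z.2)
      have h2 : q ∈ Set.range (PrimeSpectrum.comap (Ideal.Quotient.mk P.asIdeal)) := by
        rw [range_comap_of_surjective _ _ Ideal.Quotient.mk_surjective,
          Ideal.mk_ker]
        exact h1
      obtain ⟨q', rfl⟩ := h2
      exact ⟨q', Subtype.ext hq⟩
  have h1 : Topology.IsOpenEmbedding (Set.codRestrict φ Z hmem) := by
    refine ⟨hφ.codRestrict Z hmem, ?_⟩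
    have : Set.range (Set.codRestrict φ Z hmem) = Subtype.val ⁻¹' (W : Set X) := by
      ext z; exact hrange z
    rw [this]
    exact W.isOpen.preimage continuous_subtype_val
  rw [← PrimeSpectrum.topologicalKrullDim_eq_ringKrullDim]
  exact hz _ _ h1 ((hrange z).2 hzW)

end GenericPoints

lemma formallySmooth_and_finrank_of_isField {k B K : Type*} [Field k] [CommRing B] [Algebra k B]
    [CommRing K] [Algebra B K] [Algebra k K] [IsScalarTower k B K] (hK : IsField K) (p : ℕ)
    [CharP k p] (hp : p.Prime) [Algebra.FiniteType k B]
    [_root_.IsReduced (TensorProduct k (AlgebraicClosure k) B)] (P : Ideal B) [P.IsPrime]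
    [IsLocalization.AtPrime K P] {n : ℕ} (hn : ringKrullDim (B ⧸ P) = n) :
    Algebra.FormallySmooth k K ∧ Module.finrank K (KaehlerDifferential k K) = n := by
  let := hK.toField
  exact formallySmooth_and_finrank p hp P hn

/-- A smooth algebra is locally standard smooth, hence locally étale over an affine space. The
number m of coordinates is identified with the dimension only later. -/
lemma exists_etaleCoords_away {k B : Type u} [Field k] [CommRing B] [Algebra k B]
    (h : (algebraMap k B).Smooth) (q : Ideal B) [q.IsPrime] :
    ∃ f ∉ q, ∃ m : ℕ, ∀ (C : Type u) [CommRing C] [Algebra k C] [Algebra B C]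
      [IsScalarTower k B C] [IsLocalization.Away f C], ∃ y : Fin m → C, EtaleCoords k y := by
  obtain ⟨s, hs, h1⟩ := RingHom.smooth_iff_locally_isStandardSmooth.1 h
  obtain ⟨t, ht, htq⟩ : ∃ t ∈ s, t ∉ q := by
    by_contra! h2
    exact Ideal.IsPrime.ne_top ‹_› (top_unique (hs ▸ Ideal.span_le.2 h2))
  obtain ⟨m, g, hg, hge⟩ := RingHom.IsStandardSmooth.exists_etale_mvPolynomial (h1 t ht)
  refine ⟨t, htq, m, fun C _ _ _ _ _ ↦ ?_⟩
  let e : Localization.Away t ≃ₐ[B] C := IsLocalization.algEquiv (.powers t) _ _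
  refine ⟨fun i ↦ e (g (.X i)), ?_⟩
  have h3 : (MvPolynomial.aeval (R := k) fun i ↦ e (g (.X i))).toRingHom =
      e.toRingEquiv.toRingHom.comp g := by
    refine MvPolynomial.ringHom_ext (fun a ↦ ?_) fun i ↦ ?_
    · have h4 := DFunLike.congr_fun hg a
      simp only [RingHom.comp_apply] at h4
      simp [h4, IsScalarTower.algebraMap_apply k B C]
    · simp
  rw [EtaleCoords, h3]
  exact RingHom.Etale.respectsIso.1 g e.toRingEquiv hge

/-! ### Étale coordinates near smooth points -/

section EtaleCoordinates

open TensorProduct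

variable {k : Type u} [Field k] {X : Scheme.{u}} (π : X ⟶ Spec (CommRingCat.of k))

/-- The structure map from the base field to a stalk. -/
def stalkHom (x : X) : k →+* X.presheaf.stalk x :=
  (X.presheaf.germ ⊤ x trivial).hom.comp (kHom π ⊤)

lemma germ_kHom {W : X.Opens} {x : X} (hx : x ∈ W) (a : k) :
    X.presheaf.germ W x hx (kHom π W a) = stalkHom π x a := by
  rw [← rs_kHom π le_top]
  exact TopCat.Presheaf.germ_res_apply X.presheaf (homOfLE le_top) x hx _

lemma notMem_primeIdealOf_iff {W : X.Opens} (hW : IsAffineOpen W) {x : X} (hx : x ∈ W)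
    (f : Γ(X, W)) : f ∉ (hW.primeIdealOf ⟨x, hx⟩).asIdeal ↔ x ∈ X.basicOpen f := by
  rw [← PrimeSpectrum.mem_basicOpen, ← hW.fromSpec_preimage_basicOpen]
  change hW.fromSpec (hW.primeIdealOf ⟨x, hx⟩) ∈ X.basicOpen f ↔ _
  rw [hW.fromSpec_primeIdealOf]

/-- As X is reduced, the stalk at a generic point is a field, so the algebraic statement for
localizations at primes applies. -/
lemma formallySmooth_stalk_and_finrank (p : ℕ) [CharP k p] (hp : p.Prime) [GeometricallyReduced π]
    [LocallyOfFiniteType π] [IsReduced X] {Z : Set X} (hZ : Z ∈ irreducibleComponents X) {n : ℕ}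
    (hdim : topologicalKrullDim Z = n) {η : X} (hη : closure {η} = Z) :
    letI := (stalkHom π η).toAlgebra
    Algebra.FormallySmooth k (X.presheaf.stalk η) ∧
      Module.finrank (X.presheaf.stalk η) Ω[X.presheaf.stalk η⁄k] = n := by
  obtain ⟨W, hW, h, hn⟩ := ringKrullDim_quotient_primeIdealOf hdim hη
  let := (stalkHom π η).toAlgebra
  let := (kHom π W).toAlgebra
  let : Algebra Γ(X, W) (X.presheaf.stalk η) := X.presheaf.algebra_section_stalk ⟨η, h⟩
  have : IsScalarTower k Γ(X, W) (X.presheaf.stalk η) :=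
    .of_algebraMap_eq fun a ↦ (germ_kHom π h a).symm
  have := isReduced_tensorProduct π hW
  have : Algebra.FiniteType k Γ(X, W) := kHom_finiteType π hW
  have : IsLocalization.AtPrime (X.presheaf.stalk η) (hW.primeIdealOf ⟨η, h⟩).asIdeal :=
    hW.isLocalization_stalk ⟨η, h⟩
  exact formallySmooth_and_finrank_of_isField
    (isField_stalk_of_closure_mem_irreducibleComponents X η (hη ▸ hZ)) p hp _ hn

lemma mem_smoothPoints_of_formallySmooth [LocallyOfFiniteType π] {x : X}
    (h : letI := (stalkHom π x).toAlgebra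
      Algebra.FormallySmooth k (X.presheaf.stalk x)) : x ∈ smoothPoints π := by
  obtain ⟨_, ⟨(W : X.Opens), (hW : IsAffineOpen W), rfl⟩, hx, -⟩ :=
    X.isBasis_affineOpens.exists_subset_of_mem_open (Set.mem_univ x) isOpen_univ
  let := (stalkHom π x).toAlgebra
  let := (kHom π W).toAlgebra
  let : Algebra Γ(X, W) (X.presheaf.stalk x) := X.presheaf.algebra_section_stalk ⟨x, hx⟩
  have : IsScalarTower k Γ(X, W) (X.presheaf.stalk x) :=
    .of_algebraMap_eq fun a ↦ (germ_kHom π hx a).symm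
  have h1 : Algebra.FiniteType k Γ(X, W) := kHom_finiteType π hW
  have : Algebra.FinitePresentation k Γ(X, W) := Algebra.FinitePresentation.of_finiteType.1 h1
  set q := (hW.primeIdealOf ⟨x, hx⟩).asIdeal with hq
  have : IsLocalization.AtPrime (X.presheaf.stalk x) q :=
    hW.isLocalization_stalk ⟨x, hx⟩
  let e : X.presheaf.stalk x ≃ₐ[Γ(X, W)] Localization.AtPrime q :=
    IsLocalization.algEquiv q.primeCompl _ _
  have h2 : Algebra.IsSmoothAt k q := Algebra.FormallySmooth.of_equiv (e.restrictScalars k)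
  obtain ⟨f, hf, h3⟩ := Algebra.IsSmoothAt.exists_notMem_smooth k q
  refine ⟨X.basicOpen f, (notMem_primeIdealOf_iff hW hx f).1 hf,
    smooth_of_kHom π (hW.basicOpen f) ?_⟩
  have := hW.isLocalization_basicOpen f
  let := (kHom π (X.basicOpen f)).toAlgebra
  have : IsScalarTower k Γ(X, W) Γ(X, X.basicOpen f) :=
    .of_algebraMap_eq fun a ↦ (rs_kHom π (X.basicOpen_le f) a).symm
  let e' : Localization.Away f ≃ₐ[Γ(X, W)] Γ(X, X.basicOpen f) :=
    IsLocalization.algEquiv (.powers f) _ _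
  exact Algebra.Smooth.of_equiv (e'.restrictScalars k)

lemma kHom_smooth_of_le {U W : X.Opens} (hW : IsAffineOpen W) (h : W ≤ U)
    (hU : Smooth (U.ι ≫ π)) : (kHom π W).Smooth := by
  have h1 : Smooth (W.ι ≫ π) := by
    rw [← X.homOfLE_ι h, Category.assoc]
    infer_instance
  have h2 : Smooth (hW.fromSpec ≫ π) := by
    rw [← hW.isoSpec_inv_ι, Category.assoc]
    infer_instance
  rwa [fromSpec_comp, HasRingHomProperty.Spec_iff (P := @Smooth)] at h2

/-- Étale coordinates near a smooth point. -/
lemma exists_etaleCoords (p : ℕ) [CharP k p] (hp : p.Prime) [GeometricallyReduced π]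
    [LocallyOfFiniteType π] [IsReduced X] {n : ℕ} (hdim : HasPureDimension X n) {x : X}
    (hx : x ∈ smoothPoints π) : ∃ (W : X.Opens) (_ : IsAffineOpen W) (_ : x ∈ W)
      (y : Fin n → Γ(X, W)), letI := (kHom π W).toAlgebra; EtaleCoords k y := by
  obtain ⟨U, hxU, hU⟩ := hx
  obtain ⟨_, ⟨(W : X.Opens), (hW : IsAffineOpen W), rfl⟩, hxW, hWU⟩ :=
    X.isBasis_affineOpens.exists_subset_of_mem_open hxU U.isOpen
  let := (kHom π W).toAlgebra
  obtain ⟨f, hf, m, hm⟩ := exists_etaleCoords_away (k := k) (B := Γ(X, W))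
    (kHom_smooth_of_le π hW hWU hU) (hW.primeIdealOf ⟨x, hxW⟩).asIdeal
  let := (kHom π (X.basicOpen f)).toAlgebra
  have : IsScalarTower k Γ(X, W) Γ(X, X.basicOpen f) :=
    .of_algebraMap_eq fun a ↦ (rs_kHom π (X.basicOpen_le f) a).symm
  have := hW.isLocalization_basicOpen f
  obtain ⟨y, hy⟩ := hm Γ(X, X.basicOpen f)
  have hxf := (notMem_primeIdealOf_iff hW hxW f).1 hf
  have hWf := hW.basicOpen f
  -- Both numbers are the rank of the differentials of the stalk at the generic point of a component
  -- through x.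
  suffices m = n by subst this; exact ⟨_, hWf, hxf, y, hy⟩
  have hZ := irreducibleComponent_mem_irreducibleComponents x
  have hη := (isIrreducible_irreducibleComponent (x := x)).closure_genericPoint
    isClosed_irreducibleComponent
  set η := (isIrreducible_irreducibleComponent (x := x)).genericPoint
  have hηf : η ∈ X.basicOpen f := by
    have : η ⤳ x := by rw [specializes_iff_mem_closure, hη]; exact mem_irreducibleComponent
    exact this.mem_open (X.basicOpen f).isOpen hxf
  have hrank := (formallySmooth_stalk_and_finrank π p hp hZ (hdim _ hZ) hη).2
  let := (stalkHom π η).toAlgebra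
  let : Algebra Γ(X, X.basicOpen f) (X.presheaf.stalk η) :=
    X.presheaf.algebra_section_stalk ⟨η, hηf⟩
  have : IsScalarTower k Γ(X, X.basicOpen f) (X.presheaf.stalk η) :=
    .of_algebraMap_eq fun a ↦ (germ_kHom π hηf a).symm
  have : IsLocalization.AtPrime (X.presheaf.stalk η) (hWf.primeIdealOf ⟨η, hηf⟩).asIdeal :=
    hWf.isLocalization_stalk ⟨η, hηf⟩
  have h1 : Algebra.FormallyEtale Γ(X, X.basicOpen f) (X.presheaf.stalk η) :=
    .of_isLocalization (hWf.primeIdealOf ⟨η, hηf⟩).asIdeal.primeCompl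
  let := (MvPolynomial.aeval (R := k) y).toRingHom.toAlgebra
  let : Algebra (MvPolynomial (Fin m) k) (X.presheaf.stalk η) :=
    ((algebraMap Γ(X, X.basicOpen f) (X.presheaf.stalk η)).comp
      (MvPolynomial.aeval (R := k) y).toRingHom).toAlgebra
  have : IsScalarTower (MvPolynomial (Fin m) k) Γ(X, X.basicOpen f) (X.presheaf.stalk η) :=
    .of_algebraMap_eq fun _ ↦ rfl
  have h2 : Algebra.Etale (MvPolynomial (Fin m) k) Γ(X, X.basicOpen f) := hy
  have h3 : Algebra.FormallyEtale (MvPolynomial (Fin m) k) (X.presheaf.stalk η) :=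
    .comp _ Γ(X, X.basicOpen f) _
  have : IsScalarTower k (MvPolynomial (Fin m) k) (X.presheaf.stalk η) :=
    .of_algebraMap_eq fun a ↦ by
      rw [IsScalarTower.algebraMap_apply k Γ(X, X.basicOpen f)]
      exact congrArg _ ((MvPolynomial.aeval (R := k) y).commutes a).symm
  obtain ⟨b, -⟩ := exists_basis_of_formallyEtale (k := k) (σ := Fin m) (B := X.presheaf.stalk η)
  rw [Module.finrank_eq_nat_card_basis b] at hrank
  simpa using hrank

end EtaleCoordinates


/-! ### Closed smooth points and zero-dimensional subschemes -/

section Points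

/-- A chain in Z is strictly extended by a component, which is never contained in Z; the extended
chain still lies in that component, of dimension n. -/
lemma topologicalKrullDim_lt_of_avoid_components {X : Type*} [TopologicalSpace X] {n : ℕ}
    (h : ∀ C ∈ irreducibleComponents X, topologicalKrullDim C = n) {Z : Set X} (hZc : IsClosed Z)
    (hZ : ∀ C ∈ irreducibleComponents X, ∃ s ∈ C, s ∉ Z) : topologicalKrullDim Z < n := by
  by_contra! hcon
  obtain ⟨l, hl⟩ := Order.le_krullDim_iff.1 hcon
  let l' := l.map _ (IrreducibleCloseds.map_strictMono_of_isInducing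
    (Topology.IsInducing.subtypeVal (t := Z)))
  obtain ⟨C, hC, hlC⟩ := exists_mem_irreducibleComponents_subset_of_isIrreducible _
    l'.last.isIrreducible
  let C' : IrreducibleCloseds X := ⟨C, hC.1, isClosed_of_mem_irreducibleComponents _ hC⟩
  have hlt : l'.last < C' := by
    refine lt_of_le_not_ge hlC fun hle ↦ ?_
    obtain ⟨s, hs, hsZ⟩ := hZ C hC
    have h1 : s ∈ l'.last := hle hs
    rw [LTSeries.last_map] at h1
    have h2 : s ∈ closure ((↑) '' (l.last : Set Z)) := h1
    exact hsZ (closure_minimal (Subtype.coe_image_subset _ _) hZc h2)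
  have hfin := length_le_topologicalKrullDim (l'.snoc C' hlt) (Z := C) (by
    rw [RelSeries.last_snoc]; exact subset_rfl)
  rw [h C hC, show (l'.snoc C' hlt).length = n + 1 by simp [l', hl]] at hfin
  exact absurd (by exact_mod_cast hfin : n + 1 ≤ n) (by omega)

lemma closure_singleton_eq_of_topologicalKrullDim_le_zero {X : Type*} [TopologicalSpace X]
    (h : topologicalKrullDim X ≤ 0) {x : X} {Z : Set X} (hZ : IsIrreducible Z) (hZc : IsClosed Z)
    (hx : x ∈ Z) : closure {x} = Z := by
  by_contra hne
  let a : IrreducibleCloseds X := ⟨closure {x}, isIrreducible_singleton.closure, isClosed_closure⟩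
  let b : IrreducibleCloseds X := ⟨Z, hZ, hZc⟩
  have hab : a < b := lt_of_le_of_ne (closure_minimal (Set.singleton_subset_iff.2 hx) hZc)
    fun h ↦ hne (congrArg (fun c : IrreducibleCloseds X ↦ (c : Set X)) h)
  have h1 := Order.le_krullDim_iff.2 ⟨(RelSeries.singleton _ a).snoc b hab, rfl⟩
  exact absurd (h1.trans h) (by simp [RelSeries.snoc, RelSeries.append])

lemma isClosed_singleton_of_topologicalKrullDim_le_zero {X : Type*} [TopologicalSpace X] [T0Space X]
    (h : topologicalKrullDim X ≤ 0) (x : X) : IsClosed {x} := by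
  have : closure {x} = {x} := by
    refine subset_antisymm (fun y hy ↦ ?_) subset_closure
    have := closure_singleton_eq_of_topologicalKrullDim_le_zero h isIrreducible_singleton.closure
      isClosed_closure hy
    exact (inseparable_iff_closure_eq.2 this).eq
  exact closure_eq_iff_isClosed.1 this

lemma finite_of_topologicalKrullDim_le_zero {X : Type*} [TopologicalSpace X] [T0Space X]
    [NoetherianSpace X] (h : topologicalKrullDim X ≤ 0) : Finite X := by
  have : Finite (irreducibleComponents X) := NoetherianSpace.finite_irreducibleComponents
  refine .of_injective (fun x : X ↦ (⟨_, irreducibleComponent_mem_irreducibleComponents x⟩ :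
    irreducibleComponents X)) fun x y hxy ↦ (inseparable_iff_closure_eq.2 ?_).eq
  have key (z : X) := closure_singleton_eq_of_topologicalKrullDim_le_zero h
    isIrreducible_irreducibleComponent isClosed_irreducibleComponent
    (mem_irreducibleComponent (x := z))
  exact (key x).trans ((congrArg Subtype.val hxy).trans (key y).symm)

variable {k : Type u} [Field k] {X : Scheme.{u}} (π : X ⟶ Spec (CommRingCat.of k))

lemma isOpen_smoothPoints : IsOpen (smoothPoints π) :=
  isOpen_iff_forall_mem_open.2 fun _ ⟨U, hx, hU⟩ ↦ ⟨U, fun _ hy ↦ ⟨U, hy, hU⟩, U.isOpen, hx⟩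

/-- The points of a zero-dimensional subscheme. -/
lemma finite_range_and_isClosed [NoetherianSpace X] [JacobsonSpace X] {S : Scheme.{u}} (ι : S ⟶ X)
    [IsImmersion ι] (hS : topologicalKrullDim S ≤ 0) :
    (Set.range ι).Finite ∧ ∀ s ∈ Set.range ι, IsClosed {s} := by
  have hemb : Topology.IsEmbedding ι := ι.isEmbedding
  have := hemb.isInducing.noetherianSpace
  have := finite_of_topologicalKrullDim_le_zero hS
  refine ⟨Set.finite_range _, ?_⟩
  rintro _ ⟨x, rfl⟩
  -- In a Jacobson space a locally closed point is closed, so a subscheme that is merely locally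
  -- closed suffices.
  apply isClosed_singleton_of_isLocallyClosed_singleton
  obtain ⟨C, hC, hCx⟩ := hemb.isInducing.isClosed_iff.1
    (isClosed_singleton_of_topologicalKrullDim_le_zero hS x)
  have h1 : ({ι x} : Set X) = Set.range ι ∩ C := by
    ext y
    constructor
    · rintro rfl
      exact ⟨⟨x, rfl⟩, show x ∈ ι ⁻¹' C from hCx ▸ rfl⟩
    · rintro ⟨⟨z, rfl⟩, hz⟩
      have : z ∈ ι ⁻¹' C := hz
      rw [hCx] at this
      rw [Set.mem_singleton_iff.1 this]; rfl
  rw [h1]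
  exact ι.isLocallyClosed_range.inter hC.isLocallyClosed

/-- Every irreducible component contains a closed smooth point outside of a given closed subset of
smaller dimension. -/
lemma exists_isClosed_smoothPoint (p : ℕ) [CharP k p] (hp : p.Prime) [GeometricallyReduced π]
    [LocallyOfFiniteType π] [IsReduced X] [JacobsonSpace X] {n : ℕ} {Z : Set X}
    (hZ : Z ∈ irreducibleComponents X) (hdim : topologicalKrullDim Z = n) {D : Set X}
    (hD : IsClosed D) (hDdim : topologicalKrullDim D < n) :
    ∃ s ∈ Z, IsClosed {s} ∧ s ∈ smoothPoints π ∧ s ∉ D := by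
  have hZc := isClosed_of_mem_irreducibleComponents _ hZ
  have hη := hZ.1.closure_genericPoint hZc
  set η := hZ.1.genericPoint
  have h1 : η ∈ smoothPoints π := mem_smoothPoints_of_formallySmooth π
    (formallySmooth_stalk_and_finrank π p hp hZ hdim hη).1
  have h2 : η ∉ D := fun h ↦ by
    have hZD : Z ⊆ D := hη ▸ closure_minimal (by simpa using h) hD
    exact hDdim.not_ge (hdim ▸ (Topology.IsEmbedding.inclusion hZD).isInducing.topologicalKrullDim_le)
  obtain ⟨s, ⟨hs1, hs2, hs3⟩, hs4⟩ := nonempty_inter_closedPoints (X := X)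
    (Z := Z ∩ (smoothPoints π ∩ Dᶜ)) ⟨η, hη ▸ subset_closure rfl, h1, h2⟩
    (hZc.isLocallyClosed.inter ((isOpen_smoothPoints π).inter hD.isOpen_compl).isLocallyClosed)
  exact ⟨s, hs1, hs4, hs2, hs3⟩

end Points

/-! ### Étaleness over the affine chart at the complement of H -/

section EtaleMorphisms

variable {k : Type u} [Field k] {X : Scheme.{u}}

lemma morphismRestrict_etale_of_appLE {Y : Scheme.{u}} (f : X ⟶ Y) {U : Y.Opens}
    (hU : IsAffineOpen U) (h : ∀ x ∈ f ⁻¹ᵁ U, ∃ (W : X.Opens) (_ : IsAffineOpen W) (_ : x ∈ W)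
      (e : W ≤ f ⁻¹ᵁ U), (f.appLE U W e).hom.Etale) : Etale (f ∣_ U) := by
  rw [HasRingHomProperty.iff_exists_appLE (P := @Etale)
    (RingHom.Etale.stableUnderComposition.stableUnderCompositionWithLocalizationAway
      fun _ _ _ _ _ r _ ↦ RingHom.etale_algebraMap.2 (.of_isLocalizationAway r)).left]
  rintro ⟨x, hx⟩
  have : IsAffine U.toScheme := hU
  obtain ⟨W, hW, hxW, e, he⟩ := h x hx
  have hle : (f ⁻¹ᵁ U).ι ⁻¹ᵁ W ≤ (f ∣_ U) ⁻¹ᵁ ⊤ := fun _ _ ↦ trivial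
  refine ⟨⟨⊤, isAffineOpen_top U.toScheme⟩, ⟨(f ⁻¹ᵁ U).ι ⁻¹ᵁ W,
    hW.preimage_of_isOpenImmersion (f ⁻¹ᵁ U).ι (by simpa using e)⟩, hxW, hle, ?_⟩
  change ((f ∣_ U).appLE ⊤ ((f ⁻¹ᵁ U).ι ⁻¹ᵁ W) hle).hom.Etale
  rw [morphismRestrict_appLE]
  have key : ∀ (U₁ : Y.Opens) (W₁ : X.Opens) (e₁ : W₁ ≤ f ⁻¹ᵁ U₁), U₁ = U → W₁ = W →
      (f.appLE U₁ W₁ e₁).hom.Etale := by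
    rintro _ _ _ rfl rfl
    exact he
  exact key _ _ _ (by simp) (by
    rw [Scheme.Hom.image_preimage_eq_opensRange_inf]; simpa using e)

variable (k) in
lemma PSpace.exists_chartEquiv (n : ℕ) :
    ∃ e : MvPolynomial (Fin n) k ≃+* Γ(PSpace k n, PSpace.chart k (0 : Fin (n + 1))),
      (∀ a, e (.C a) = kHom (PSpace.structureMap k n) _ a) ∧
      ∀ j, e (.X j) = PSpace.ratio k 0 j.succ := by
  obtain ⟨θ, hθ, hθr⟩ := PSpace.exists_ringHom k (0 : Fin (n + 1))
    (MvPolynomial.C (σ := Fin n)) (Fin.cons 1 MvPolynomial.X) rfl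
  let ψ := MvPolynomial.eval₂Hom (kHom (PSpace.structureMap k n) (PSpace.chart k 0))
    fun j : Fin n ↦ PSpace.ratio k (0 : Fin (n + 1)) j.succ
  refine ⟨RingEquiv.ofRingHom ψ θ ?_ ?_, fun a ↦ MvPolynomial.eval₂_C _ _ a,
    fun j ↦ MvPolynomial.eval₂_X _ _ j⟩
  · refine PSpace.ringHom_ext k 0 (fun a ↦ ?_) fun j ↦ ?_
    · simp [hθ, ψ]
    · rw [RingHom.comp_apply, hθr]
      refine Fin.cases ?_ (fun j ↦ ?_) j
      · simp [PSpace.ratio_self]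
      · simp [ψ]
  · refine MvPolynomial.ringHom_ext (fun a ↦ ?_) fun j ↦ ?_
    · simp [ψ, hθ]
    · simp [ψ, hθr]

/-- The functions `y` are étale coordinates on `W`. -/
def EtaleOn (π : X ⟶ Spec (CommRingCat.of k)) (W : X.Opens) {n : ℕ} (y : Fin n → Γ(X, W)) : Prop :=
  letI := (kHom π W).toAlgebra
  EtaleCoords k y

variable {π : X ⟶ Spec (CommRingCat.of k)}

lemma EtaleOn.basicOpen {W : X.Opens} (hW : IsAffineOpen W) {n : ℕ} {y : Fin n → Γ(X, W)}
    (h : EtaleOn π W y) (f : Γ(X, W)) :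
    EtaleOn π (X.basicOpen f) fun j ↦ rs (X.basicOpen_le f) (y j) := by
  let := (kHom π W).toAlgebra
  let := (kHom π (X.basicOpen f)).toAlgebra
  have : IsScalarTower k Γ(X, W) Γ(X, X.basicOpen f) :=
    .of_algebraMap_eq fun a ↦ (rs_kHom π (X.basicOpen_le f) a).symm
  have := hW.isLocalization_basicOpen f
  exact EtaleCoords.localization (C := Γ(X, X.basicOpen f)) h f

lemma EtaleOn.exists_basicOpen {W : X.Opens} (hW : IsAffineOpen W) {n : ℕ} {y Y : Fin n → Γ(X, W)}
    (h : EtaleOn π W y) {s : X} (hs : s ∈ W)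
    (hY : ∀ j, Y j - y j ∈ (hW.primeIdealOf ⟨s, hs⟩).asIdeal ^ 2) :
    ∃ f : Γ(X, W), s ∈ X.basicOpen f ∧
      EtaleOn π (X.basicOpen f) fun j ↦ rs (X.basicOpen_le f) (Y j) := by
  let := (kHom π W).toAlgebra
  obtain ⟨f, hf, hC⟩ := EtaleCoords.exists_of_sub_mem_sq (k := k) h _ hY
  let := (kHom π (X.basicOpen f)).toAlgebra
  have : IsScalarTower k Γ(X, W) Γ(X, X.basicOpen f) :=
    .of_algebraMap_eq fun a ↦ (rs_kHom π (X.basicOpen_le f) a).symm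
  have := hW.isLocalization_basicOpen f
  exact ⟨f, (notMem_primeIdealOf_iff hW hs f).1 hf, hC Γ(X, X.basicOpen f)⟩

/-- The chart x_0 ≠ 0 is the affine space on the ratios x_j / x_0, so the map on functions is étale
exactly when the pulled back ratios are étale coordinates. -/
lemma etale_morphismRestrict_of_etaleOn {n : ℕ} {f : X ⟶ PSpace k n}
    (hf : f ≫ PSpace.structureMap k n = π)
    (h : ∀ x ∈ f ⁻¹ᵁ PSpace.chart k 0, ∃ (W : X.Opens) (_ : IsAffineOpen W) (_ : x ∈ W)
      (e : W ≤ f ⁻¹ᵁ PSpace.chart k 0),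
      EtaleOn π W fun j : Fin n ↦ f.appLE _ W e (PSpace.ratio k 0 j.succ)) :
    Etale (f ∣_ PSpace.chart k (0 : Fin (n + 1))) := by
  refine morphismRestrict_etale_of_appLE f (PSpace.isAffineOpen_chart k 0) fun x hx ↦ ?_
  obtain ⟨W, hW, hxW, e, he⟩ := h x hx
  refine ⟨W, hW, hxW, e, ?_⟩
  obtain ⟨ψ, hψ, hψr⟩ := PSpace.exists_chartEquiv k n
  let := (kHom π W).toAlgebra
  have h1 := RingHom.Etale.respectsIso.2 _ ψ.symm he
  convert h1 using 1
  rw [← RingHom.comp_id (f.appLE _ W e).hom]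
  have h2 : (RingHom.id _) = ψ.toRingHom.comp ψ.symm.toRingHom := by
    ext a; simp
  rw [h2, ← RingHom.comp_assoc]
  congr 1
  refine MvPolynomial.ringHom_ext (fun a ↦ ?_) fun j ↦ ?_
  · subst hf
    simp only [RingHom.comp_apply, RingEquiv.toRingHom_eq_coe, RingEquiv.coe_toRingHom, hψ]
    exact (appLE_kHom _ f e a).trans ((MvPolynomial.aeval (R := k)
      fun j : Fin n ↦ (f.appLE _ W e).hom (PSpace.ratio k 0 j.succ)).commutes a).symm
  · simp only [RingHom.comp_apply, RingEquiv.toRingHom_eq_coe, RingEquiv.coe_toRingHom, hψr]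
    exact (MvPolynomial.aeval_X (R := k)
      (fun j : Fin n ↦ (f.appLE _ W e).hom (PSpace.ratio k 0 j.succ)) j).symm

end EtaleMorphisms


/-! ### Construction of the defining sections -/

section Sections

variable {k : Type u} [Field k] {X : Scheme.{u}} {π : X ⟶ Spec (CommRingCat.of k)} {c : Cocycle X}

/-- Rational functions that are étale coordinates at each of finitely many smooth closed points. -/
lemma AmpleCocycle.exists_etaleOn [NoetherianSpace X] (hc : AmpleCocycle c) {n : ℕ} (S : Finset X)
    (hS : ∀ s ∈ S, IsClosed {s})
    (hcoord : ∀ s ∈ S, ∃ (W : X.Opens) (_ : IsAffineOpen W) (_ : s ∈ W) (y : Fin n → Γ(X, W)),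
      EtaleOn π W y) :
    ∃ (V : X.Opens) (Y : Fin n → Γ(X, V)), ∀ s ∈ S, ∃ (W : X.Opens) (_ : IsAffineOpen W)
      (hWV : W ≤ V), s ∈ W ∧ EtaleOn π W fun j ↦ rs hWV (Y j) := by
  classical
  have hcoord' (s : X) : ∃ (W : X.Opens) (y : Fin n → Γ(X, W)), s ∈ S →
      IsAffineOpen W ∧ s ∈ W ∧ EtaleOn π W y := by
    by_cases hs : s ∈ S
    · obtain ⟨W, h1, h2, y, h3⟩ := hcoord s hs
      exact ⟨W, y, fun _ ↦ ⟨h1, h2, h3⟩⟩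
    · exact ⟨⊥, 0, fun h ↦ absurd h hs⟩
  choose W y hWy using hcoord'
  obtain ⟨d, t, hd, ht⟩ := hc.exists_separating S hS W fun s hs ↦ (hWy s hs).2.1
  choose N₀ hN₀ using fun (s : S) (j : Fin n) ↦
    exists_extension (ht s s.2).1 (rs (ht s s.2).2.2.1 (y s j))
  obtain ⟨N, hN⟩ := exists_nat_bound fun q : S × Fin n ↦ N₀ q.1 q.2
  choose b hb hbt using fun (s : S) (j : Fin n) ↦ hN₀ s j N (hN (s, j))
  -- With b_{s,j} extending y_{s,j} t_s^N, the quotient C_j / h is an average of the y_{s,j} with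
  -- weights t_s^(N+2). The 2 in the exponent puts the terms of the other points into the square of
  -- the prime at s.
  let h : ∀ i, Γ(X, c.U i) := ∑ s : S, t s ^ (N + 2)
  let C (j : Fin n) : ∀ i, Γ(X, c.U i) := ∑ s : S, b s j * t s ^ 2
  have hh : IsSec c ((N + 2) * d) h := IsSec.sum _ fun s _ ↦ (ht s s.2).1.pow (N + 2)
  have hC (j) : IsSec c ((N + 2) * d) (C j) := IsSec.sum _ fun s _ ↦ by
    rw [add_mul]; exact (hb s j).mul ((ht s s.2).1.pow 2)
  choose Y hY using fun j ↦ exists_ratio (hC j) hh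
  refine ⟨locus c h, Y, fun s hs ↦ ?_⟩
  obtain ⟨i, hi⟩ := c.cover s
  have hsU (s' : S) (hne : s' ≠ ⟨s, hs⟩) : s ∉ X.basicOpen (t s' i) := by
    rw [← (ht s' s'.2).1.mem_locus_iff hi]
    exact (ht s' s'.2).2.2.2 s hs fun h ↦ hne (Subtype.ext h.symm)
  have hsh : s ∈ locus c h := by
    rw [hh.mem_locus_iff hi, show h i = ∑ s : S, (t s ^ (N + 2)) i from Finset.sum_apply ..]
    refine mem_basicOpen_sum _ _ (Finset.mem_univ ⟨s, hs⟩) ?_ fun s' _ hne ↦ ?_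
    · rw [Pi.pow_apply, Scheme.basicOpen_pow _ _ (by omega), ← (ht s hs).1.mem_locus_iff hi]
      exact (ht s hs).2.1
    · rw [Pi.pow_apply, Scheme.basicOpen_pow _ _ (by omega)]
      exact hsU s' hne
  obtain ⟨hWs, hsW, hyW⟩ := hWy s hs
  obtain ⟨f, hf, hsf⟩ := hWs.exists_basicOpen_le
    (V := locus c (t s) ⊓ locus c h ⊓ c.U i) ⟨s, ⟨(ht s hs).2.1, hsh⟩, hi⟩ hsW
  have hft : X.basicOpen f ≤ locus c (t s) := fun _ hp ↦ (hf hp).1.1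
  have hfh : X.basicOpen f ≤ locus c h := fun _ hp ↦ (hf hp).1.2
  have hfi : X.basicOpen f ≤ c.U i := fun _ hp ↦ (hf hp).2
  have hWf := hWs.basicOpen f
  have hyf := hyW.basicOpen hWs f
  set q := (hWf.primeIdealOf ⟨s, hsf⟩).asIdeal with hq
  obtain ⟨g, hsg, hg⟩ := hyf.exists_basicOpen hWf (Y := fun j ↦ rs hfh (Y j)) hsf fun j ↦ by
    have hu : IsUnit (rs hfi (h i)) := hh.isUnit_rs hfh hfi
    have h1 := hY j i _ hfh hfi
    have hmem (s' : S) (hne : s' ≠ ⟨s, hs⟩) : rs hfi (t s' i) ∈ q := by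
      by_contra hcon
      exact hsU s' hne ((mem_basicOpen_rs hfi _ hsf).1 ((notMem_primeIdealOf_iff hWf hsf _).1 hcon))
    -- After multiplication by h, the term of s cancels and every other term is divisible by the
    -- square of some t_{s'} that vanishes at s.
    have h2 : (rs hfh (Y j) - rs (X.basicOpen_le f) (y s j)) * rs hfi (h i) ∈ q ^ 2 := by
      rw [sub_mul, h1]
      simp only [h, C, Finset.sum_apply, map_sum, Finset.mul_sum, ← Finset.sum_sub_distrib]
      refine sum_mem fun s' _ ↦ ?_
      by_cases hs' : s' = ⟨s, hs⟩
      · subst hs'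
        have h3 := hbt ⟨s, hs⟩ j i _ hft hfi
        rw [rs_rs] at h3
        rw [Pi.mul_apply, map_mul, h3, Pi.pow_apply, Pi.pow_apply, map_pow, map_pow, pow_add,
          mul_assoc, sub_self]
        exact zero_mem _
      · have h4 := Ideal.pow_mem_pow (hmem s' hs') 2
        rw [Pi.mul_apply, map_mul, Pi.pow_apply, Pi.pow_apply, map_pow, map_pow, pow_add,
          ← mul_assoc]
        exact sub_mem (Ideal.mul_mem_left _ _ h4) (Ideal.mul_mem_left _ _ h4)
    exact (Ideal.mul_unit_mem_iff_mem _ hu).1 h2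
  refine ⟨X.basicOpen g, hWf.basicOpen g, (X.basicOpen_le g).trans hfh, hsg, ?_⟩
  simpa only [rs_rs] using hg

lemma mem_basicOpen_add {U : X.Opens} {a b : Γ(X, U)} {x : X} (hb : x ∈ X.basicOpen b)
    (ha : x ∉ X.basicOpen a) : x ∈ X.basicOpen (a + b) := by
  have hx : x ∈ U := X.basicOpen_le _ hb
  by_contra hcon
  rw [← X.evaluation_eq_zero_iff_notMem_basicOpen x hx] at hcon ha
  rw [map_add, ha, zero_add, X.evaluation_eq_zero_iff_notMem_basicOpen x hx] at hcon
  exact hcon hb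

/-- Sections without common zeros whose ratios are étale coordinates on the nonvanishing locus of
the first one. -/
lemma AmpleCocycle.exists_sections [NoetherianSpace X] (hc : AmpleCocycle c) {p : ℕ} [CharP k p]
    (hp : p.Prime) {n : ℕ} (hdim : HasPureDimension X n) (S : Finset X)
    (hS : ∀ s ∈ S, IsClosed {s})
    (hcoord : ∀ s ∈ S, ∃ (W : X.Opens) (_ : IsAffineOpen W) (_ : s ∈ W) (y : Fin n → Γ(X, W)),
      EtaleOn π W y)
    (hcomp : ∀ Z ∈ irreducibleComponents X, ∃ s ∈ S, s ∈ Z)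
    {D : Set X} (hD : IsClosed D) (hSD : ∀ s ∈ S, s ∉ D) :
    ∃ (d : ℕ) (h : ∀ i, Γ(X, c.U i)), 1 ≤ d ∧ IsSec c d h ∧ (∀ s ∈ S, s ∈ locus c h) ∧
      (∀ x ∈ D, x ∉ locus c h) ∧ ∀ K : ℕ, ∃ (M : ℕ) (a : Fin (n + 1) → ∀ i, Γ(X, c.U i)),
        K ≤ M ∧ 1 ≤ M ∧ a 0 = h ^ M ∧ (∀ l, IsSec c (M * d) (a l)) ∧
        (∀ x, ∃ l, x ∈ locus c (a l)) ∧ ∀ x ∈ locus c h, ∃ (W : X.Opens) (_ : IsAffineOpen W)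
          (_ : x ∈ W) (_ : W ≤ locus c h) (r : Fin n → Γ(X, W)), EtaleOn π W r ∧
          ∀ (j : Fin n) (i : c.ι) (V : X.Opens) (hV : V ≤ W) (hU : V ≤ c.U i),
            rs hV (r j) * rs hU (a 0 i) = rs hU (a j.succ i) := by
  classical
  obtain ⟨V₀, Y, hY⟩ := hc.exists_etaleOn S hS hcoord
  choose W hW hWV hsW hYW using hY
  -- Restricting h to be supported in E makes the Y_j étale coordinates on all of X_h, not just at
  -- the points of S, and makes h vanish on D.
  let E : X.Opens := (⨆ s : S, W s s.2) ⊓ ⟨Dᶜ, hD.isOpen_compl⟩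
  obtain ⟨d, h, hd, hh, hSh, hhE⟩ := hc.exists_sec S hS E fun s hs ↦
    ⟨Opens.mem_iSup.2 ⟨⟨s, hs⟩, hsW s hs⟩, hSD s hs⟩
  have hhV : locus c h ≤ V₀ := hhE.trans (inf_le_left.trans (iSup_le fun s ↦ hWV s s.2))
  have hZ : topologicalKrullDim ((locus c h : Set X)ᶜ : Set X) < n :=
    topologicalKrullDim_lt_of_avoid_components hdim (locus c h).isOpen.isClosed_compl fun C hC ↦ by
      obtain ⟨s, hs, hsC⟩ := hcomp C hC
      exact ⟨s, hsC, fun hcon ↦ hcon (hSh s hs)⟩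
  obtain ⟨e, g, he, hg, hgZ⟩ := hc.exists_no_common_zero n (locus c h).isOpen.isClosed_compl hZ
  choose N₀ hN₀ using fun j ↦ exists_extension hh (rs hhV (Y j))
  obtain ⟨N, hN⟩ := exists_nat_bound N₀
  refine ⟨d, h, hd, hh, hSh, fun x hx hxh ↦ (hhE hxh).2 hx, fun K ↦ ?_⟩
  -- The final exponent is M = p e m: it is at least K, and M - 1 is at least N, so each Y_j h^(M-1)
  -- extends to a section. The factor p e lets a p-th power of a power of g_j have the degree of
  -- h^M.
  let m := N + K + 1
  have hpe : 0 < p * e := Nat.mul_pos hp.pos he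
  have hm : m ≤ p * e * m := Nat.le_mul_of_pos_left m hpe
  obtain ⟨M', hM'⟩ : ∃ M', p * e * m = M' + 1 := ⟨p * e * m - 1, by omega⟩
  choose b hb hbh using fun j ↦ hN₀ j M' ((hN j).trans (by omega))
  have hemd : e * m * d = d * m * e := by ring
  choose z hz using fun j ↦ exists_ratio (a := g j ^ (d * m)) (b := h ^ (e * m))
    ((hg j).pow (d * m)) (by rw [← hemd]; exact hh.pow (e * m))
  have hl : locus c (h ^ (e * m)) = locus c h := locus_pow (Nat.mul_pos he (by omega))
  have hbase (j : Fin n) : IsSec c (p * e * m * d) (b j * h) := by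
    rw [hM', add_mul, one_mul]; exact (hb j).mul hh
  have hgp (j : Fin n) : IsSec c (p * e * m * d) (g j ^ (d * m * p)) := by
    rw [show p * e * m * d = d * m * p * e by ring]; exact (hg j).pow _
  -- Here b_j extends Y_j h^(M-1); the remaining factor h makes the first summand vanish off X_h,
  -- where the g_j take over. On X_h the ratio to h^M is Y_j + z_j^p with z_j = g_j^(dm) / h^(em).
  let a : Fin (n + 1) → ∀ i, Γ(X, c.U i) :=
    Fin.cons (h ^ (p * e * m)) fun j ↦ b j * h + g j ^ (d * m * p)
  have ha0 : a 0 = h ^ (p * e * m) := rfl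
  have haj (j : Fin n) : a j.succ = b j * h + g j ^ (d * m * p) := rfl
  have ha (l) : IsSec c (p * e * m * d) (a l) := by
    refine Fin.cases ?_ (fun j ↦ ?_) l
    · exact hh.pow _
    · exact (hbase j).add (hgp j)
  refine ⟨p * e * m, a, by omega, by omega, rfl, ha, fun x ↦ ?_, fun x hx ↦ ?_⟩
  · by_cases hx : x ∈ locus c h
    · exact ⟨0, by rwa [ha0, locus_pow (by omega)]⟩
    · obtain ⟨j, hj⟩ := hgZ x hx
      obtain ⟨i, hi⟩ := c.cover x
      refine ⟨j.succ, ?_⟩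
      rw [(ha _).mem_locus_iff hi, haj]
      refine mem_basicOpen_add (a := (b j * h) i) ?_ ?_
      · rw [← (hgp j).mem_locus_iff hi, locus_pow (Nat.mul_pos (Nat.mul_pos hd (by omega)) hp.pos)]
        exact hj
      · rw [← (hbase j).mem_locus_iff hi, mem_locus_mul (hb j) hh]
        exact fun hcon ↦ hx hcon.2
  · obtain ⟨s, hs⟩ := Opens.mem_iSup.1 (hhE hx).1
    obtain ⟨f, hf, hxf⟩ := (hW s s.2).exists_basicOpen_le (V := locus c h) ⟨x, hx⟩ hs
    have h1 := (hYW s s.2).basicOpen (hW s s.2) f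
    let := (kHom π (X.basicOpen f)).toAlgebra
    refine ⟨X.basicOpen f, (hW s s.2).basicOpen f, hxf, hf, _,
      EtaleCoords.add_pow h1 p (fun j ↦ rs (hf.trans hl.ge) (z j)), fun j i V hV hU ↦ ?_⟩
    have h2 := hz j i V (hV.trans (hf.trans hl.ge)) hU
    have h3 := hbh j i V (hV.trans hf) hU
    rw [Pi.pow_apply, Pi.pow_apply, map_pow, map_pow] at h2
    rw [rs_rs] at h3
    rw [ha0, haj, map_add, map_pow, rs_rs, rs_rs, rs_rs, Pi.add_apply, Pi.mul_apply, Pi.pow_apply,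
      Pi.pow_apply, map_add, map_mul, map_pow, map_pow, h3, pow_mul (rs hU (g j i)), ← h2, add_mul,
      hM', pow_succ, ← mul_assoc, ← pow_succ, ← hM', mul_pow, ← pow_mul,
      show p * e * m = e * m * p by ring]

/-- A section vanishing on a closed subscheme is nilpotent there. -/
lemma exists_pow_pullback_eq_zero {D : Scheme.{u}} (ι : D ⟶ X) [IsClosedImmersion ι] {d : ℕ}
    {h : ∀ i, Γ(X, c.U i)} (hh : IsSec c d h) (hD : ∀ x ∈ Set.range ι, x ∉ locus c h) :
    ∃ K : ℕ, ∀ M ≥ K, ∀ i, (ι.app (c.U i) (h i)) ^ M = 0 := by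
  have := c.finite
  have key (i) : IsNilpotent (ι.app (c.U i) (h i)) := by
    -- On a quasi-compact scheme a function that vanishes at every point is nilpotent; finitely many
    -- charts give a uniform exponent.
    rw [Scheme.isNilpotent_iff_basicOpen_eq_bot_of_isCompact ((c.affine i).preimage ι).isCompact,
      ← Scheme.Hom.preimage_basicOpen, eq_bot_iff]
    exact fun x hx ↦ hD (ι x) ⟨x, rfl⟩
      ((hh.mem_locus_iff (X.basicOpen_le _ hx)).2 hx)
  choose K hK using key
  obtain ⟨N, hN⟩ := exists_nat_bound K
  exact ⟨N, fun M hM i ↦ pow_eq_zero_of_le ((hN i).trans hM) (hK i)⟩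

/-- On the preimage of chart l, x_0 / x_l times the unit a_l equals a_0, which pulls back to zero on
D. -/
lemma factorsThroughHyperplane_of_isSec {n d : ℕ} {D : Scheme.{u}} (ι : D ⟶ X)
    {a : Fin (n + 1) → ∀ i, Γ(X, c.U i)} (ha : ∀ l, IsSec c d (a l)) {f : X ⟶ PSpace k n}
    (hf : ∀ l, ∃ h : f ⁻¹ᵁ PSpace.chart k l = locus c (a l), ∀ j (i : c.ι) (V : X.Opens)
        (hV : V ≤ locus c (a l)) (hU : V ≤ c.U i),
        f.appLE _ V (hV.trans h.ge) (PSpace.ratio k l j) * rs hU (a l i) = rs hU (a j i))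
    (h0 : ∀ i, ι.app (c.U i) (a 0 i) = 0) : FactorsThroughHyperplane (ι ≫ f) := fun l ↦ by
  obtain ⟨h, H⟩ := hf l
  refine rs_ext fun x hx ↦ ?_
  obtain ⟨i, hi⟩ := c.cover (ι x)
  have hx' : ι x ∈ locus c (a l) := h.le hx
  let V : X.Opens := locus c (a l) ⊓ c.U i
  have hV : ι ⁻¹ᵁ V ≤ (ι ≫ f) ⁻¹ᵁ PSpace.chart k l := fun y hy ↦ h.ge hy.1
  refine ⟨ι ⁻¹ᵁ V, hV, ⟨hx', hi⟩, ?_⟩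
  have h1 := congrArg (ι.app V).hom (H 0 i V inf_le_left inf_le_right)
  rw [map_mul] at h1
  have hu := ((ha l).isUnit_rs (V := V) inf_le_left inf_le_right).map (ι.app V).hom
  have h2 : (ι.app V).hom (rs inf_le_right (a 0 i)) = 0 := by
    rw [Scheme.Hom.app_eq_appLE, appLE_rs]
    have := rs_appLE ι (le_rfl : ι ⁻¹ᵁ c.U i ≤ _) (V' := ι ⁻¹ᵁ V) (fun y hy ↦ hy.2) (a 0 i)
    rw [← Scheme.Hom.app_eq_appLE, h0, map_zero] at this
    exact this.symm
  rw [h2] at h1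
  have h3 := hu.mul_left_eq_zero.1 h1
  rw [map_zero, Scheme.Hom.app_eq_appLE, rs_appLE]
  rw [Scheme.Hom.app_eq_appLE] at h3
  exact (appLE_comp_apply ι f _ _ _).symm.trans h3

end Sections

end EtaleCover

end

/-! ### Assembly of the theorem -/

open EtaleCover in
theorem theorem1 {k : Type u} [Field k] (p : ℕ) [CharP k p] (hp : 0 < p) (n : ℕ)
    {X : Scheme.{u}} (π : X ⟶ Spec (CommRingCat.of k))
    (hproj : IsProjective π) (hred : GeometricallyReduced π) (hdim : HasPureDimension X n)
    (L : X.Modules) (hL : IsAmple L)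
    {D : Scheme.{u}} (ιD : D ⟶ X) (hD : IsClosedImmersion ιD) (hDdim : topologicalKrullDim D < n)
    {S : Scheme.{u}} (ιS : S ⟶ X) (hS : IsImmersion ιS) (hSdim : topologicalKrullDim S ≤ 0)
    (hSsmooth : Set.range ιS ⊆ smoothPoints π)
    (hSD : Disjoint (Set.range ιS) (Set.range ιD)) :
    ∃ f : X ⟶ PSpace k n,
      f ≫ PSpace.structureMap k n = π ∧
      IsFinite f ∧
      (∃ (d : ℕ) (s : Fin (n + 1) → Γ(tensorPow L d, ⊤)), 1 ≤ d ∧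
        IsInducedBy f (tensorPow L d) s) ∧
      Etale (f ∣_ PSpace.chart k (0 : Fin (n + 1))) ∧
      (f '' Set.range ιD ⊆ PSpace.hyperplane k n ∧ FactorsThroughHyperplane (ιD ≫ f)) ∧
      Disjoint (f '' Set.range ιS) (PSpace.hyperplane k n) := by
  classical
  have hp' : p.Prime := (CharP.char_is_prime_or_zero k p).resolve_right hp.ne'
  have hproper : IsProper π := by
    obtain ⟨N, i, hi, rfl⟩ := hproj
    infer_instance
  have := hL.compactSpace
  have : IsNoetherian X := { __ := LocallyOfFiniteType.isLocallyNoetherian π }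
  have : JacobsonSpace X := LocallyOfFiniteType.jacobsonSpace π
  have : IsReduced X := GeometricallyReduced.isReduced_of_flat_of_isLocallyNoetherian π
  obtain ⟨c, ⟨F⟩⟩ := exists_frames hL.isLineBundle
  have hc := hL.ampleCocycle F
  obtain ⟨hSfin, hSclosed⟩ := finite_range_and_isClosed ιS hSdim
  have hDclosed : IsClosed (Set.range ιD) := ιD.isClosedEmbedding.isClosed_range
  have hDdim' : topologicalKrullDim (Set.range ιD) < n :=
    (IsHomeomorph.topologicalKrullDim_eq _
      ιD.isClosedEmbedding.isEmbedding.toHomeomorph.isHomeomorph) ▸ hDdim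
  have : Finite (irreducibleComponents X) := NoetherianSpace.finite_irreducibleComponents
  choose pt hptZ hptc hpts hptD using fun Z : irreducibleComponents X ↦
    exists_isClosed_smoothPoint π p hp' Z.2 (hdim Z Z.2) hDclosed hDdim'
  -- The points `pt Z` ensure that h vanishes on no component, so that its zero set has dimension
  -- less than n even when S is empty.
  let T : Finset X := hSfin.toFinset ∪ (Set.finite_range pt).toFinset
  have hT {P : X → Prop} (h1 : ∀ s ∈ Set.range ιS, P s) (h2 : ∀ Z, P (pt Z)) : ∀ s ∈ T, P s := by
    intro s hs
    rcases Finset.mem_union.1 hs with hs | hs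
    · exact h1 s (hSfin.mem_toFinset.1 hs)
    · obtain ⟨Z, rfl⟩ := (Set.finite_range pt).mem_toFinset.1 hs
      exact h2 Z
  obtain ⟨d, h, hd, hh, hTh, hDh, H⟩ := hc.exists_sections (π := π) hp' hdim T
    (hT hSclosed hptc)
    (hT (fun s hs ↦ exists_etaleCoords π p hp' hdim (hSsmooth hs))
      fun Z ↦ exists_etaleCoords π p hp' hdim (hpts Z))
    (fun Z hZ ↦ ⟨pt ⟨Z, hZ⟩, Finset.mem_union_right _
      ((Set.finite_range pt).mem_toFinset.2 ⟨_, rfl⟩), hptZ ⟨Z, hZ⟩⟩) hDclosed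
    (hT (fun s hs hsD ↦ Set.disjoint_left.1 hSD hs hsD) hptD)
  -- K depends on h, which is why h is fixed before the exponent M. Taking M ≥ K gives factorization
  -- through H as a scheme, not only on points.
  obtain ⟨K, hK⟩ := exists_pow_pullback_eq_zero ιD hh hDh
  obtain ⟨M, a, hKM, hM, ha0, ha, hcover, hetale⟩ := H K
  obtain ⟨f, hfπ, hf⟩ := exists_hom_of_isSec π ha hcover
  have hpre : f ⁻¹ᵁ PSpace.chart k 0 = locus c h := by
    rw [(hf 0).1, ha0, locus_pow hM]
  have hMd : 1 ≤ M * d := Nat.mul_pos hM hd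
  refine ⟨f, hfπ, isFinite_of_preimage_chart hc hMd ha hfπ fun l ↦ (hf l).1, ?_, ?_, ⟨?_, ?_⟩, ?_⟩
  · obtain ⟨s, hs⟩ := isInducedBy_of_isSec F ha hf
    exact ⟨M * d, s, hMd, hs⟩
  · refine etale_morphismRestrict_of_etaleOn hfπ fun x hx ↦ ?_
    obtain ⟨W, hW, hxW, hWh, r, hr, hra⟩ := hetale x (hpre.le hx)
    refine ⟨W, hW, hxW, hWh.trans hpre.ge, ?_⟩
    have hle : W ≤ locus c (a 0) := by rwa [ha0, locus_pow hM]
    convert hr using 2 with j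
    refine rs_injective_of_isSec (ha 0) hle fun i V hV hU ↦ ?_
    rw [hra j i V hV hU, rs_appLE]
    exact (hf 0).2 j.succ i V (hV.trans hle) hU
  · rintro _ ⟨x, hx, rfl⟩ hcon
    exact hDh x hx (hpre.le hcon)
  · refine factorsThroughHyperplane_of_isSec ιD ha hf fun i ↦ ?_
    rw [ha0, Pi.pow_apply, map_pow]
    exact hK M hKM i
  · rw [Set.disjoint_left]
    rintro _ ⟨x, hx, rfl⟩ hcon
    exact hcon (hpre.ge (hTh x (Finset.mem_union_left _ (hSfin.mem_toFinset.2 hx))))
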